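/- **Setting.** A Unique Games instance with vertex set $V$ and finite alphabet $A$ is a finitely supported probability distribution over triples $(u,v,\pi)$ with $u,v\in V$ and $\pi$ a permutation of $A$; an assignment $s:V\to A$ satisfies $(u,v,\pi)$ if $s(u)=\pi(s(v))$. Its level-$r$ SoS relaxation has variables $x_{v,a}$ ($v\in V$, $a\in A$); its optimal value is the supremum of $\tilde{\mathbb E}\big[\mathbb E_{(u,v,\pi)}\sum_{a} x_{u,\pi(a)}x_{v,a}\big]$ over all linear functionals $\tilde{\mathbb E}$ on real polynomials of degree at most $r$ with $\tilde{\mathbb E}\,1=1$, $\tilde{\mathbb E}P^2\ge 0$ whenever $\deg P\le r/2$, and $\tilde{\mathbb E}(x_{v,a}^2-x_{v,a})^2=0$, $\tilde{\mathbb E}(\sum_a x_{v,a}-1)^2=0$ for all $v,a$. For $0<\epsilon<1$ let $T_{1-\epsilon}$ be the noise graph on $A^R$: a random neighbour $y$ of $x$ is obtained by independently keeping each coordinate with probability $1-\epsilon$ and replacing it by a uniform symbol otherwise. The label-extended graph of an instance with alphabet of size $R$ has vertex set $V\times A$, and its random edge is $\big((u,\pi(j)),(v,j)\big)$ for a random constraint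 $(u,v,\pi)$ and a uniform $j\in A$. Let $\mathcal U=\mathcal U_{\eta,R}$ be any Unique Games instance with alphabet $[R]$ whose label-extended graph is, up to renaming of vertices, the noise graph $T_{1-\eta}$ on $\{\pm1\}^R$ (with uniform stationary distribution). An example, for $R=2^m$, is the Khot–Vishnoi quotient noisy cube: its vertices are the cosets in $\{\pm1\}^R$ of the Hadamard code (the linear functions on $\mathbb F_2^m$); fix a representative of each coset and label a point $x$ of its coset by the codeword by which $x$ differs from the representative; a random constraint is obtained from a uniform $x\in\{\pm1\}^R$ and a random neighbour $y$ of $x$ in $T_{1-\eta}$, and relates the cosets of $x$ and of $y$ by matching the label of $xh$ with the label of $yh$ for every codeword $h$. The long-code reduction $\mathcal W=\mathcal W_{\epsilon,k}(\mathcal U)$ has vertex set $V\times\mathbb Z_k^R$ and alphabet $\mathbb Z_k$. A random constraint of it is drawn as follows: draw a random constraint $(u,v,\pi)$ of $\mathcal U$ and an independent second one $(u,v',\pi')$ conditioned on the same first vertex $u$, draw $x\in\mathbb Z_k^R$ uniformly, a random neighbour $y$ of $x$ in $T_{1-\epsilon}$, and $c\in\mathbb Z_k$ uniformly, and require of the assignment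 $F$ that $F(v',\pi'.(y-c\mathbf 1))=F(v,\pi.x)+c$, where $(\pi.x)_i=x_{\pi(i)}$. **Theorem.** There are absolute constants $c_1,C,c_2>0$ such that the following hold. 1. For all integers $k\ge 2$, all $\epsilon,\eta\in(0,1)$, all $R$ and every instance $\mathcal U_{\eta,R}$ as above, the optimal value of the level-$8$ SoS relaxation of $\mathcal W_{\epsilon,k}(\mathcal U_{\eta,R})$ is at most $$k^{-c_1\epsilon}+k^{C\log k}\cdot R^{-c_2\eta}.$$ 2. In particular, this value is close to $k^{-c_1\epsilon}$ if $\log R\gg(\log k)^2/\eta$: for every $\kappa>0$ there is $K>0$ such that, for all $k,\epsilon,\eta,R,\mathcal U_{\eta,R}$ as in 1 with $\log R\ge K(\log k)^2/\eta$, the value is at most $(1+\kappa)\,k^{-c_1\epsilon}$. 3. Eight rounds certify the value $1/100$: there is $K>0$ such that for every $\epsilon\in(0,1)$ there is $k_0$ such that for all $k\ge \max(k_0,2)$, all $\eta\in(0,1)$, and all $R$, $\mathcal U_{\eta,R}$ as above with $\log R\ge K(\log k)^2/\eta$, the value is at most $1/100$. 4. For every $m\ge 0$ and $\eta\in(0,1)$,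 the label-extended graph of the Khot–Vishnoi quotient noisy cube with $R=2^m$ is $T_{1-\eta}$, so that 1–3 apply to it. -/

import Mathlib

noncomputable section

namespace SoSUniqueGames

open MvPolynomial

/-! ### Pseudo-expectations and the SoS relaxation of a polynomial program -/

/-- `E` is a level-`r` pseudo-expectation functional on real polynomials in the variables `σ`.
Only the values of `E` on polynomials of degree at most `r` are constrained or used; every linear
functional on that subspace extends to a linear functional on all polynomials. -/
structure IsPseudoExpectation {σ : Type} (r : ℕ) (E : MvPolynomial σ ℝ →ₗ[ℝ] ℝ) : Prop where
  map_one : E 1 = 1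
  sq_nonneg : ∀ P : MvPolynomial σ ℝ, 2 * P.totalDegree ≤ r → 0 ≤ E (P ^ 2)

/-- The value of the `r`-round SoS relaxation of the program
"maximize `P₀` subject to `P ^ 2 = 0` for all `P ∈ cons`". -/
def sosValue {σ : Type} (r : ℕ) (P₀ : MvPolynomial σ ℝ) (cons : Set (MvPolynomial σ ℝ)) : EReal :=
  sSup {v : EReal | ∃ E : MvPolynomial σ ℝ →ₗ[ℝ] ℝ,
    IsPseudoExpectation r E ∧ (∀ P ∈ cons, E (P ^ 2) = 0) ∧ v = ((E P₀ : ℝ) : EReal)}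

/-! ### Unique Games -/

/-- A Unique Games instance with vertex set `V` and alphabet `A`: a finitely supported probability
distribution over constraints `(u, v, π)`, `π` a permutation of `A`. The distribution is presented
as the law of `(src e, dst e, perm e)` for `e` drawn from the finite probability space
`(Constraint, weight)`. An assignment `s : V → A` satisfies `(u, v, π)` iff `s u = π (s v)`. -/
structure UniqueGame (V A : Type) where
  Constraint : Type
  [fintypeConstraint : Fintype Constraint]
  weight : Constraint → ℝ
  weight_nonneg : ∀ e, 0 ≤ weight e
  weight_sum : ∑ e, weight e = 1
  src : Constraint → V
  dst : Constraint → V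
  perm : Constraint → Equiv.Perm A

attribute [instance] UniqueGame.fintypeConstraint

namespace UniqueGame

variable {V A : Type}

/-- The (polynomial) fraction of satisfied constraints; the variable `X (v, a)` is the `0/1`
indicator of "`v` gets the symbol `a`". -/
def objective [Fintype A] (U : UniqueGame V A) : MvPolynomial (V × A) ℝ :=
  ∑ e, C (U.weight e) * ∑ a : A, X (U.src e, U.perm e a) * X (U.dst e, a)

/-- The constraints on the variables: they are `0/1`-valued, and every vertex gets exactly one
symbol. -/
def assignmentConstraints (V A : Type) [Fintype A] : Set (MvPolynomial (V × A) ℝ) :=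
  {P | ∃ (v : V) (a : A), P = X (v, a) ^ 2 - X (v, a)} ∪
  {P | ∃ v : V, P = (∑ a : A, X (v, a)) - 1}

/-- The optimal value of the level-`r` SoS relaxation of a Unique Games instance. -/
def sosOpt [Fintype A] (r : ℕ) (U : UniqueGame V A) : EReal :=
  sosValue r U.objective (assignmentConstraints V A)

open scoped Classical in
/-- The probability that a random constraint `(u', v, π)` has `u' = u`. -/
def srcProb (U : UniqueGame V A) (u : V) : ℝ :=
  ∑ e, if U.src e = u then U.weight e else 0

open scoped Classical in
/-- The label-extended graph: the law of a random edge `((u, π j), (v, j))`, where `(u, v, π)` is a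
random constraint and `j` a uniform symbol. -/
def labelExtended [Fintype A] (U : UniqueGame V A) (p q : V × A) : ℝ :=
  (∑ e, if U.src e = p.1 ∧ U.dst e = q.1 ∧ U.perm e q.2 = p.2 then U.weight e else 0)
    / Fintype.card A

end UniqueGame

/-! ### Noise graphs -/

/-- Transition probabilities of the noise graph `T_{1-ε}` on `A^L`: each coordinate is kept with
probability `1 - ε` and otherwise replaced by a uniform symbol. -/
def noise {L A : Type} [Fintype L] [Fintype A] [DecidableEq A] (ε : ℝ) (x y : L → A) : ℝ :=
  ∏ i, ((1 - ε) * (if x i = y i then 1 else 0) + ε / Fintype.card A)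

theorem noise_nonneg {L A : Type} [Fintype L] [Fintype A] [DecidableEq A] {ε : ℝ}
    (hε : ε ∈ Set.Ioo (0 : ℝ) 1) (x y : L → A) : 0 ≤ noise ε x y := by
  obtain ⟨h0, h1⟩ := hε
  refine Finset.prod_nonneg fun i _ => add_nonneg (mul_nonneg (by linarith) ?_) (by positivity)
  split_ifs <;> norm_num

theorem noise_sum {L A : Type} [Fintype L] [DecidableEq L] [Fintype A] [DecidableEq A] [Nonempty A]
    (ε : ℝ) (x : L → A) : ∑ y : L → A, noise ε x y = 1 := by
  have hA : (Fintype.card A : ℝ) ≠ 0 := by simp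
  unfold noise
  rw [← Fintype.piFinset_univ, ← Finset.prod_univ_sum (fun _ => Finset.univ)
    (fun i a => ((1 - ε) * (if x i = a then 1 else 0) + ε / Fintype.card A : ℝ))]
  refine Finset.prod_eq_one fun i _ => ?_
  rw [Finset.sum_add_distrib, ← Finset.mul_sum]
  simp
  field_simp
  ring

/-- `G_U = T_{1-η}`: the label-extended graph of `U` is the noise graph on the cube `{±1}^L`
(written `L → ZMod 2`), up to naming of the vertices. -/
def HasNoisyCubeGraph {V L : Type} [Fintype L] (η : ℝ) (U : UniqueGame V L) : Prop :=
  ∃ φ : V × L ≃ (L → ZMod 2),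
    ∀ p q : V × L, U.labelExtended p q = noise η (φ p) (φ q) / 2 ^ Fintype.card L

/-! ### The long-code alphabet reduction -/

open scoped Classical in
theorem longCode_weight_sum {V L : Type} [Fintype L] [DecidableEq L] (k : ℕ) [NeZero k]
    (ε : ℝ) (U : UniqueGame V L) :
    ∑ t : U.Constraint × U.Constraint × (L → ZMod k) × (L → ZMod k) × ZMod k,
      (if U.src t.1 = U.src t.2.1 then
        U.weight t.1 * (U.weight t.2.1 / U.srcProb (U.src t.1)) *
          (1 / (k : ℝ) ^ Fintype.card L * noise ε t.2.2.1 t.2.2.2.1 * (1 / k))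
      else 0) = 1 := by
  have hk : (k : ℝ) ≠ 0 := by exact_mod_cast NeZero.ne k
  have inner : ∀ e e' : U.Constraint,
      ∑ s : (L → ZMod k) × (L → ZMod k) × ZMod k,
        (if U.src e = U.src e' then
          U.weight e * (U.weight e' / U.srcProb (U.src e)) *
            (1 / (k : ℝ) ^ Fintype.card L * noise ε s.1 s.2.1 * (1 / k)) else 0)
      = U.weight e / U.srcProb (U.src e) * (if U.src e' = U.src e then U.weight e' else 0) := by
    intro e e'
    by_cases h : U.src e = U.src e'
    · have h' : U.src e' = U.src e := h.symm
      simp only [h', if_true]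
      rw [← Finset.mul_sum, Fintype.sum_prod_type]
      simp only [Fintype.sum_prod_type, Finset.sum_const, Finset.card_univ, ZMod.card,
        nsmul_eq_mul]
      have : ∀ x : L → ZMod k, ∑ y : L → ZMod k,
          ((k : ℝ) * (1 / (k : ℝ) ^ Fintype.card L * noise ε x y * (1 / k)))
          = 1 / (k : ℝ) ^ Fintype.card L := by
        intro x
        have hy : ∀ y : L → ZMod k,
            (k : ℝ) * (1 / (k : ℝ) ^ Fintype.card L * noise ε x y * (1 / k))
              = 1 / (k : ℝ) ^ Fintype.card L * noise ε x y := by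
          intro y
          field_simp
        simp only [hy]
        rw [← Finset.mul_sum, noise_sum, mul_one]
      simp only [this, Finset.sum_const, Finset.card_univ, Fintype.card_fun, ZMod.card,
        nsmul_eq_mul]
      push_cast
      field_simp
    · have h' : ¬ U.src e' = U.src e := fun h' => h h'.symm
      simp [h, h']
  rw [Fintype.sum_prod_type]
  simp only [Fintype.sum_prod_type (α₁ := U.Constraint), inner]
  rw [← U.weight_sum]
  refine Finset.sum_congr rfl fun e _ => ?_
  rw [← Finset.mul_sum]
  change U.weight e / U.srcProb (U.src e) * U.srcProb (U.src e) = U.weight e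
  rcases eq_or_ne (U.srcProb (U.src e)) 0 with h | h
  · have hle : U.weight e ≤ U.srcProb (U.src e) := by
      have := Finset.single_le_sum
        (f := fun e' => if U.src e' = U.src e then U.weight e' else 0)
        (fun e' _ => by
          show 0 ≤ (if U.src e' = U.src e then U.weight e' else 0)
          split_ifs
          · exact U.weight_nonneg e'
          · exact le_rfl) (Finset.mem_univ e)
      simpa [UniqueGame.srcProb] using this
    rw [h] at hle
    rw [h, le_antisymm hle (U.weight_nonneg e)]
    simp
  · field_simp

open scoped Classical in
/-- The unique game `W_{ε,k}(U)`, with vertex set `V × Ω^L` and alphabet `Ω = ZMod k`.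
A random constraint is drawn as follows. Draw a constraint `e = (u, v, π)` of `U` and a second one
`e' = (u, v', π')` conditioned on having the same first vertex `u` (for a regular `U` the vertex `u`
is uniform); draw `x ∈ Ω^L` uniformly, a random neighbour `y` of `x` in `T_{1-ε}`, and a uniform
`c ∈ Ω`. With `(π.x) i = x (π i)`, the constraint requires of an assignment `F` that
`F (v', π'.(y - c·1)) = F (v, π.x) + c`. -/
def longCodeReduction {V L : Type} [Fintype L] [DecidableEq L] (k : ℕ) [NeZero k]
    (ε : ℝ) (hε : ε ∈ Set.Ioo (0 : ℝ) 1) (U : UniqueGame V L) :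
    UniqueGame (V × (L → ZMod k)) (ZMod k) where
  Constraint := U.Constraint × U.Constraint × (L → ZMod k) × (L → ZMod k) × ZMod k
  weight := fun t =>
    if U.src t.1 = U.src t.2.1 then
      U.weight t.1 * (U.weight t.2.1 / U.srcProb (U.src t.1)) *
        (1 / (k : ℝ) ^ Fintype.card L * noise ε t.2.2.1 t.2.2.2.1 * (1 / k))
    else 0
  weight_nonneg := by
    intro t
    split_ifs
    · have h1 := U.weight_nonneg t.1
      have h2 := U.weight_nonneg t.2.1
      have h3 := noise_nonneg hε t.2.2.1 t.2.2.2.1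
      have h4 : 0 ≤ U.srcProb (U.src t.1) := Finset.sum_nonneg fun e _ => by
        split_ifs
        · exact U.weight_nonneg e
        · exact le_rfl
      positivity
    · exact le_rfl
  weight_sum := longCode_weight_sum k ε U
  src := fun (e, _, x, _, _) => (U.dst e, fun i => x (U.perm e i))
  dst := fun (_, e', _, y, c) => (U.dst e', fun i => y (U.perm e' i) - c)
  perm := fun (_, _, _, _, c) => Equiv.subRight c

/-! ### The quotient noisy cube -/

/-- The Hadamard code: the linear functions `x ↦ ⟨s, x⟩` on `F₂^m`, as a subspace of the cube
`{±1}^R`, `R = 2^m`, whose coordinates are indexed by `F₂^m`. -/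
def hadamard (m : ℕ) : (Fin m → ZMod 2) →ₗ[ZMod 2] ((Fin m → ZMod 2) → ZMod 2) where
  toFun s := fun x => ∑ i, s i * x i
  map_add' s t := by
    funext x
    simp [add_mul, Finset.sum_add_distrib]
  map_smul' a s := by
    funext x
    simp [Finset.mul_sum, mul_assoc]

/-- The vertices: the cosets of the Hadamard code in the cube. -/
abbrev CubeQuotient (m : ℕ) : Type :=
  ((Fin m → ZMod 2) → ZMod 2) ⧸ LinearMap.range (hadamard m)

/-- The representative of a coset. -/
def cosetRep {m : ℕ} (u : CubeQuotient m) : (Fin m → ZMod 2) → ZMod 2 := Quotient.out u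

theorem exists_label {m : ℕ} (x : (Fin m → ZMod 2) → ZMod 2) :
    ∃ s : Fin m → ZMod 2,
      hadamard m s = x - cosetRep (Submodule.Quotient.mk x : CubeQuotient m) := by
  have h : (Submodule.Quotient.mk (cosetRep (Submodule.Quotient.mk x : CubeQuotient m)) :
      CubeQuotient m) = Submodule.Quotient.mk x := Quotient.out_eq _
  exact (Submodule.Quotient.eq _).1 h.symm

/-- The label of a point `x` inside its coset: the (unique) `s` such that `x` is the representative
of its coset plus the codeword of `s`. -/
def label {m : ℕ} (x : (Fin m → ZMod 2) → ZMod 2) : Fin m → ZMod 2 := (exists_label x).choose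

/-- The quotient noisy cube instance, with alphabet of size `R = 2^m`, indexed by `F₂^m`: draw a
uniform point `x` of the cube and a random neighbour `y` of `x` in `T_{1-η}`; the vertices of the
constraint are the cosets of `x` and `y`, and its permutation matches the label of `x + h` with the
label of `y + h` for every codeword `h`. -/
def khotVishnoi (m : ℕ) (η : ℝ) (hη : η ∈ Set.Ioo (0 : ℝ) 1) :
    UniqueGame (CubeQuotient m) (Fin m → ZMod 2) where
  Constraint := ((Fin m → ZMod 2) → ZMod 2) × ((Fin m → ZMod 2) → ZMod 2)
  weight := fun (x, y) => 1 / 2 ^ (2 ^ m) * noise η x y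
  weight_nonneg := fun (x, y) => mul_nonneg (by positivity) (noise_nonneg hη x y)
  weight_sum := by
    rw [Fintype.sum_prod_type]
    simp only [← Finset.mul_sum, noise_sum]
    simp [ZMod.card]
  src := fun (x, _) => Submodule.Quotient.mk x
  dst := fun (_, y) => Submodule.Quotient.mk y
  perm := fun (x, y) => Equiv.addRight (label x - label y)

end SoSUniqueGames

end

/-!
The value of the relaxation is bounded by using nothing but the constraints and the nonnegativity of
the functional on squares of quadratic polynomials in the variables. Throughout, a functional `E` on
an algebra and a subspace `W` (the affine forms) are given, functions take values in `W`, and an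
inequality for real functions is replaced by the same inequality after the application of `E`.

Write `R` for the alphabet size of the given game, `n` for its number of vertices, `f` for the
folded long codes and `g = G f` for their averages over the neighbours of a vertex. The objective is
the quadratic form of the noise operator `T_{1-ε}` on the functions `g u`
(`map_objective_longCodeReduction`). It is at most `z` plus `1 - z` times the correlation of `g`
with its part `h` of degree at most `d`, where `z` bounds `(1 - ε) ^ (d + 1)` (`form_noise_le`).
As `g` is an average of quantities with values `0` and `1`, Young's inequality bounds this
correlation by the fourth moment of `h` and the mean `1 / k` of `g` (`YoungBound`).

Hypercontractivity over a large alphabet loses powers of `k`, but only on functions with a large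
influence: up to a multiple of `∑ i, E ‖D_i g‖⁴`, with smoothed derivatives `D_i g`, the fourth
moment is bounded with a constant exponential in `d` and independent of `k`
(`NonnegOnQuartics.sum_pow_four_le`). So it remains to show that on average over `u` the sum of the
`E ‖D_i (g u)‖⁴` is small, of order `R ^ (-η / 16)`.

The pairs `(u, i)` are the vertices of the label-extended graph, which is the noisy cube. The
averaging operator `G` has a lift `T` to functions on `V × L × Ω^L` that moves the coordinate `i`
along, with `D G = T D` and `D Gᵀ = Tᵀ D` for the derivative operator `D`
(`UniqueGame.derivKernel_mul_pow`); and `T` is also a lift of the noise operator `T_{1-η}` of the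
cube `{±1} ^ R`. Split `f` along the spectrum of `S = Gᵀ G` at a threshold `l`
(`exists_spectral_split`). The part with small eigenvalues changes `g`, hence its total influence,
by little. The other part is `S ^ s f₁` with `f₁ = A₁ f` of norm at most `l ^ (-s)` times that of
`f`, and `D G S ^ s f₁ = T (Tᵀ T) ^ s D f₁`. The kernel here is a lift of `T_{1-η}` to the power
`2 s + 1`, which for `s` of order `1 / η` has small correlation. The two-point inequality, and with
it the induction proving `2 → 4` hypercontractivity, holds for all nonnegative lifts of such an
operator (`NonnegOnQuartics.hypercontractive_lift`). It turns the average of `‖·‖⁴` over the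
`n R` vertices `(u, i)` into the square of the average of `‖·‖²`. As the influences of one function
sum to at most its variance, this gains a factor `1 / R`
(`NonnegOnQuartics.sum_pairSum_deriv_le`). The choice `l = R ^ (-η / 16)` balances the two parts,
and `d` close to `(log k) / 8` gives the bound.
-/

noncomputable section

set_option linter.unusedSectionVars false

namespace SoSUniqueGames

/-! ### Matrices acting on vector-valued functions -/

section Forms

variable {A : Type*} [CommRing A] [Algebra ℝ A] {X Y Z : Type*} [Fintype X] [Fintype Y] [Fintype Z]

/-- A real matrix acting on a function with values in a real algebra. -/
def act (M : Matrix X Y ℝ) (f : Y → A) (x : X) : A := ∑ y, M x y • f y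

/-- The quadratic form `∑ M x y F(f x f y)` of a matrix, for a functional `F` on the algebra. -/
def form (F : A →ₗ[ℝ] ℝ) (M : Matrix X X ℝ) (f : X → A) : ℝ :=
  ∑ x, ∑ y, M x y * F (f x * f y)

/-- `F` is nonnegative on the squares of elements of `W`. -/
def NonnegOnSquares (W : Submodule ℝ A) (F : A →ₗ[ℝ] ℝ) : Prop := ∀ a ∈ W, 0 ≤ F (a ^ 2)

/-- The functional `p ↦ E (b² p)`. -/
def sqWeight (E : A →ₗ[ℝ] ℝ) (b : A) : A →ₗ[ℝ] ℝ := E ∘ₗ LinearMap.mulLeft ℝ (b ^ 2)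

@[simp] theorem sqWeight_apply (E : A →ₗ[ℝ] ℝ) (b p : A) : sqWeight E b p = E (b ^ 2 * p) := rfl

theorem act_mem {W : Submodule ℝ A} (M : Matrix X Y ℝ) {f : Y → A} (hf : ∀ y, f y ∈ W) (x : X) :
    act M f x ∈ W :=
  W.sum_mem fun y _ => W.smul_mem _ (hf y)

theorem act_mul (M : Matrix X Y ℝ) (N : Matrix Y Z ℝ) (f : Z → A) :
    act (M * N) f = act M (act N f) := by
  funext x
  simp only [act, Matrix.mul_apply, Finset.sum_smul, Finset.smul_sum, smul_smul]
  rw [Finset.sum_comm]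

theorem act_one [DecidableEq X] (f : X → A) : act (1 : Matrix X X ℝ) f = f := by
  funext x
  simp [act, Matrix.one_apply]

theorem act_add_left (M N : Matrix X Y ℝ) (f : Y → A) (x : X) :
    act (M + N) f x = act M f x + act N f x := by
  simp [act, add_smul, Finset.sum_add_distrib]

theorem map_act_mul_act (F : A →ₗ[ℝ] ℝ) (M : Matrix X Y ℝ) (N : Matrix Z Y ℝ) (f : Y → A)
    (x : X) (z : Z) :
    F (act M f x * act N f z) = ∑ y, ∑ y', M x y * N z y' * F (f y * f y') := by
  simp only [act, Finset.sum_mul_sum, map_sum, smul_mul_smul_comm, map_smul, smul_eq_mul]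

theorem sum_sq_act (F : A →ₗ[ℝ] ℝ) (M : Matrix X Y ℝ) (f : Y → A) :
    ∑ x, F (act M f x ^ 2) = form F (M.transpose * M) f := by
  simp only [pow_two, map_act_mul_act, form, Matrix.mul_apply, Matrix.transpose_apply,
    Finset.sum_mul]
  rw [Finset.sum_comm]
  refine Finset.sum_congr rfl fun y _ => ?_
  rw [Finset.sum_comm]

theorem form_one [DecidableEq X] (F : A →ₗ[ℝ] ℝ) (f : X → A) :
    form F 1 f = ∑ x, F (f x ^ 2) := by
  simp [form, Matrix.one_apply, pow_two]

theorem form_add (F : A →ₗ[ℝ] ℝ) (M N : Matrix X X ℝ) (f : X → A) :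
    form F (M + N) f = form F M f + form F N f := by
  simp [form, add_mul, Finset.sum_add_distrib]

theorem form_smul (F : A →ₗ[ℝ] ℝ) (c : ℝ) (M : Matrix X X ℝ) (f : X → A) :
    form F (c • M) f = c * form F M f := by
  simp [form, Finset.mul_sum, mul_assoc]

theorem form_sum {S : Type*} (s : Finset S) (F : A →ₗ[ℝ] ℝ) (M : S → Matrix X X ℝ) (f : X → A) :
    form F (∑ i ∈ s, M i) f = ∑ i ∈ s, form F (M i) f := by
  classical
  induction s using Finset.induction_on with
  | empty => simp [form]
  | insert a s ha ih => rw [Finset.sum_insert ha, Finset.sum_insert ha, form_add, ih]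

theorem form_mul_diagonal_mul [DecidableEq X] (F : A →ₗ[ℝ] ℝ) (U : Matrix X X ℝ) (d : X → ℝ)
    (f : X → A) :
    form F (U * Matrix.diagonal d * U.transpose) f
      = ∑ x, d x * F (act U.transpose f x ^ 2) := by
  have e : ∀ y y', (U * Matrix.diagonal d * U.transpose) y y' = ∑ x, U y x * d x * U y' x := by
    intro y y'
    rw [Matrix.mul_apply]
    simp only [Matrix.mul_diagonal, Matrix.transpose_apply]
  simp only [pow_two, map_act_mul_act, form, e, Matrix.transpose_apply, Finset.mul_sum,
    Finset.sum_mul]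
  have h : ∀ y : X, ∑ y', ∑ x, U y x * d x * U y' x * F (f y * f y')
      = ∑ x, ∑ y', d x * (U y x * U y' x * F (f y * f y')) := fun y => by
    rw [Finset.sum_comm]
    exact Finset.sum_congr rfl fun x _ => Finset.sum_congr rfl fun y' _ => by ring
  rw [Finset.sum_congr rfl fun y _ => h y, Finset.sum_comm]

/-- The Schur test: a matrix with nonnegative entries whose rows and columns have sum at most one
is a contraction. -/
theorem sum_sq_act_le {W : Submodule ℝ A} {F : A →ₗ[ℝ] ℝ} (hF : NonnegOnSquares W F)
    {K : Matrix X Y ℝ} (h0 : ∀ x y, 0 ≤ K x y) (hr : ∀ x, ∑ y, K x y ≤ 1)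
    (hc : ∀ y, ∑ x, K x y ≤ 1) {f : Y → A} (hf : ∀ y, f y ∈ W) :
    ∑ x, F (act K f x ^ 2) ≤ ∑ y, F (f y ^ 2) := by
  have key : ∀ y y', F (f y * f y') ≤ (F (f y ^ 2) + F (f y' ^ 2)) / 2 := by
    intro y y'
    have h := hF _ (W.sub_mem (hf y) (hf y'))
    have e : (f y - f y') ^ 2 = f y ^ 2 + f y' ^ 2 - (2 : ℝ) • (f y * f y') := by
      rw [two_smul]; ring
    rw [e, map_sub, map_add, map_smul, smul_eq_mul] at h
    linarith
  have h1 : ∀ x, F (act K f x ^ 2) ≤ ∑ y, K x y * F (f y ^ 2) := by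
    intro x
    rw [pow_two, map_act_mul_act]
    have hx : ∑ y, ∑ y', K x y * K x y' * F (f y * f y')
        ≤ ∑ y, ∑ y', (K x y * K x y' * F (f y ^ 2) / 2 + K x y * K x y' * F (f y' ^ 2) / 2) := by
      refine Finset.sum_le_sum fun y _ => Finset.sum_le_sum fun y' _ => ?_
      have := mul_le_mul_of_nonneg_left (key y y') (mul_nonneg (h0 x y) (h0 x y'))
      linarith
    refine hx.trans ?_
    have e : ∑ y, ∑ y', (K x y * K x y' * F (f y ^ 2) / 2 + K x y * K x y' * F (f y' ^ 2) / 2)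
        = (∑ y', K x y') * ∑ y, K x y * F (f y ^ 2) := by
      simp only [Finset.sum_add_distrib]
      have e2 : ∑ y, ∑ y', K x y * K x y' * F (f y' ^ 2) / 2
          = ∑ y, ∑ y', K x y * K x y' * F (f y ^ 2) / 2 := by
        rw [Finset.sum_comm]
        exact Finset.sum_congr rfl fun y _ => Finset.sum_congr rfl fun y' _ => by ring
      rw [e2, ← Finset.sum_add_distrib, Finset.sum_mul_sum, Finset.sum_comm]
      refine Finset.sum_congr rfl fun y _ => ?_
      rw [← Finset.sum_add_distrib]
      exact Finset.sum_congr rfl fun y' _ => by ring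
    rw [e]
    have hn : 0 ≤ ∑ y, K x y * F (f y ^ 2) :=
      Finset.sum_nonneg fun y _ => mul_nonneg (h0 x y) (hF _ (hf y))
    exact mul_le_of_le_one_left hn (hr x)
  calc ∑ x, F (act K f x ^ 2) ≤ ∑ x, ∑ y, K x y * F (f y ^ 2) := Finset.sum_le_sum fun x _ => h1 x
    _ = ∑ y, (∑ x, K x y) * F (f y ^ 2) := by
        rw [Finset.sum_comm]; simp only [Finset.sum_mul]
    _ ≤ ∑ y, F (f y ^ 2) := Finset.sum_le_sum fun y _ =>
        mul_le_of_le_one_left (hF _ (hf y)) (hc y)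

/-- Jensen's inequality for a single average. -/
theorem sq_act_le {W : Submodule ℝ A} {F : A →ₗ[ℝ] ℝ} (hF : NonnegOnSquares W F)
    {w : Y → ℝ} (h0 : ∀ y, 0 ≤ w y) (h1 : ∑ y, w y = 1) {f : Y → A} (hf : ∀ y, f y ∈ W) :
    F ((∑ y, w y • f y) ^ 2) ≤ ∑ y, w y * F (f y ^ 2) := by
  set a := ∑ y, w y • f y with ha
  have hm : a ∈ W := W.sum_mem fun y _ => W.smul_mem _ (hf y)
  have h : 0 ≤ ∑ y, w y * F ((f y - a) ^ 2) :=
    Finset.sum_nonneg fun y _ => mul_nonneg (h0 y) (hF _ (W.sub_mem (hf y) hm))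
  have e : ∀ y, w y * F ((f y - a) ^ 2)
      = w y * F (f y ^ 2) - 2 * F ((w y • f y) * a) + w y * F (a ^ 2) := by
    intro y
    have e : (f y - a) ^ 2 = f y ^ 2 - (2 : ℝ) • (f y * a) + a ^ 2 := by rw [two_smul]; ring
    rw [e, map_add, map_sub, map_smul, smul_mul_assoc, map_smul, smul_eq_mul, smul_eq_mul]
    ring
  simp only [e, Finset.sum_add_distrib, Finset.sum_sub_distrib, ← Finset.mul_sum, ← map_sum,
    ← Finset.sum_mul, ← ha, h1] at h
  rw [← pow_two] at h
  linarith

end Forms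

section Kernels

variable {A : Type*} [CommRing A] [Algebra ℝ A]
variable {ι Ω : Type} [Fintype ι] [DecidableEq ι] [Fintype Ω] [DecidableEq Ω]

/-- The product kernel on `Ω^ι` that acts on the functions of the coordinate `i` by the scalar `a i`
on constants and by the scalar `b i` on functions of mean zero. -/
def prodKernel (a b : ι → ℝ) : Matrix (ι → Ω) (ι → Ω) ℝ := fun x y =>
  ∏ i, (a i / Fintype.card Ω + b i * ((if x i = y i then 1 else 0) - 1 / Fintype.card Ω))

/-- The projection to the Efron–Stein component of a set `S` of coordinates. -/
def levelProj (S : Finset ι) : Matrix (ι → Ω) (ι → Ω) ℝ :=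
  prodKernel (fun i => if i ∈ S then 0 else 1) (fun i => if i ∈ S then 1 else 0)

/-- The operator acting on the Efron–Stein component of `S` by the scalar `w S`. -/
def multiplier (w : Finset ι → ℝ) : Matrix (ι → Ω) (ι → Ω) ℝ := ∑ S, w S • levelProj S

theorem prodKernel_comm (a b : ι → ℝ) (x y : ι → Ω) :
    prodKernel a b x y = prodKernel a b y x := by
  simp only [prodKernel, eq_comm]

theorem noise_eq_prodKernel (ε : ℝ) (x y : ι → Ω) :
    noise ε x y = prodKernel (fun _ => 1) (fun _ => 1 - ε) x y := by
  unfold noise prodKernel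
  refine Finset.prod_congr rfl fun i _ => ?_
  ring

theorem prodKernel_mul [Nonempty Ω] (a b a' b' : ι → ℝ) :
    (prodKernel a b * prodKernel a' b' : Matrix (ι → Ω) (ι → Ω) ℝ)
      = prodKernel (fun i => a i * a' i) (fun i => b i * b' i) := by
  have hk : (Fintype.card Ω : ℝ) ≠ 0 := by simp
  ext x y
  simp only [Matrix.mul_apply, prodKernel, ← Finset.prod_mul_distrib]
  rw [← Fintype.piFinset_univ, ← Finset.prod_univ_sum (fun _ => Finset.univ) (fun i c =>
    (a i / Fintype.card Ω + b i * ((if x i = c then 1 else 0) - 1 / Fintype.card Ω)) *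
    (a' i / Fintype.card Ω + b' i * ((if c = y i then 1 else 0) - 1 / Fintype.card Ω)))]
  refine Finset.prod_congr rfl fun i _ => ?_
  have e : ∀ c : Ω,
      (a i / Fintype.card Ω + b i * ((if x i = c then 1 else 0) - 1 / Fintype.card Ω)) *
      (a' i / Fintype.card Ω + b' i * ((if c = y i then 1 else 0) - 1 / Fintype.card Ω))
      = (a i - b i) / Fintype.card Ω * ((a' i - b' i) / Fintype.card Ω)
        + (if x i = c then b i * ((a' i - b' i) / Fintype.card Ω) else 0)
        + (if c = y i then b' i * ((a i - b i) / Fintype.card Ω) else 0)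
        + (if x i = c then (if c = y i then b i * b' i else 0) else 0) := by
    intro c
    split_ifs <;> ring
  simp only [e, Finset.sum_add_distrib, Finset.sum_ite_eq, Finset.sum_ite_eq', Finset.mem_univ,
    if_true, Finset.sum_const, Finset.card_univ, nsmul_eq_mul]
  split_ifs <;> field_simp <;> ring

theorem prodKernel_eq_multiplier (a b : ι → ℝ) :
    (prodKernel a b : Matrix (ι → Ω) (ι → Ω) ℝ)
      = multiplier fun S => (∏ i ∈ S, b i) * ∏ i ∈ Sᶜ, a i := by
  ext x y
  simp only [multiplier, Matrix.sum_apply, Matrix.smul_apply, smul_eq_mul, levelProj, prodKernel]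
  have h : ∀ i,
      (a i / Fintype.card Ω + b i * ((if x i = y i then 1 else 0) - 1 / Fintype.card Ω) : ℝ)
      = b i * ((if x i = y i then 1 else 0) - 1 / Fintype.card Ω) + a i / Fintype.card Ω :=
    fun i => add_comm _ _
  rw [Finset.prod_congr rfl fun i _ => h i, Finset.prod_add, Finset.powerset_univ]
  refine Finset.sum_congr rfl fun S _ => ?_
  rw [← Finset.compl_eq_univ_sdiff, ← Finset.prod_mul_prod_compl S (fun i =>
    ((if i ∈ S then (0 : ℝ) else 1) / Fintype.card Ω + (if i ∈ S then (1 : ℝ) else 0) *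
      ((if x i = y i then 1 else 0) - 1 / Fintype.card Ω))), Finset.prod_mul_distrib]
  have e1 : ∏ i ∈ S, ((if i ∈ S then (0 : ℝ) else 1) / Fintype.card Ω +
      (if i ∈ S then (1 : ℝ) else 0) *
      ((if x i = y i then 1 else 0) - 1 / Fintype.card Ω))
      = ∏ i ∈ S, ((if x i = y i then 1 else 0) - 1 / Fintype.card Ω : ℝ) :=
    Finset.prod_congr rfl fun i hi => by simp [hi]
  have e2 : ∏ i ∈ Sᶜ, ((if i ∈ S then (0 : ℝ) else 1) / Fintype.card Ω +
      (if i ∈ S then (1 : ℝ) else 0) * ((if x i = y i then 1 else 0) - 1 / Fintype.card Ω))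
      = ∏ i ∈ Sᶜ, (1 / Fintype.card Ω : ℝ) :=
    Finset.prod_congr rfl fun i hi => by simp [Finset.mem_compl.1 hi]
  have e3 : ∏ i ∈ Sᶜ, (a i / Fintype.card Ω : ℝ)
      = (∏ i ∈ Sᶜ, a i) * ∏ i ∈ Sᶜ, (1 / Fintype.card Ω : ℝ) := by
    rw [← Finset.prod_mul_distrib]
    exact Finset.prod_congr rfl fun i _ => by ring
  rw [e1, e2, e3]
  ring

theorem levelProj_mul [Nonempty Ω] (S S' : Finset ι) :
    (levelProj S * levelProj S' : Matrix (ι → Ω) (ι → Ω) ℝ)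
      = if S = S' then levelProj S else 0 := by
  unfold levelProj
  rw [prodKernel_mul]
  split_ifs with h
  · subst h
    congr 1 <;> funext i <;> split_ifs <;> simp
  · ext x y
    obtain ⟨i, hi⟩ : ∃ i, ¬ (i ∈ S ↔ i ∈ S') := by
      by_contra hc
      push Not at hc
      exact h (Finset.ext hc)
    rw [Matrix.zero_apply]
    refine Finset.prod_eq_zero (Finset.mem_univ i) ?_
    by_cases h1 : i ∈ S <;> by_cases h2 : i ∈ S' <;> simp_all

theorem multiplier_mul [Nonempty Ω] (w w' : Finset ι → ℝ) :
    (multiplier w * multiplier w' : Matrix (ι → Ω) (ι → Ω) ℝ)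
      = multiplier fun S => w S * w' S := by
  unfold multiplier
  rw [Finset.sum_mul_sum]
  refine Finset.sum_congr rfl fun S _ => ?_
  simp [levelProj_mul, smul_smul, mul_comm]

theorem levelProj_transpose (S : Finset ι) :
    (levelProj S : Matrix (ι → Ω) (ι → Ω) ℝ).transpose = levelProj S := by
  ext x y
  exact prodKernel_comm _ _ _ _

theorem multiplier_transpose (w : Finset ι → ℝ) :
    (multiplier w : Matrix (ι → Ω) (ι → Ω) ℝ).transpose = multiplier w := by
  simp [multiplier, Matrix.transpose_sum, levelProj_transpose]

theorem multiplier_one [Nonempty Ω] :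
    (multiplier (fun _ => 1) : Matrix (ι → Ω) (ι → Ω) ℝ) = 1 := by
  have h := prodKernel_eq_multiplier (ι := ι) (Ω := Ω) (fun _ => 1) (fun _ => 1)
  simp only [Finset.prod_const_one, mul_one] at h
  rw [← h]
  ext x y
  simp only [prodKernel, Matrix.one_apply]
  split_ifs with hxy
  · subst hxy; simp
  · obtain ⟨i, hi⟩ := Function.ne_iff.1 hxy
    exact Finset.prod_eq_zero (Finset.mem_univ i) (by simp [hi])

theorem form_multiplier (F : A →ₗ[ℝ] ℝ) (w : Finset ι → ℝ) (f : (ι → Ω) → A) :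
    form F (multiplier w) f = ∑ S, w S * form F (levelProj S) f := by
  simp only [multiplier, form_sum, form_smul]

theorem form_levelProj_nonneg [Nonempty Ω] {W : Submodule ℝ A} {F : A →ₗ[ℝ] ℝ}
    (hF : NonnegOnSquares W F) (S : Finset ι) {f : (ι → Ω) → A} (hf : ∀ x, f x ∈ W) :
    0 ≤ form F (levelProj S) f := by
  have h : (levelProj S : Matrix (ι → Ω) (ι → Ω) ℝ)
      = (levelProj S).transpose * levelProj S := by
    rw [levelProj_transpose, levelProj_mul, if_pos rfl]
  rw [h, ← sum_sq_act]
  exact Finset.sum_nonneg fun x _ => hF _ (act_mem _ hf x)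

theorem form_multiplier_mono [Nonempty Ω] {W : Submodule ℝ A} {F : A →ₗ[ℝ] ℝ}
    (hF : NonnegOnSquares W F) {w w' : Finset ι → ℝ} (h : ∀ S, w S ≤ w' S) {f : (ι → Ω) → A}
    (hf : ∀ x, f x ∈ W) : form F (multiplier w) f ≤ form F (multiplier w') f := by
  rw [form_multiplier, form_multiplier]
  exact Finset.sum_le_sum fun S _ =>
    mul_le_mul_of_nonneg_right (h S) (form_levelProj_nonneg hF S hf)

/-- Parseval's identity for the Efron–Stein decomposition. -/
theorem sum_sq_act_multiplier [Nonempty Ω] (F : A →ₗ[ℝ] ℝ) (w : Finset ι → ℝ)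
    (f : (ι → Ω) → A) :
    ∑ x, F (act (multiplier w) f x ^ 2) = form F (multiplier fun S => w S ^ 2) f := by
  rw [sum_sq_act, multiplier_transpose, multiplier_mul]
  simp only [pow_two]

theorem sum_sq_eq_form_multiplier [Nonempty Ω] (F : A →ₗ[ℝ] ℝ) (f : (ι → Ω) → A) :
    ∑ x, F (f x ^ 2) = form F (multiplier fun _ => 1) f := by
  rw [multiplier_one, form_one]

end Kernels

/-! ### Hypercontractivity for lifts of the noise operator -/

section Twisted

variable {A : Type*} [CommRing A] [Algebra ℝ A]

/-- `E` is nonnegative on the squares of all sums of products of two elements of `W`. -/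
def NonnegOnQuartics (W : Submodule ℝ A) (E : A →ₗ[ℝ] ℝ) : Prop := ∀ P ∈ W * W, 0 ≤ E (P ^ 2)

variable {W : Submodule ℝ A} {E : A →ₗ[ℝ] ℝ}

theorem NonnegOnQuartics.sqWeight (hE : NonnegOnQuartics W E) {b : A} (hb : b ∈ W) :
    NonnegOnSquares W (sqWeight E b) := fun a ha => by
  have h := hE _ (Submodule.mul_mem_mul hb ha)
  rwa [sqWeight_apply, ← mul_pow]

theorem NonnegOnQuartics.sq_mul_sq_nonneg (hE : NonnegOnQuartics W E) {a b : A} (ha : a ∈ W)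
    (hb : b ∈ W) : 0 ≤ E (a ^ 2 * b ^ 2) := by
  have h := hE _ (Submodule.mul_mem_mul ha hb)
  rwa [mul_pow] at h

/-- The inequality between the arithmetic and the geometric mean for two products. -/
theorem NonnegOnQuartics.two_mul_le (hE : NonnegOnQuartics W E) {a b c d : A} (ha : a ∈ W)
    (hb : b ∈ W) (hc : c ∈ W) (hd : d ∈ W) :
    2 * E (a * b * c * d) ≤ E (a ^ 2 * b ^ 2) + E (c ^ 2 * d ^ 2) := by
  have h := hE _ (Submodule.sub_mem _ (Submodule.mul_mem_mul ha hb) (Submodule.mul_mem_mul hc hd))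
  have e : (a * b - c * d) ^ 2
      = a ^ 2 * b ^ 2 + c ^ 2 * d ^ 2 - (2 : ℝ) • (a * b * c * d) := by
    rw [two_smul]; ring
  rw [e, map_sub, map_add, map_smul, smul_eq_mul] at h
  linarith

/-- The two-point step. The mixed term `abcd` can be split in two ways, as `ac · bd` and as
`ad · bc`; the weights `γ₁`, `γ₂` of the two splittings are free. -/
theorem NonnegOnQuartics.two_point (hE : NonnegOnQuartics W E) {a b c d : A} (ha : a ∈ W)
    (hb : b ∈ W) (hc : c ∈ W) (hd : d ∈ W) {α β γ₁ γ₂ : ℝ} (hα : 0 ≤ α) (hβ : 0 ≤ β)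
    (h1 : 0 ≤ γ₁) (h2 : 0 ≤ γ₂) (h : γ₁ + γ₂ = 4 * α ^ 2 * β ^ 2) :
    E ((α • a + β • b) ^ 2 * (α • c + β • d) ^ 2) ≤
      (α ^ 4 + 2 * α ^ 3 * β + γ₁ / 2) * E (a ^ 2 * c ^ 2)
      + (β ^ 4 + 2 * α * β ^ 3 + γ₁ / 2) * E (b ^ 2 * d ^ 2)
      + (α ^ 2 * β ^ 2 + α ^ 3 * β + α * β ^ 3 + γ₂ / 2) *
          (E (a ^ 2 * d ^ 2) + E (b ^ 2 * c ^ 2)) := by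
  have e : (α • a + β • b) ^ 2 * (α • c + β • d) ^ 2
      = α ^ 4 • (a ^ 2 * c ^ 2) + β ^ 4 • (b ^ 2 * d ^ 2)
        + (α ^ 2 * β ^ 2) • (a ^ 2 * d ^ 2) + (α ^ 2 * β ^ 2) • (b ^ 2 * c ^ 2)
        + (2 * α ^ 3 * β) • (a * c * a * d) + (2 * α * β ^ 3) • (b * c * b * d)
        + (2 * α ^ 3 * β) • (a * c * b * c) + (2 * α * β ^ 3) • (a * d * b * d)
        + (4 * α ^ 2 * β ^ 2) • (a * c * b * d) := by
    simp only [Algebra.smul_def, map_mul, map_pow, map_ofNat]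
    ring
  rw [e]
  simp only [map_add, map_smul, smul_eq_mul]
  have k1 := mul_le_mul_of_nonneg_left (hE.two_mul_le ha hc ha hd)
    (by positivity : 0 ≤ α ^ 3 * β)
  have k2 := mul_le_mul_of_nonneg_left (hE.two_mul_le hb hc hb hd)
    (by positivity : 0 ≤ α * β ^ 3)
  have k3 := mul_le_mul_of_nonneg_left (hE.two_mul_le ha hc hb hc)
    (by positivity : 0 ≤ α ^ 3 * β)
  have k4 := mul_le_mul_of_nonneg_left (hE.two_mul_le ha hd hb hd)
    (by positivity : 0 ≤ α * β ^ 3)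
  have k5 := mul_le_mul_of_nonneg_left (hE.two_mul_le ha hc hb hd) (by positivity : 0 ≤ γ₁ / 2)
  have k6 := mul_le_mul_of_nonneg_left (hE.two_mul_le ha hd hb hc) (by positivity : 0 ≤ γ₂ / 2)
  have e6 : a * d * b * c = a * c * b * d := by ring
  rw [e6] at k6
  rw [← h]
  linarith

/-- A lift of a kernel `T` on `P` to `P × N`: a matrix with nonnegative entries such that each of
its `N × N` blocks has all row sums and all column sums equal to the entry of `T`. -/
structure IsLift {P N : Type*} [Fintype N] (T : Matrix P P ℝ) (K : Matrix (P × N) (P × N) ℝ) :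
    Prop where
  nonneg : ∀ z z', 0 ≤ K z z'
  row : ∀ p α q, ∑ β, K (p, α) (q, β) = T p q
  col : ∀ p q β, ∑ α, K (p, α) (q, β) = T p q

theorem IsLift.mul {P N : Type*} [Fintype P] [Fintype N] {T T' : Matrix P P ℝ}
    {K K' : Matrix (P × N) (P × N) ℝ} (h : IsLift T K) (h' : IsLift T' K') :
    IsLift (T * T') (K * K') where
  nonneg _ _ := Finset.sum_nonneg fun y _ => mul_nonneg (h.nonneg _ _) (h'.nonneg _ _)
  row p α q := by
    simp only [Matrix.mul_apply, Fintype.sum_prod_type]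
    rw [Finset.sum_comm]
    refine Finset.sum_congr rfl fun r _ => ?_
    rw [Finset.sum_comm]
    simp only [← Finset.mul_sum, h'.row, ← Finset.sum_mul, h.row]
  col p q β := by
    simp only [Matrix.mul_apply, Fintype.sum_prod_type]
    rw [Finset.sum_comm]
    refine Finset.sum_congr rfl fun r _ => ?_
    rw [Finset.sum_comm]
    simp only [← Finset.sum_mul, h.col, ← Finset.mul_sum, h'.col]

theorem IsLift.transpose {P N : Type*} [Fintype N] {T : Matrix P P ℝ}
    {K : Matrix (P × N) (P × N) ℝ} (h : IsLift T K) : IsLift T.transpose K.transpose where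
  nonneg _ _ := h.nonneg _ _
  row p α q := h.col q p α
  col p q β := h.row q β p

theorem sum_fin_succ {M Ω : Type*} [AddCommMonoid M] [Fintype Ω] {n : ℕ}
    (g : (Fin (n + 1) → Ω) → M) :
    ∑ x, g x = ∑ a : Ω, ∑ x : Fin n → Ω, g (Fin.cons a x) := by
  rw [← (Fin.consEquiv fun _ => Ω).sum_comp, Fintype.sum_prod_type]
  rfl

theorem sum_zmod_two {M : Type*} [AddCommMonoid M] (g : ZMod 2 → M) : ∑ i, g i = g 0 + g 1 :=
  Fin.sum_univ_two g

theorem prodKernel_cons {Ω : Type} [Fintype Ω] [DecidableEq Ω] {n : ℕ} (u v : ℝ)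
    (a b : Fin n → ℝ) (i j : Ω) (x y : Fin n → Ω) :
    prodKernel (Fin.cons u a) (Fin.cons v b) (Fin.cons i x : Fin (n + 1) → Ω) (Fin.cons j y)
      = (u / Fintype.card Ω + v * ((if i = j then 1 else 0) - 1 / Fintype.card Ω))
        * prodKernel a b x y := by
  simp [prodKernel, Fin.prod_univ_succ]

/-- Hypercontractivity for lifts of the noise operator of the cube with small correlation, by
induction on the dimension. As all lifts are treated at once, nothing but the nonnegativity of the
kernel and its marginals is used. -/
theorem NonnegOnQuartics.hypercontractive_lift (hE : NonnegOnQuartics W E) {τ : ℝ} (h0 : 0 ≤ τ)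
    (hτ : 2 * τ ≤ 1 - τ ^ 2) {N : Type*} [Fintype N] (n : ℕ) :
    ∀ (K K' : Matrix ((Fin n → ZMod 2) × N) ((Fin n → ZMod 2) × N) ℝ)
      (D D' : (Fin n → ZMod 2) × N → A),
      IsLift (prodKernel (fun _ => 1) fun _ => τ) K →
      IsLift (prodKernel (fun _ => 1) fun _ => τ) K' →
      (∀ z, D z ∈ W) → (∀ z, D' z ∈ W) →
      2 ^ n * ∑ p, ∑ α, ∑ α', E (act K D (p, α) ^ 2 * act K' D' (p, α') ^ 2)
        ≤ ∑ z, ∑ z', E (D z ^ 2 * D' z' ^ 2) := by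
  induction n with
  | zero =>
    intro K K' D D' hK hK' hD hD'
    have schur : ∀ {K : Matrix ((Fin 0 → ZMod 2) × N) ((Fin 0 → ZMod 2) × N) ℝ}
        {D : (Fin 0 → ZMod 2) × N → A} (_ : IsLift (prodKernel (fun _ => 1) fun _ => τ) K)
        (_ : ∀ z, D z ∈ W) {b : A} (_ : b ∈ W),
        ∑ z, E (b ^ 2 * act K D z ^ 2) ≤ ∑ z, E (b ^ 2 * D z ^ 2) := by
      intro K D hK hD b hb
      refine sum_sq_act_le (hE.sqWeight hb) hK.nonneg (fun z => ?_) (fun z => ?_) hD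
      · rw [Fintype.sum_prod_type]
        simp [hK.row, prodKernel]
      · rw [Fintype.sum_prod_type]
        simp [hK.col, prodKernel]
    have e : 2 ^ 0 * ∑ p, ∑ α, ∑ α', E (act K D (p, α) ^ 2 * act K' D' (p, α') ^ 2)
        = ∑ z, ∑ z', E (act K D z ^ 2 * act K' D' z' ^ 2) := by
      simp [Fintype.sum_prod_type]
    rw [e]
    calc ∑ z, ∑ z', E (act K D z ^ 2 * act K' D' z' ^ 2)
        ≤ ∑ z, ∑ z', E (act K D z ^ 2 * D' z' ^ 2) :=
          Finset.sum_le_sum fun z _ => schur hK' hD' (act_mem _ hD z)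
      _ = ∑ z', ∑ z, E (D' z' ^ 2 * act K D z ^ 2) := by
          rw [Finset.sum_comm]; simp only [mul_comm]
      _ ≤ ∑ z', ∑ z, E (D' z' ^ 2 * D z ^ 2) :=
          Finset.sum_le_sum fun z' _ => schur hK hD (hD' z')
      _ = _ := by rw [Finset.sum_comm]; simp only [mul_comm]
  | succ n ih =>
    intro K K' D D' hK hK' hD hD'
    have hlt : τ < 1 := by nlinarith
    set t : ZMod 2 → ZMod 2 → ℝ := fun i j => if i = j then (1 + τ) / 2 else (1 - τ) / 2 with ht
    have tpos : ∀ i j, 0 < t i j := by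
      intro i j
      simp only [ht]
      split_ifs <;> linarith
    have hker : ∀ (i j : ZMod 2) (p q : Fin n → ZMod 2),
        (prodKernel (fun _ => 1) fun _ => τ : Matrix (Fin (n + 1) → ZMod 2) _ ℝ)
          (Fin.cons i p) (Fin.cons j q)
        = t i j * prodKernel (fun _ => 1) (fun _ => τ) p q := by
      intro i j p q
      have h1 : (fun _ => 1 : Fin (n + 1) → ℝ) = Fin.cons 1 (fun _ => 1) := by
        funext l; refine Fin.cases ?_ (fun l => ?_) l <;> simp
      have h2 : (fun _ => τ : Fin (n + 1) → ℝ) = Fin.cons τ (fun _ => τ) := by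
        funext l; refine Fin.cases ?_ (fun l => ?_) l <;> simp
      rw [h1, h2, prodKernel_cons]
      congr 1
      simp only [ht, ZMod.card]
      split_ifs <;> push_cast <;> ring
    -- the blocks of a lift with respect to the first coordinate, normalized to be lifts themselves
    set blk : Matrix ((Fin (n + 1) → ZMod 2) × N) ((Fin (n + 1) → ZMod 2) × N) ℝ →
        ZMod 2 → ZMod 2 → Matrix ((Fin n → ZMod 2) × N) ((Fin n → ZMod 2) × N) ℝ :=
      fun K i j z z' => K (Fin.cons i z.1, z.2) (Fin.cons j z'.1, z'.2) / t i j with hblk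
    have hlift : ∀ {K}, IsLift (prodKernel (fun _ => 1) fun _ => τ) K → ∀ i j,
        IsLift (prodKernel (fun _ => 1) fun _ => τ) (blk K i j) := by
      intro K hK i j
      refine ⟨fun z z' => div_nonneg (hK.nonneg _ _) (tpos i j).le, fun p α q => ?_,
        fun p q β => ?_⟩
      · simp only [hblk, ← Finset.sum_div, hK.row, hker]
        exact mul_div_cancel_left₀ _ (tpos i j).ne'
      · simp only [hblk, ← Finset.sum_div, hK.col, hker]
        exact mul_div_cancel_left₀ _ (tpos i j).ne'
    set sl : ((Fin (n + 1) → ZMod 2) × N → A) → ZMod 2 → (Fin n → ZMod 2) × N → A :=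
      fun D j z => D (Fin.cons j z.1, z.2) with hsl
    have hact : ∀ (K) (D : (Fin (n + 1) → ZMod 2) × N → A) (i : ZMod 2) (p : Fin n → ZMod 2)
        (α : N),
        act K D (Fin.cons i p, α) = t i 0 • act (blk K i 0) (sl D 0) (p, α)
          + t i 1 • act (blk K i 1) (sl D 1) (p, α) := by
      intro K D i p α
      simp only [act, Fintype.sum_prod_type, sum_fin_succ, sum_zmod_two, hblk, hsl,
        Finset.smul_sum, smul_smul, mul_div_cancel₀ _ (tpos _ _).ne']
    have hslm : ∀ {D : (Fin (n + 1) → ZMod 2) × N → A}, (∀ z, D z ∈ W) → ∀ j z, sl D j z ∈ W :=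
      fun h j z => h _
    set d : ZMod 2 → ZMod 2 → ℝ := fun j l => ∑ z, ∑ z', E (sl D j z ^ 2 * sl D' l z' ^ 2) with hd
    set S : ZMod 2 → ZMod 2 → ZMod 2 → ℝ := fun i j l => ∑ p, ∑ α, ∑ α',
      E (act (blk K i j) (sl D j) (p, α) ^ 2 * act (blk K' i l) (sl D' l) (p, α') ^ 2) with hS
    have hSd : ∀ i j l, 2 ^ n * S i j l ≤ d j l := fun i j l =>
      ih _ _ _ _ (hlift hK i j) (hlift hK' i l) (hslm hD j) (hslm hD' l)
    have hR : ∑ z, ∑ z', E (D z ^ 2 * D' z' ^ 2) = d 0 0 + d 0 1 + d 1 0 + d 1 1 := by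
      simp only [hd, hsl, Fintype.sum_prod_type, sum_fin_succ, sum_zmod_two,
        Finset.sum_add_distrib]
      ring
    -- one row of the two-point inequality, summed over the remaining coordinates
    have hrow : ∀ (i : ZMod 2) (α β γ₁ γ₂ : ℝ), t i 0 = α → t i 1 = β → 0 ≤ α → 0 ≤ β →
        0 ≤ γ₁ → 0 ≤ γ₂ → γ₁ + γ₂ = 4 * α ^ 2 * β ^ 2 →
        ∑ p, ∑ x, ∑ x', E (act K D (Fin.cons i p, x) ^ 2 * act K' D' (Fin.cons i p, x') ^ 2)
        ≤ (α ^ 4 + 2 * α ^ 3 * β + γ₁ / 2) * S i 0 0 + (β ^ 4 + 2 * α * β ^ 3 + γ₁ / 2) * S i 1 1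
          + (α ^ 2 * β ^ 2 + α ^ 3 * β + α * β ^ 3 + γ₂ / 2) * (S i 0 1 + S i 1 0) := by
      intro i α β γ₁ γ₂ hα hβ α0 β0 g1 g2 hg
      simp only [hS, ← Finset.sum_add_distrib, Finset.mul_sum]
      refine Finset.sum_le_sum fun p _ => Finset.sum_le_sum fun x _ =>
        Finset.sum_le_sum fun x' _ => ?_
      rw [hact, hact, hα, hβ]
      exact hE.two_point (act_mem _ (hslm hD 0) _) (act_mem _ (hslm hD 1) _)
        (act_mem _ (hslm hD' 0) _) (act_mem _ (hslm hD' 1) _) α0 β0 g1 g2 hg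
    have t00 : t 0 0 = (1 + τ) / 2 := by simp [ht]
    have t01 : t 0 1 = (1 - τ) / 2 := by simp [ht]
    have t10 : t 1 0 = (1 - τ) / 2 := by simp [ht]
    have t11 : t 1 1 = (1 + τ) / 2 := by simp [ht]
    set α := (1 + τ) / 2 with hα
    set β := (1 - τ) / 2 with hβ
    have α0 : 0 ≤ α := by rw [hα]; linarith
    have β0 : 0 ≤ β := by rw [hβ]; linarith
    -- with these weights the four coefficients of the two rows together are all equal to 1/2
    have g1 : 0 ≤ 2 * α ^ 2 * β ^ 2 - τ ^ 2 / 2 := by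
      have e : 2 * α ^ 2 * β ^ 2 - τ ^ 2 / 2 = ((1 - τ ^ 2) ^ 2 - (2 * τ) ^ 2) / 8 := by
        rw [hα, hβ]; ring
      rw [e]
      have := pow_le_pow_left₀ (by linarith : 0 ≤ 2 * τ) hτ 2
      linarith
    have g2 : 0 ≤ 2 * α ^ 2 * β ^ 2 + τ ^ 2 / 2 := by positivity
    obtain ⟨C1, hC1⟩ : ∃ C, C = α ^ 4 + 2 * α ^ 3 * β + (2 * α ^ 2 * β ^ 2 - τ ^ 2 / 2) / 2 :=
      ⟨_, rfl⟩
    obtain ⟨C2, hC2⟩ : ∃ C, C = β ^ 4 + 2 * α * β ^ 3 + (2 * α ^ 2 * β ^ 2 - τ ^ 2 / 2) / 2 :=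
      ⟨_, rfl⟩
    have hC3 : α ^ 2 * β ^ 2 + α ^ 3 * β + α * β ^ 3 + (2 * α ^ 2 * β ^ 2 + τ ^ 2 / 2) / 2
        = 1 / 4 := by
      rw [hα, hβ]; ring
    have hC12 : C1 + C2 = 1 / 2 := by rw [hC1, hC2, hα, hβ]; ring
    have c1 : 0 ≤ C1 := by rw [hC1]; positivity
    have c2 : 0 ≤ C2 := by rw [hC2]; positivity
    have r0 := (hrow 0 α β _ _ t00 t01 α0 β0 g1 g2 (by ring)).trans_eq
      (show _ = C1 * S 0 0 0 + C2 * S 0 1 1 + 1 / 4 * (S 0 0 1 + S 0 1 0) by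
        rw [← hC3, hC1, hC2])
    have r1 := (hrow 1 β α _ _ t10 t11 β0 α0 g1 g2 (by ring)).trans_eq
      (show _ = C2 * S 1 0 0 + C1 * S 1 1 1 + 1 / 4 * (S 1 0 1 + S 1 1 0) by
        rw [← hC3, hC1, hC2]; ring)
    have hsum : ∑ p, ∑ x, ∑ x', E (act K D (p, x) ^ 2 * act K' D' (p, x') ^ 2)
        = ∑ p, ∑ x, ∑ x', E (act K D (Fin.cons 0 p, x) ^ 2 * act K' D' (Fin.cons 0 p, x') ^ 2)
        + ∑ p, ∑ x, ∑ x', E (act K D (Fin.cons 1 p, x) ^ 2 * act K' D' (Fin.cons 1 p, x') ^ 2) := by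
      rw [sum_fin_succ, sum_zmod_two]
    rw [hsum, hR, pow_succ]
    have q1 := mul_le_mul_of_nonneg_left (hSd 0 0 0) c1
    have q2 := mul_le_mul_of_nonneg_left (hSd 0 1 1) c2
    have q3 := add_le_add (hSd 0 0 1) (hSd 0 1 0)
    have q4 := mul_le_mul_of_nonneg_left (hSd 1 0 0) c2
    have q5 := mul_le_mul_of_nonneg_left (hSd 1 1 1) c1
    have q6 := add_le_add (hSd 1 0 1) (hSd 1 1 0)
    have rr := mul_le_mul_of_nonneg_left (add_le_add r0 r1) (by positivity : (0 : ℝ) ≤ 2 ^ n)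
    have hC2' : C2 = 1 / 2 - C1 := by linarith
    rw [hC2'] at rr q2 q4
    linarith

end Twisted

/-! ### Hypercontractivity over large alphabets -/

section Invariance

variable {A : Type*} [CommRing A] [Algebra ℝ A] {W : Submodule ℝ A} {E : A →ₗ[ℝ] ℝ}

/-- The sum `∑ E(f(x)² g(y)²)` over all pairs of points. -/
def pairSum {X Y : Type*} [Fintype X] [Fintype Y] (E : A →ₗ[ℝ] ℝ) (f : X → A) (g : Y → A) : ℝ :=
  ∑ x, ∑ y, E (f x ^ 2 * g y ^ 2)

theorem pairSum_comm {X Y : Type*} [Fintype X] [Fintype Y] (E : A →ₗ[ℝ] ℝ) (f : X → A)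
    (g : Y → A) : pairSum E f g = pairSum E g f := by
  unfold pairSum
  rw [Finset.sum_comm]
  simp only [mul_comm]

theorem NonnegOnQuartics.pairSum_nonneg {X Y : Type*} [Fintype X] [Fintype Y]
    (hE : NonnegOnQuartics W E) {f : X → A} {g : Y → A} (hf : ∀ x, f x ∈ W) (hg : ∀ x, g x ∈ W) :
    0 ≤ pairSum E f g :=
  Finset.sum_nonneg fun x _ => Finset.sum_nonneg fun y _ => hE.sq_mul_sq_nonneg (hf x) (hg y)

variable {Ω : Type} [Fintype Ω] [DecidableEq Ω]

/-- The inequality for one coordinate: `f`, `g` are the means and `D`, `G` the deviations from them.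
The terms of first order in the deviations sum to zero, the mixed ones are split by the inequality
between the means. -/
theorem NonnegOnQuartics.sum_sq_mul_sq_le (hE : NonnegOnQuartics W E) {f g : A}
    {D G : Ω → A} (hf : f ∈ W) (hg : g ∈ W) (hD : ∀ i, D i ∈ W) (hG : ∀ i, G i ∈ W)
    (hD0 : ∑ i, D i = 0) (hG0 : ∑ i, G i = 0) :
    ∑ i, E ((f + D i) ^ 2 * (g + G i) ^ 2) ≤
      Fintype.card Ω * E (f ^ 2 * g ^ 2) + 4 * ∑ i, E (f ^ 2 * G i ^ 2)
        + 4 * ∑ i, E (D i ^ 2 * g ^ 2) + 3 * ∑ i, E (D i ^ 2 * G i ^ 2) := by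
  have e : ∀ i, (f + D i) ^ 2 * (g + G i) ^ 2
      = f ^ 2 * g ^ 2 + f ^ 2 * G i ^ 2 + D i ^ 2 * g ^ 2 + D i ^ 2 * G i ^ 2
        + (2 : ℝ) • (f * g ^ 2 * D i) + (2 : ℝ) • (f ^ 2 * g * G i)
        + (2 : ℝ) • (f * G i * D i * g) + (2 : ℝ) • (f * G i * D i * g)
        + (2 : ℝ) • (f * G i * D i * G i) + (2 : ℝ) • (D i * g * D i * G i) := by
    intro i
    simp only [two_smul]
    ring
  have z1 : ∑ i, E ((2 : ℝ) • (f * g ^ 2 * D i)) = 0 := by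
    rw [← map_sum, ← Finset.smul_sum, ← Finset.mul_sum, hD0]; simp
  have z2 : ∑ i, E ((2 : ℝ) • (f ^ 2 * g * G i)) = 0 := by
    rw [← map_sum, ← Finset.smul_sum, ← Finset.mul_sum, hG0]; simp
  have p1 : ∑ i, E ((2 : ℝ) • (f * G i * D i * g))
      ≤ ∑ i, E (f ^ 2 * G i ^ 2) + ∑ i, E (D i ^ 2 * g ^ 2) := by
    rw [← Finset.sum_add_distrib]
    refine Finset.sum_le_sum fun i _ => ?_
    rw [map_smul, smul_eq_mul]
    exact hE.two_mul_le hf (hG i) (hD i) hg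
  have p2 : ∑ i, E ((2 : ℝ) • (f * G i * D i * G i))
      ≤ ∑ i, E (f ^ 2 * G i ^ 2) + ∑ i, E (D i ^ 2 * G i ^ 2) := by
    rw [← Finset.sum_add_distrib]
    refine Finset.sum_le_sum fun i _ => ?_
    rw [map_smul, smul_eq_mul]
    exact hE.two_mul_le hf (hG i) (hD i) (hG i)
  have p3 : ∑ i, E ((2 : ℝ) • (D i * g * D i * G i))
      ≤ ∑ i, E (D i ^ 2 * g ^ 2) + ∑ i, E (D i ^ 2 * G i ^ 2) := by
    rw [← Finset.sum_add_distrib]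
    refine Finset.sum_le_sum fun i _ => ?_
    rw [map_smul, smul_eq_mul]
    exact hE.two_mul_le (hD i) hg (hD i) (hG i)
  simp only [e, map_add, Finset.sum_add_distrib, z1, z2, Finset.sum_const, Finset.card_univ,
    nsmul_eq_mul]
  linarith

/-- The average of a function over its first coordinate. -/
def headMean {n : ℕ} (f : (Fin (n + 1) → Ω) → A) (x : Fin n → Ω) : A :=
  (1 / (Fintype.card Ω : ℝ)) • ∑ i, f (Fin.cons i x)

/-- The deviation of a function from its average over the first coordinate. -/
def headDev {n : ℕ} (f : (Fin (n + 1) → Ω) → A) (i : Ω) (x : Fin n → Ω) : A :=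
  f (Fin.cons i x) - headMean f x

theorem headMean_mem {n : ℕ} {f : (Fin (n + 1) → Ω) → A} (hf : ∀ x, f x ∈ W) (x : Fin n → Ω) :
    headMean f x ∈ W :=
  W.smul_mem _ (W.sum_mem fun _ _ => hf _)

theorem headDev_mem {n : ℕ} {f : (Fin (n + 1) → Ω) → A} (hf : ∀ x, f x ∈ W) (i : Ω)
    (x : Fin n → Ω) : headDev f i x ∈ W :=
  W.sub_mem (hf _) (headMean_mem hf x)

theorem sum_headDev [Nonempty Ω] {n : ℕ} (f : (Fin (n + 1) → Ω) → A) (x : Fin n → Ω) :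
    ∑ i, headDev f i x = 0 := by
  have hk : (Fintype.card Ω : ℝ) ≠ 0 := by simp
  simp only [headDev, headMean, Finset.sum_sub_distrib, Finset.sum_const, Finset.card_univ]
  rw [← Nat.cast_smul_eq_nsmul ℝ, smul_smul, mul_one_div_cancel hk, one_smul, sub_self]

theorem act_prodKernel_cons [Nonempty Ω] {n : ℕ} (u v : ℝ) (a b : Fin n → ℝ)
    (f : (Fin (n + 1) → Ω) → A) (i : Ω) (x : Fin n → Ω) :
    act (prodKernel (Fin.cons u a : Fin (n + 1) → ℝ) (Fin.cons v b)) f (Fin.cons i x)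
      = u • act (prodKernel a b) (headMean f) x + v • act (prodKernel a b) (headDev f i) x := by
  have h1 : act (prodKernel (Fin.cons u a : Fin (n + 1) → ℝ) (Fin.cons v b)) f (Fin.cons i x)
      = ∑ y, prodKernel a b x y • (u • headMean f y + v • headDev f i y) := by
    simp only [act, sum_fin_succ]
    rw [Finset.sum_comm]
    refine Finset.sum_congr rfl fun y _ => ?_
    have e : ∀ j : Ω, prodKernel (Fin.cons u a : Fin (n + 1) → ℝ) (Fin.cons v b)
        (Fin.cons i x : Fin (n + 1) → Ω) (Fin.cons j y) • f (Fin.cons j y)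
        = prodKernel a b x y • ((u - v) • (1 / (Fintype.card Ω : ℝ)) • f (Fin.cons j y))
          + (if i = j then prodKernel a b x y • v • f (Fin.cons j y) else 0) := by
      intro j
      rw [prodKernel_cons]
      split_ifs
      · simp only [smul_smul, ← add_smul]
        congr 1
        ring
      · simp only [smul_smul, add_zero]
        congr 1
        ring
    simp only [e, Finset.sum_add_distrib, Finset.sum_ite_eq, Finset.mem_univ, if_true,
      ← Finset.smul_sum]
    rw [← smul_add]
    congr 1
    simp only [headDev]
    change (u - v) • headMean f y + _ = _
    rw [smul_sub, sub_smul]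
    abel
  rw [h1]
  simp only [act, smul_add, Finset.sum_add_distrib, Finset.smul_sum]
  congr 1 <;> exact Finset.sum_congr rfl fun y _ => smul_comm _ _ _

theorem sum_sq_act_prodKernel_cons [Nonempty Ω] {n : ℕ} (F : A →ₗ[ℝ] ℝ) (u v : ℝ)
    (a b : Fin n → ℝ) (f : (Fin (n + 1) → Ω) → A) :
    ∑ z, F (act (prodKernel (Fin.cons u a : Fin (n + 1) → ℝ) (Fin.cons v b)) f z ^ 2)
      = u ^ 2 * Fintype.card Ω * ∑ x, F (act (prodKernel a b) (headMean f) x ^ 2)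
        + v ^ 2 * ∑ i, ∑ x, F (act (prodKernel a b) (headDev f i) x ^ 2) := by
  rw [sum_fin_succ, Finset.sum_comm, Finset.mul_sum,
    Finset.sum_comm (s := (Finset.univ : Finset Ω)),
    Finset.mul_sum, ← Finset.sum_add_distrib]
  refine Finset.sum_congr rfl fun x _ => ?_
  set m := act (prodKernel a b) (headMean f) x with hm
  have hz : ∑ i, act (prodKernel a b) (headDev f i) x = 0 := by
    simp only [act]
    rw [Finset.sum_comm]
    simp only [← Finset.smul_sum, sum_headDev, smul_zero, Finset.sum_const_zero]
  have e : ∀ i, F (act (prodKernel (Fin.cons u a : Fin (n + 1) → ℝ) (Fin.cons v b)) f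
      (Fin.cons i x) ^ 2) = u ^ 2 * F (m ^ 2) + v ^ 2 * F (act (prodKernel a b) (headDev f i) x ^ 2)
        + 2 * u * v * F (m * act (prodKernel a b) (headDev f i) x) := by
    intro i
    rw [act_prodKernel_cons, ← hm]
    have e : ∀ p q : A, (u • p + v • q) ^ 2
        = u ^ 2 • p ^ 2 + v ^ 2 • q ^ 2 + (2 * u * v) • (p * q) := by
      intro p q
      simp only [Algebra.smul_def, map_mul, map_pow, map_ofNat]
      ring
    rw [e, map_add, map_add, map_smul, map_smul, map_smul]
    simp only [smul_eq_mul]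
  have hz' : ∑ i, F (m * act (prodKernel a b) (headDev f i) x) = 0 := by
    rw [← map_sum, ← Finset.mul_sum, hz, mul_zero, map_zero]
  simp only [e, Finset.sum_add_distrib, ← Finset.mul_sum, hz', mul_zero,
    Finset.sum_const, Finset.card_univ, nsmul_eq_mul]
  ring

theorem pairSum_prodKernel_cons [Nonempty Ω] {n : ℕ} (u v : ℝ)
    (a b : Fin n → ℝ) (f g : (Fin (n + 1) → Ω) → A) :
    pairSum E (act (prodKernel (Fin.cons u a : Fin (n + 1) → ℝ) (Fin.cons v b)) f)
        (act (prodKernel (Fin.cons u a : Fin (n + 1) → ℝ) (Fin.cons v b)) g)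
      = u ^ 4 * Fintype.card Ω ^ 2 * pairSum E (act (prodKernel a b) (headMean f))
          (act (prodKernel a b) (headMean g))
        + u ^ 2 * v ^ 2 * Fintype.card Ω * ∑ i, pairSum E (act (prodKernel a b) (headMean f))
          (act (prodKernel a b) (headDev g i))
        + u ^ 2 * v ^ 2 * Fintype.card Ω * ∑ i, pairSum E (act (prodKernel a b) (headDev f i))
          (act (prodKernel a b) (headMean g))
        + v ^ 4 * ∑ i, ∑ j, pairSum E (act (prodKernel a b) (headDev f i))
          (act (prodKernel a b) (headDev g j)) := by
  have hr : ∀ {X : Type} [Fintype X] (p : X → A) (g : (Fin (n + 1) → Ω) → A), pairSum E p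
      (act (prodKernel (Fin.cons u a : Fin (n + 1) → ℝ) (Fin.cons v b)) g)
      = u ^ 2 * Fintype.card Ω * pairSum E p (act (prodKernel a b) (headMean g))
        + v ^ 2 * ∑ i, pairSum E p (act (prodKernel a b) (headDev g i)) := by
    intro X _ p g
    have h : ∀ x, ∑ z, E (p x ^ 2 *
        act (prodKernel (Fin.cons u a : Fin (n + 1) → ℝ) (Fin.cons v b)) g z ^ 2)
        = u ^ 2 * Fintype.card Ω * ∑ y, E (p x ^ 2 * act (prodKernel a b) (headMean g) y ^ 2)
          + v ^ 2 * ∑ i, ∑ y, E (p x ^ 2 * act (prodKernel a b) (headDev g i) y ^ 2) := fun x =>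
      sum_sq_act_prodKernel_cons (sqWeight E (p x)) u v a b g
    simp only [pairSum, h, Finset.sum_add_distrib, ← Finset.mul_sum]
    rw [Finset.sum_comm (s := (Finset.univ : Finset X)) (t := (Finset.univ : Finset Ω))]
  have hl : ∀ {X : Type} [Fintype X] (p : X → A), pairSum E
      (act (prodKernel (Fin.cons u a : Fin (n + 1) → ℝ) (Fin.cons v b)) f) p
      = u ^ 2 * Fintype.card Ω * pairSum E (act (prodKernel a b) (headMean f)) p
        + v ^ 2 * ∑ i, pairSum E (act (prodKernel a b) (headDev f i)) p := by
    intro X _ p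
    rw [pairSum_comm, hr, pairSum_comm]
    simp only [pairSum_comm E p]
  rw [hr, hl]
  simp only [hl, Finset.sum_add_distrib, ← Finset.mul_sum]
  rw [Finset.sum_comm (s := (Finset.univ : Finset Ω)) (t := (Finset.univ : Finset Ω))]
  ring

/-- The step from `n` to `n + 1` coordinates on the side of the fourth moment. -/
theorem NonnegOnQuartics.sum_cons_sq_mul_sq_le [Nonempty Ω] (hE : NonnegOnQuartics W E) {n : ℕ}
    {f g : (Fin (n + 1) → Ω) → A} (hf : ∀ x, f x ∈ W) (hg : ∀ x, g x ∈ W) :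
    ∑ z, E (f z ^ 2 * g z ^ 2) ≤
      Fintype.card Ω * ∑ x, E (headMean f x ^ 2 * headMean g x ^ 2)
        + 4 * ∑ i, ∑ x, E (headMean f x ^ 2 * headDev g i x ^ 2)
        + 4 * ∑ i, ∑ x, E (headDev f i x ^ 2 * headMean g x ^ 2)
        + 3 * ∑ i, ∑ x, E (headDev f i x ^ 2 * headDev g i x ^ 2) := by
  rw [sum_fin_succ, Finset.sum_comm]
  simp only [Finset.sum_comm (s := (Finset.univ : Finset Ω))
      (t := (Finset.univ : Finset (Fin n → Ω))),
    Finset.mul_sum (s := (Finset.univ : Finset (Fin n → Ω))), ← Finset.sum_add_distrib]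
  refine Finset.sum_le_sum fun x _ => ?_
  have h := hE.sum_sq_mul_sq_le (headMean_mem hf x) (headMean_mem hg x)
    (fun i => headDev_mem hf i x) (fun i => headDev_mem hg i x) (sum_headDev f x) (sum_headDev g x)
  simpa only [headDev, add_sub_cancel] using h

theorem const_eq_cons (n : ℕ) (r : ℝ) :
    (fun _ => r : Fin (n + 1) → ℝ) = Fin.cons r fun _ => r := by
  funext l
  refine Fin.cases ?_ (fun l => ?_) l <;> simp

/-- Hypercontractivity on `Ω^n`, with a constant depending on the size of `Ω`. -/
theorem NonnegOnQuartics.hypercontractive [Nonempty Ω] (hE : NonnegOnQuartics W E) {τ : ℝ}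
    (h4 : 4 ≤ τ ^ 2) (hk : 3 * (Fintype.card Ω : ℝ) ≤ τ ^ 4) (n : ℕ) :
    ∀ f g : (Fin n → Ω) → A, (∀ x, f x ∈ W) → (∀ x, g x ∈ W) →
      (Fintype.card Ω : ℝ) ^ n * ∑ x, E (f x ^ 2 * g x ^ 2)
        ≤ pairSum E (act (prodKernel (fun _ => 1) fun _ => τ) f)
            (act (prodKernel (fun _ => 1) fun _ => τ) g) := by
  induction n with
  | zero =>
    intro f g hf hg
    have h : (prodKernel (fun _ => 1) fun _ => τ : Matrix (Fin 0 → Ω) (Fin 0 → Ω) ℝ) = 1 := by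
      ext x y
      rw [Subsingleton.elim x y]
      simp [prodKernel]
    rw [h, act_one, act_one]
    simp [pairSum]
  | succ n ih =>
    intro f g hf hg
    rw [const_eq_cons, const_eq_cons, pairSum_prodKernel_cons, pow_succ]
    set k : ℝ := ((Fintype.card Ω : ℕ) : ℝ) with hkdef
    have k0 : 0 ≤ k := by positivity
    set P : Matrix (Fin n → Ω) (Fin n → Ω) ℝ := prodKernel (fun _ => 1) fun _ => τ with hP
    have mf := headMean_mem hf
    have mg := headMean_mem hg
    have df := headDev_mem hf
    have dg := headDev_mem hg
    have nn : ∀ {f g : (Fin n → Ω) → A}, (∀ x, f x ∈ W) → (∀ x, g x ∈ W) →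
      0 ≤ pairSum E (act P f) (act P g) := fun hf hg =>
        hE.pairSum_nonneg (act_mem _ hf) (act_mem _ hg)
    have q1 := ih _ _ mf mg
    have q2 := Finset.sum_le_sum fun i (_ : i ∈ Finset.univ) => ih _ _ mf (dg i)
    have q3 := Finset.sum_le_sum fun i (_ : i ∈ Finset.univ) => ih _ _ (df i) mg
    have q4 := Finset.sum_le_sum fun i (_ : i ∈ Finset.univ) => ih _ _ (df i) (dg i)
    simp only [← Finset.mul_sum] at q2 q3 q4
    -- the diagonal terms are bounded by all terms; this costs the factor `k` in `3 * k ≤ τ ^ 4`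
    have q5 : ∑ i, pairSum E (act P (headDev f i)) (act P (headDev g i))
        ≤ ∑ i, ∑ j, pairSum E (act P (headDev f i)) (act P (headDev g j)) :=
      Finset.sum_le_sum fun i _ => Finset.single_le_sum
        (f := fun j => pairSum E (act P (headDev f i)) (act P (headDev g j)))
        (fun j _ => nn (df i) (dg j)) (Finset.mem_univ i)
    have n2 := Finset.sum_nonneg fun i (_ : i ∈ Finset.univ) => nn mf (dg i)
    have n3 := Finset.sum_nonneg fun i (_ : i ∈ Finset.univ) => nn (df i) mg
    have n4 := Finset.sum_nonneg fun i (_ : i ∈ Finset.univ) => Finset.sum_nonneg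
      fun j (_ : j ∈ Finset.univ) => nn (df i) (dg j)
    have hs := mul_le_mul_of_nonneg_left (hE.sum_cons_sq_mul_sq_le hf hg)
      (by positivity : 0 ≤ k ^ n * k)
    rw [← hkdef] at hs
    have m1 := mul_le_mul_of_nonneg_left q1 (by positivity : 0 ≤ k ^ 2)
    have m2 := mul_le_mul_of_nonneg_left q2 (by positivity : 0 ≤ 4 * k)
    have m3 := mul_le_mul_of_nonneg_left q3 (by positivity : 0 ≤ 4 * k)
    have m4 := mul_le_mul_of_nonneg_left (q4.trans q5) (by positivity : 0 ≤ 3 * k)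
    have r2 := mul_le_mul_of_nonneg_right (mul_le_mul_of_nonneg_right h4 k0) n2
    have r3 := mul_le_mul_of_nonneg_right (mul_le_mul_of_nonneg_right h4 k0) n3
    have r4 := mul_le_mul_of_nonneg_right hk n4
    linarith

set_option maxHeartbeats 1000000 in
/-- Hypercontractivity on `Ω^n` with a constant that does not depend on the size of `Ω`, up to an
error controlled by the influences of the coordinates. -/
theorem NonnegOnQuartics.hypercontractive_add_influences [Nonempty Ω] (hE : NonnegOnQuartics W E)
    {τ : ℝ} (h4 : 4 ≤ τ ^ 2) (hk : 3 * (Fintype.card Ω : ℝ) ≤ τ ^ 4) (n : ℕ) :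
    ∀ f g : (Fin n → Ω) → A, (∀ x, f x ∈ W) → (∀ x, g x ∈ W) →
      (Fintype.card Ω : ℝ) ^ n * ∑ x, E (f x ^ 2 * g x ^ 2)
        ≤ pairSum E (act (prodKernel (fun _ => 1) fun _ => 2) f)
            (act (prodKernel (fun _ => 1) fun _ => 2) g)
          + 3 * Fintype.card Ω * ∑ i,
            pairSum E (act (prodKernel (fun l => if l = i then 0 else 1) fun _ => τ) f)
              (act (prodKernel (fun l => if l = i then 0 else 1) fun _ => τ) g) := by
  induction n with
  | zero =>
    intro f g hf hg
    have h : (prodKernel (fun _ => 1) fun _ => 2 : Matrix (Fin 0 → Ω) (Fin 0 → Ω) ℝ) = 1 := by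
      ext x y
      rw [Subsingleton.elim x y]
      simp [prodKernel]
    rw [h, act_one, act_one]
    simp [pairSum]
  | succ n ih =>
    intro f g hf hg
    have c0 : (fun l : Fin (n + 1) => if l = 0 then (0 : ℝ) else 1) = Fin.cons 0 fun _ => 1 := by
      funext l
      refine Fin.cases ?_ (fun l => ?_) l <;> simp
    have cs : ∀ i : Fin n, (fun l : Fin (n + 1) => if l = i.succ then (0 : ℝ) else 1)
        = Fin.cons 1 fun l => if l = i then 0 else 1 := by
      intro i
      funext l
      refine Fin.cases ?_ (fun l => ?_) l <;> simp [Fin.ext_iff]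
    rw [const_eq_cons n 1, const_eq_cons n 2, const_eq_cons n τ, Fin.sum_univ_succ, c0]
    simp only [cs, pairSum_prodKernel_cons]
    rw [pow_succ]
    set k : ℝ := ((Fintype.card Ω : ℕ) : ℝ) with hkdef
    have k0 : 0 ≤ k := by positivity
    set P : Matrix (Fin n → Ω) (Fin n → Ω) ℝ := prodKernel (fun _ => 1) fun _ => 2 with hP
    set T : Matrix (Fin n → Ω) (Fin n → Ω) ℝ := prodKernel (fun _ => 1) fun _ => τ with hT
    set Z : Fin n → Matrix (Fin n → Ω) (Fin n → Ω) ℝ := fun i =>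
      prodKernel (fun l => if l = i then 0 else 1) fun _ => τ with hZ
    have mf := headMean_mem hf
    have mg := headMean_mem hg
    have df := headDev_mem hf
    have dg := headDev_mem hg
    have nn : ∀ (M : Matrix (Fin n → Ω) (Fin n → Ω) ℝ) {f g : (Fin n → Ω) → A}, (∀ x, f x ∈ W) →
      (∀ x, g x ∈ W) → 0 ≤ pairSum E (act M f) (act M g) := fun M _ _ hf hg =>
        hE.pairSum_nonneg (act_mem _ hf) (act_mem _ hg)
    have q1 := ih _ _ mf mg
    have q2 := Finset.sum_le_sum fun i (_ : i ∈ Finset.univ) => ih _ _ mf (dg i)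
    have q3 := Finset.sum_le_sum fun i (_ : i ∈ Finset.univ) => ih _ _ (df i) mg
    have q4 := Finset.sum_le_sum fun i (_ : i ∈ Finset.univ) =>
      hE.hypercontractive h4 hk n _ _ (df i) (dg i)
    simp only [← Finset.mul_sum, Finset.sum_add_distrib] at q2 q3 q4
    -- the diagonal terms are absorbed by the influence of the first coordinate
    have q5 : ∑ i, pairSum E (act T (headDev f i)) (act T (headDev g i))
        ≤ ∑ i, ∑ j, pairSum E (act T (headDev f i)) (act T (headDev g j)) :=
      Finset.sum_le_sum fun i _ => Finset.single_le_sum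
        (f := fun j => pairSum E (act T (headDev f i)) (act T (headDev g j)))
        (fun j _ => nn T (df i) (dg j)) (Finset.mem_univ i)
    have n4 : ∀ M : Matrix (Fin n → Ω) (Fin n → Ω) ℝ,
        0 ≤ ∑ i, ∑ j, pairSum E (act M (headDev f i)) (act M (headDev g j)) := fun M =>
      Finset.sum_nonneg fun i _ => Finset.sum_nonneg fun j _ => nn M (df i) (dg j)
    have x2 : ∑ j, ∑ i, pairSum E (act (Z i) (headMean f)) (act (Z i) (headDev g j))
        = ∑ i, ∑ j, pairSum E (act (Z i) (headMean f)) (act (Z i) (headDev g j)) :=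
      Finset.sum_comm
    have x3 : ∑ j, ∑ i, pairSum E (act (Z i) (headDev f j)) (act (Z i) (headMean g))
        = ∑ i, ∑ j, pairSum E (act (Z i) (headDev f j)) (act (Z i) (headMean g)) :=
      Finset.sum_comm
    have n2 : 0 ≤ ∑ i, ∑ j, pairSum E (act (Z i) (headMean f)) (act (Z i) (headDev g j)) :=
      Finset.sum_nonneg fun i _ => Finset.sum_nonneg fun j _ => nn _ mf (dg j)
    have n3 : 0 ≤ ∑ i, ∑ j, pairSum E (act (Z i) (headDev f j)) (act (Z i) (headMean g)) :=
      Finset.sum_nonneg fun i _ => Finset.sum_nonneg fun j _ => nn _ (df j) mg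
    have n5 : 0 ≤ ∑ l, ∑ i, ∑ j, pairSum E (act (Z l) (headDev f i)) (act (Z l) (headDev g j)) :=
      Finset.sum_nonneg fun l _ => n4 _
    have t4 : 1 ≤ τ ^ 4 := by nlinarith
    have hs := mul_le_mul_of_nonneg_left (hE.sum_cons_sq_mul_sq_le hf hg)
      (by positivity : 0 ≤ k ^ n * k)
    rw [← hkdef] at hs
    have m1 := mul_le_mul_of_nonneg_left q1 (by positivity : 0 ≤ k ^ 2)
    have m2 := mul_le_mul_of_nonneg_left q2 (by positivity : 0 ≤ 4 * k)
    have m3 := mul_le_mul_of_nonneg_left q3 (by positivity : 0 ≤ 4 * k)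
    have m4 := mul_le_mul_of_nonneg_left (q4.trans q5) (by positivity : 0 ≤ 3 * k)
    have r2 := mul_le_mul_of_nonneg_right (mul_le_mul_of_nonneg_right h4
      (by positivity : 0 ≤ 3 * k ^ 2)) n2
    have r3 := mul_le_mul_of_nonneg_right (mul_le_mul_of_nonneg_right h4
      (by positivity : 0 ≤ 3 * k ^ 2)) n3
    have r4 := mul_le_mul_of_nonneg_left (mul_le_mul_of_nonneg_right t4 (n4 T))
      (by positivity : 0 ≤ 3 * k)
    have r5 : 0 ≤ 3 * k * (τ ^ 4 * ∑ l, ∑ i, ∑ j,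
        pairSum E (act (Z l) (headDev f i)) (act (Z l) (headDev g j))) :=
      mul_nonneg (by positivity) (mul_nonneg (by positivity) n5)
    have r6 := n4 P
    simp only [Finset.sum_add_distrib, ← Finset.mul_sum]
    simp only [hZ] at x2 x3 r2 r3 r5
    rw [x2] at m2
    rw [x3] at m3
    generalize (∑ x, E (headMean f x ^ 2 * headMean g x ^ 2)) = s1 at *
    generalize (∑ i, ∑ x, E (headMean f x ^ 2 * headDev g i x ^ 2)) = s2 at *
    generalize (∑ i, ∑ x, E (headDev f i x ^ 2 * headMean g x ^ 2)) = s3 at *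
    generalize (∑ i, ∑ x, E (headDev f i x ^ 2 * headDev g i x ^ 2)) = s4 at *
    linarith

variable {ι : Type} [Fintype ι] [DecidableEq ι]

/-- Product operators commute with renaming the coordinates. -/
theorem act_prodKernel_comp {κ : Type} [Fintype κ] [DecidableEq κ] (e : ι ≃ κ) (a b : κ → ℝ)
    (f : (ι → Ω) → A) (x : κ → Ω) :
    act (prodKernel a b) (fun y : κ → Ω => f (y ∘ e)) x
      = act (prodKernel (a ∘ e) (b ∘ e)) f (x ∘ e) := by
  have h : ∀ y : κ → Ω, prodKernel a b x y • f (y ∘ e)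
      = prodKernel (a ∘ e) (b ∘ e) (x ∘ e) (y ∘ e) • f (y ∘ e) := by
    intro y
    congr 1
    unfold prodKernel
    rw [← e.prod_comp]
    rfl
  simp only [act, h]
  exact (Equiv.arrowCongr e.symm (Equiv.refl Ω)).sum_comp
    fun y => prodKernel (a ∘ e) (b ∘ e) (x ∘ e) y • f y

/-- `NonnegOnQuartics.hypercontractive_add_influences` for a single function, over any finite index
set. -/
theorem NonnegOnQuartics.sum_pow_four_le [Nonempty Ω] (hE : NonnegOnQuartics W E)
    {τ : ℝ} (h4 : 4 ≤ τ ^ 2) (hk : 3 * (Fintype.card Ω : ℝ) ≤ τ ^ 4)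
    (f : (ι → Ω) → A) (hf : ∀ x, f x ∈ W) :
      (Fintype.card Ω : ℝ) ^ Fintype.card ι * ∑ x, E (f x ^ 4)
        ≤ pairSum E (act (prodKernel (fun _ => 1) fun _ => 2) f)
            (act (prodKernel (fun _ => 1) fun _ => 2) f)
          + 3 * Fintype.card Ω * ∑ i,
            pairSum E (act (prodKernel (fun l => if l = i then 0 else 1) fun _ => τ) f)
              (act (prodKernel (fun l => if l = i then 0 else 1) fun _ => τ) f) := by
  set e := Fintype.equivFin ι with he
  set f' : (Fin (Fintype.card ι) → Ω) → A := fun y => f (y ∘ e) with hf'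
  have hs : ∀ p : (ι → Ω) → ℝ, ∑ y : Fin (Fintype.card ι) → Ω, p (y ∘ e) = ∑ x, p x := by
    intro p
    rw [← (Equiv.arrowCongr e.symm (Equiv.refl Ω)).sum_comp]
    rfl
  have h := hE.hypercontractive_add_influences h4 hk _ f' f' (fun x => hf _) (fun x => hf _)
  have hp : ∀ p q : (ι → Ω) → A,
      pairSum E (fun y : Fin (Fintype.card ι) → Ω => p (y ∘ e)) (fun y => q (y ∘ e))
        = pairSum E p q := by
    intro p q
    unfold pairSum
    rw [← hs]
    exact Finset.sum_congr rfl fun x _ => hs fun z => E (p (x ∘ e) ^ 2 * q z ^ 2)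
  have ha : ∀ a b : Fin (Fintype.card ι) → ℝ, act (prodKernel a b) f'
      = fun y => act (prodKernel (a ∘ e) (b ∘ e)) f (y ∘ e) := fun a b =>
    funext fun x => act_prodKernel_comp e a b f x
  simp only [ha, hp] at h
  rw [← e.sum_comp] at h
  have hc : ∀ i : ι, (fun l => if l = e i then (0 : ℝ) else 1) ∘ e
      = fun l => if l = i then 0 else 1 := by
    intro i
    funext l
    simp
  simp only [hc, ← pow_add, hf'] at h
  rw [hs fun x => E (f x ^ (2 + 2))] at h
  exact h

end Invariance

/-! ### Splitting along the spectrum -/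

section Spectral

variable {X : Type*} [Fintype X] [DecidableEq X]

/-- Splitting of the identity along the spectrum of a symmetric matrix `S`: on the eigenvectors
with eigenvalue above `l` the power `S ^ s` is inverted by `A₁`, the others are kept by `A₂`. -/
theorem exists_spectral_split {S : Matrix X X ℝ} (hS : S.transpose = S) {l : ℝ} (hl : 0 < l)
    (s : ℕ) :
    ∃ A₁ A₂ : Matrix X X ℝ, S ^ s * A₁ + A₂ = 1 ∧
      ∀ {A : Type} [CommRing A] [Algebra ℝ A] (W : Submodule ℝ A) (F : A →ₗ[ℝ] ℝ),
        NonnegOnSquares W F → ∀ f : X → A, (∀ x, f x ∈ W) →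
        ∑ x, F (act A₁ f x ^ 2) ≤ (l⁻¹) ^ (2 * s) * ∑ x, F (f x ^ 2) ∧
        form F (A₂.transpose * S * A₂) f ≤ l * ∑ x, F (f x ^ 2) := by
  have hH : S.IsHermitian := by
    rw [Matrix.IsHermitian, Matrix.conjTranspose_eq_transpose_of_trivial, hS]
  set U : Matrix X X ℝ := Subtype.val hH.eigenvectorUnitary with hU
  set μ := hH.eigenvalues with hμ
  have hUU : U.transpose * U = 1 := by
    have h := Unitary.coe_star_mul_self hH.eigenvectorUnitary
    rwa [Matrix.star_eq_conjTranspose, Matrix.conjTranspose_eq_transpose_of_trivial] at h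
  have hUU' : U * U.transpose = 1 := mul_eq_one_comm.1 hUU
  have hdiag : S = U * Matrix.diagonal μ * U.transpose := by
    have h := hH.spectral_theorem
    rw [Unitary.conjStarAlgAut_apply] at h
    rw [← Matrix.conjTranspose_eq_transpose_of_trivial, ← Matrix.star_eq_conjTranspose]
    exact h
  have hmul : ∀ d d' : X → ℝ, (U * Matrix.diagonal d * U.transpose)
      * (U * Matrix.diagonal d' * U.transpose)
      = U * Matrix.diagonal (fun x => d x * d' x) * U.transpose := by
    intro d d'
    calc _ = U * Matrix.diagonal d * (U.transpose * U) * Matrix.diagonal d' * U.transpose := by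
          simp only [Matrix.mul_assoc]
      _ = _ := by rw [hUU, Matrix.mul_one, Matrix.mul_assoc U, Matrix.diagonal_mul_diagonal]
  have hone : U * Matrix.diagonal (fun _ => (1 : ℝ)) * U.transpose = 1 := by
    rw [Matrix.diagonal_one, Matrix.mul_one, hUU']
  have hpow : ∀ s : ℕ, S ^ s = U * Matrix.diagonal (fun x => μ x ^ s) * U.transpose := by
    intro s
    induction s with
    | zero => simp only [pow_zero]; rw [← hone]
    | succ s ih =>
      rw [pow_succ, ih]
      nth_rewrite 1 [hdiag]
      rw [hmul]
      simp only [pow_succ]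
  have htr : ∀ d : X → ℝ, (U * Matrix.diagonal d * U.transpose).transpose
      = U * Matrix.diagonal d * U.transpose := by
    intro d
    simp [Matrix.transpose_mul, Matrix.mul_assoc]
  refine ⟨U * Matrix.diagonal (fun x => if l < μ x then (μ x ^ s)⁻¹ else 0) * U.transpose,
    U * Matrix.diagonal (fun x => if l < μ x then 0 else 1) * U.transpose, ?_, ?_⟩
  · rw [hpow, hmul, ← Matrix.add_mul, ← Matrix.mul_add, Matrix.diagonal_add, ← hone]
    congr 3
    funext x
    split_ifs with h
    · rw [mul_inv_cancel₀ (pow_pos (hl.trans h) s).ne', add_zero]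
    · simp
  · intro A _ _ W F hF f hf
    have hn : ∀ x, 0 ≤ F (act U.transpose f x ^ 2) := fun x => hF _ (act_mem _ hf x)
    have htot : ∑ x, F (f x ^ 2) = ∑ x, F (act U.transpose f x ^ 2) := by
      rw [sum_sq_act, Matrix.transpose_transpose, hUU', form_one]
    rw [htot, Finset.mul_sum, Finset.mul_sum]
    constructor
    · rw [sum_sq_act, htr, hmul, form_mul_diagonal_mul]
      refine Finset.sum_le_sum fun x _ => mul_le_mul_of_nonneg_right ?_ (hn x)
      split_ifs with h
      · rw [← inv_pow, ← pow_add, two_mul]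
        exact pow_le_pow_left₀ (inv_nonneg.2 (hl.trans h).le) (inv_anti₀ hl h.le) _
      · simp only [mul_zero]
        positivity
    · rw [htr]
      nth_rewrite 1 [hdiag]
      rw [hmul, hmul, form_mul_diagonal_mul]
      refine Finset.sum_le_sum fun x _ => mul_le_mul_of_nonneg_right ?_ (hn x)
      split_ifs with h
      · simp [hl.le]
      · simpa using h

end Spectral

/-! ### Kernels of a unique game and their lifts -/

section Lifts

variable {A : Type*} [CommRing A] [Algebra ℝ A] {W : Submodule ℝ A} {E : A →ₗ[ℝ] ℝ}

theorem IsLift.mul_pow {P N : Type*} [Fintype P] [DecidableEq P] [Fintype N] [DecidableEq N]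
    {T : Matrix P P ℝ} {K : Matrix (P × N) (P × N) ℝ} (h : IsLift T K) (s : ℕ) :
    IsLift (T * (T.transpose * T) ^ s) (K * (K.transpose * K) ^ s) := by
  induction s with
  | zero => simpa using h
  | succ s ih =>
    simp only [pow_succ, ← Matrix.mul_assoc]
    exact (ih.mul h.transpose).mul h

theorem submatrix_prodKernel_mul_pow {P : Type*} [Fintype P] [DecidableEq P] {ι Ω : Type}
    [Fintype ι] [DecidableEq ι] [Fintype Ω] [DecidableEq Ω] [Nonempty Ω] (ψ : P ≃ (ι → Ω))
    (r : ℝ) (s : ℕ) {T : Matrix P P ℝ}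
    (hT : T = (prodKernel (fun _ => 1) fun _ => r).submatrix ψ ψ) :
    T * (T.transpose * T) ^ s
      = (prodKernel (fun _ => 1) fun _ => r ^ (2 * s + 1)).submatrix ψ ψ := by
  have ht : T.transpose = T := by
    subst hT
    ext p q
    exact prodKernel_comm _ _ _ _
  rw [ht]
  induction s with
  | zero => simpa using hT
  | succ s ih =>
    rw [pow_succ, ← Matrix.mul_assoc, ih, hT, Matrix.submatrix_mul_equiv, prodKernel_mul,
      Matrix.submatrix_mul_equiv, prodKernel_mul]
    congr 1
    ring_nf

/-- `NonnegOnQuartics.hypercontractive_lift` for a single function and a set `P` of vertices that is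
identified with a cube. -/
theorem NonnegOnQuartics.card_mul_sum_lift_le (hE : NonnegOnQuartics W E) {τ : ℝ} (h0 : 0 ≤ τ)
    (hτ : 2 * τ ≤ 1 - τ ^ 2) {P N ι : Type} [Fintype P] [Fintype N] [Fintype ι] [DecidableEq ι]
    (ψ : P ≃ (ι → ZMod 2)) {K : Matrix (P × N) (P × N) ℝ}
    (hK : IsLift ((prodKernel (fun _ => 1) fun _ => τ).submatrix ψ ψ) K)
    {D : P × N → A} (hD : ∀ z, D z ∈ W) :
    Fintype.card P * ∑ p, pairSum E (fun α => act K D (p, α)) (fun α => act K D (p, α))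
      ≤ pairSum E D D := by
  set e : (Fin (Fintype.card ι) → ZMod 2) ≃ P :=
    ((Fintype.equivFin ι).symm.arrowCongr (Equiv.refl _)).trans ψ.symm with he
  set e' : (Fin (Fintype.card ι) → ZMod 2) × N ≃ P × N := e.prodCongr (Equiv.refl N) with he'
  have hψ : ∀ z, ψ (e z) = fun i => z (Fintype.equivFin ι i) := by
    intro z
    simp only [he, Equiv.trans_apply, Equiv.apply_symm_apply]
    rfl
  have hl : IsLift (prodKernel (fun _ => 1) fun _ => τ) (K.submatrix e' e') := by
    have hk : ∀ p q,
        (prodKernel (fun _ => 1) fun _ => τ : Matrix (ι → ZMod 2) _ ℝ) (ψ (e p)) (ψ (e q))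
        = prodKernel (fun _ => 1) (fun _ => τ) p q := by
      intro p q
      rw [hψ, hψ]
      unfold prodKernel
      rw [← (Fintype.equivFin ι).prod_comp]
    exact ⟨fun z z' => hK.nonneg _ _, fun p α q => (hK.row (e p) α (e q)).trans (hk p q),
      fun p q β => (hK.col (e p) (e q) β).trans (hk p q)⟩
  have h := hE.hypercontractive_lift h0 hτ _ _ _ (D ∘ e') (D ∘ e') hl hl (fun z => hD _)
    (fun z => hD _)
  have ha : ∀ p α, act (K.submatrix e' e') (D ∘ e') (p, α) = act K D (e p, α) := fun p α =>
    e'.sum_comp fun z => K (e p, α) z • D z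
  have hc : (Fintype.card P : ℝ) = 2 ^ Fintype.card ι := by
    rw [Fintype.card_congr ψ]
    simp [ZMod.card]
  have hs : ∀ g : P × N → ℝ, ∑ z, g (e' z) = ∑ z, g z := e'.sum_comp
  simp only [ha, Function.comp] at h
  rw [e.sum_comp fun p => ∑ α, ∑ α', E (act K D (p, α) ^ 2 * act K D (p, α') ^ 2),
    hs fun z => ∑ z', E (D z ^ 2 * D (e' z') ^ 2)] at h
  have hs' : ∀ z, ∑ z', E (D z ^ 2 * D (e' z') ^ 2) = ∑ z', E (D z ^ 2 * D z' ^ 2) := fun z =>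
    hs fun z' => E (D z ^ 2 * D z' ^ 2)
  simp only [hs'] at h
  rw [hc]
  exact h

/-- An `ℓ²` bound that holds for all functionals gives a bound on sums over pairs. -/
theorem pairSum_act_le {X Y : Type*} [Fintype X]
    [Fintype Y] {M : Matrix X Y ℝ} {f : Y → A} (hf : ∀ y, f y ∈ W) {c : ℝ} (hc : 0 ≤ c)
    (h : ∀ b ∈ W, ∑ x, E (b ^ 2 * act M f x ^ 2) ≤ c * ∑ y, E (b ^ 2 * f y ^ 2)) :
    pairSum E (act M f) (act M f) ≤ c ^ 2 * pairSum E f f := by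
  have h1 : pairSum E (act M f) (act M f) ≤ c * pairSum E (act M f) f := by
    unfold pairSum
    rw [Finset.mul_sum]
    exact Finset.sum_le_sum fun x _ => h _ (act_mem M hf x)
  have h2 : pairSum E f (act M f) ≤ c * pairSum E f f := by
    unfold pairSum
    rw [Finset.mul_sum]
    exact Finset.sum_le_sum fun x _ => h _ (hf x)
  rw [pairSum_comm] at h2
  have h3 := mul_le_mul_of_nonneg_left h2 hc
  linarith

/-- Removing a small part `b` of a function `a + b` in a bound for the square of its `ℓ²` norm. -/
theorem NonnegOnQuartics.pairSum_add_le (hE : NonnegOnQuartics W E) {X : Type*} [Fintype X]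
    {a b c : X → A} (ha : ∀ x, a x ∈ W) (hb : ∀ x, b x ∈ W) (hc : ∀ x, c x = a x + b x) :
    pairSum E c c ≤ 4 * pairSum E a a + 4 * pairSum E b c := by
  have hcm : ∀ x, c x ∈ W := fun x => by rw [hc]; exact W.add_mem (ha x) (hb x)
  have sq : ∀ {f : X → A}, (∀ x, f x ∈ W) → ∑ x, f x ^ 2 ∈ W * W := fun h =>
    Submodule.sum_mem _ fun x _ => by rw [pow_two]; exact Submodule.mul_mem_mul (h x) (h x)
  have hp : ∀ f g : X → A, pairSum E f g = E ((∑ x, f x ^ 2) * ∑ y, g y ^ 2) := by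
    intro f g
    rw [Finset.sum_mul_sum, map_sum]
    simp only [map_sum]
    rfl
  -- the square of `2|a|² - |c|²`
  have h1 : 4 * pairSum E a c ≤ 4 * pairSum E a a + pairSum E c c := by
    have h := hE _ (Submodule.sub_mem _ (Submodule.smul_mem _ (2 : ℝ) (sq ha)) (sq hcm))
    simp only [hp]
    set p := ∑ x, a x ^ 2
    set q := ∑ x, c x ^ 2
    have e : ((2 : ℝ) • p - q) ^ 2 = (4 : ℝ) • (p * p) + q * q - (4 : ℝ) • (p * q) := by
      simp only [Algebra.smul_def, map_ofNat]
      ring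
    rw [e, map_sub, map_add, map_smul, map_smul, smul_eq_mul, smul_eq_mul] at h
    linarith
  -- `c² ≤ 2a² + 2b²`
  have h2 : pairSum E c c ≤ 2 * pairSum E a c + 2 * pairSum E b c := by
    unfold pairSum
    simp only [Finset.mul_sum, ← Finset.sum_add_distrib]
    refine Finset.sum_le_sum fun x _ => Finset.sum_le_sum fun y _ => ?_
    have h := hE.sq_mul_sq_nonneg (W.sub_mem (ha x) (hb x)) (hcm y)
    have e : (a x - b x) ^ 2 * c y ^ 2 = (2 : ℝ) • (a x ^ 2 * c y ^ 2)
        + (2 : ℝ) • (b x ^ 2 * c y ^ 2) - c x ^ 2 * c y ^ 2 := by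
      rw [hc x]
      simp only [two_smul]
      ring
    rw [e, map_sub, map_add, map_smul, map_smul, smul_eq_mul, smul_eq_mul] at h
    linarith
  linarith

end Lifts

section GameKernels

variable {A : Type*} [CommRing A] [Algebra ℝ A]
variable {V L Ω : Type} [Fintype V] [DecidableEq V] [Fintype L] [DecidableEq L]
  [Fintype Ω] [DecidableEq Ω]

/-- The game with the two sides of every constraint exchanged. -/
def UniqueGame.reverse (U : UniqueGame V L) : UniqueGame V L where
  Constraint := U.Constraint
  weight := U.weight
  weight_nonneg := U.weight_nonneg
  weight_sum := U.weight_sum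
  src := U.dst
  dst := U.src
  perm e := (U.perm e).symm

/-- The operator averaging functions on `V × Ω^L` over the neighbours `v` of a vertex `u`, the
coordinates being matched by the permutations. It is normalized for the case that the first vertex
of a random constraint is uniform. -/
def UniqueGame.avgKernel (Ω : Type) [DecidableEq Ω] (U : UniqueGame V L) :
    Matrix (V × (L → Ω)) (V × (L → Ω)) ℝ := fun p q =>
  ∑ e, if U.src e = p.1 ∧ (U.dst e, p.2 ∘ U.perm e) = q then Fintype.card V * U.weight e else 0

/-- The corresponding operator for functions on `V × L × Ω^L`, which moves along with the points a
coordinate of the cube. -/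
def UniqueGame.liftKernel (Ω : Type) [DecidableEq Ω] (U : UniqueGame V L) :
    Matrix ((V × L) × (L → Ω)) ((V × L) × (L → Ω)) ℝ := fun p q =>
  ∑ e, if U.src e = p.1.1 ∧ ((U.dst e, (U.perm e).symm p.1.2), p.2 ∘ U.perm e) = q
    then Fintype.card V * U.weight e else 0

/-- The operator taking a family of functions on `Ω^L` to the family of their smoothed derivatives
in all the coordinates. -/
def derivKernel (V L Ω : Type) [DecidableEq V] [Fintype L] [DecidableEq L] [Fintype Ω]
    [DecidableEq Ω] : Matrix ((V × L) × (L → Ω)) (V × (L → Ω)) ℝ := fun p q =>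
  if p.1.1 = q.1 then prodKernel (fun l => if l = p.1.2 then 0 else 1) (fun _ => 1 / 2) p.2 q.2
  else 0

theorem UniqueGame.act_avgKernel (U : UniqueGame V L) (f : V × (L → Ω) → A) (p : V × (L → Ω)) :
    act (U.avgKernel Ω) f p = ∑ e, if U.src e = p.1 then
      (Fintype.card V * U.weight e) • f (U.dst e, p.2 ∘ U.perm e) else 0 := by
  simp only [act, UniqueGame.avgKernel, Finset.sum_smul]
  rw [Finset.sum_comm]
  refine Finset.sum_congr rfl fun e _ => ?_
  split_ifs with h
  · simp only [h, true_and, ite_smul, zero_smul, Finset.sum_ite_eq, Finset.mem_univ, if_true]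
  · simp [h]

theorem UniqueGame.act_liftKernel (U : UniqueGame V L) (D : (V × L) × (L → Ω) → A)
    (p : (V × L) × (L → Ω)) :
    act (U.liftKernel Ω) D p = ∑ e, if U.src e = p.1.1 then
      (Fintype.card V * U.weight e) • D ((U.dst e, (U.perm e).symm p.1.2), p.2 ∘ U.perm e)
      else 0 := by
  simp only [act, UniqueGame.liftKernel, Finset.sum_smul]
  rw [Finset.sum_comm]
  refine Finset.sum_congr rfl fun e _ => ?_
  split_ifs with h
  · simp only [h, true_and, ite_smul, zero_smul, Finset.sum_ite_eq, Finset.mem_univ, if_true]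
  · simp [h]

theorem act_derivKernel (f : V × (L → Ω) → A) (p : (V × L) × (L → Ω)) :
    act (derivKernel V L Ω) f p
      = act (prodKernel (fun l => if l = p.1.2 then 0 else 1) fun _ => 1 / 2)
          (fun y => f (p.1.1, y)) p.2 := by
  simp only [act, derivKernel, Fintype.sum_prod_type, ite_smul, zero_smul]
  rw [Finset.sum_eq_single p.1.1]
  · simp
  · intro b _ hb
    simp [Ne.symm hb]
  · simp

theorem UniqueGame.avgKernel_reverse (U : UniqueGame V L) :
    U.reverse.avgKernel Ω = (U.avgKernel Ω).transpose := by
  ext p q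
  simp only [UniqueGame.avgKernel, Matrix.transpose_apply]
  refine Finset.sum_congr rfl fun e _ => if_congr ?_ rfl rfl
  obtain ⟨v, y⟩ := p
  obtain ⟨u, x⟩ := q
  simp only [UniqueGame.reverse, Prod.mk.injEq]
  constructor
  · rintro ⟨rfl, rfl, rfl⟩
    exact ⟨rfl, rfl, by funext i; simp⟩
  · rintro ⟨rfl, rfl, rfl⟩
    exact ⟨rfl, rfl, by funext i; simp⟩

theorem UniqueGame.liftKernel_reverse (U : UniqueGame V L) :
    U.reverse.liftKernel Ω = (U.liftKernel Ω).transpose := by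
  ext p q
  simp only [UniqueGame.liftKernel, Matrix.transpose_apply]
  refine Finset.sum_congr rfl fun e _ => if_congr ?_ rfl rfl
  obtain ⟨⟨v, j⟩, y⟩ := p
  obtain ⟨⟨u, i⟩, x⟩ := q
  simp only [UniqueGame.reverse, Prod.mk.injEq, Equiv.symm_symm]
  constructor
  · rintro ⟨rfl, ⟨rfl, rfl⟩, rfl⟩
    exact ⟨rfl, ⟨rfl, by simp⟩, by funext i; simp⟩
  · rintro ⟨rfl, ⟨rfl, rfl⟩, rfl⟩
    exact ⟨rfl, ⟨rfl, by simp⟩, by funext i; simp⟩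

/-- Renaming the coordinates of both points of a product kernel. -/
theorem prodKernel_comp_equiv (σ : Equiv.Perm L) (a b : L → ℝ) (x y : L → Ω) :
    prodKernel (a ∘ σ) (b ∘ σ) (x ∘ σ) (y ∘ σ) = prodKernel a b x y := by
  unfold prodKernel
  exact Equiv.prod_comp σ fun i =>
    (a i / Fintype.card Ω + b i * ((if x i = y i then 1 else 0) - 1 / Fintype.card Ω))

theorem UniqueGame.derivKernel_mul_avgKernel (U : UniqueGame V L) :
    derivKernel V L Ω * U.avgKernel Ω = U.liftKernel Ω * derivKernel V L Ω := by
  have key : ∀ f : V × (L → Ω) → ℝ,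
      act (derivKernel V L Ω) (act (U.avgKernel Ω) f)
        = act (U.liftKernel Ω) (act (derivKernel V L Ω) f) := by
    intro f
    funext ⟨⟨u, i⟩, x⟩
    rw [act_derivKernel, UniqueGame.act_liftKernel]
    simp only [act_derivKernel]
    simp only [UniqueGame.act_avgKernel]
    simp only [act, Finset.smul_sum]
    rw [Finset.sum_comm]
    refine Finset.sum_congr rfl fun e _ => ?_
    split_ifs with h
    · rw [← ((U.perm e).arrowCongr (Equiv.refl Ω)).sum_comp]
      refine Finset.sum_congr rfl fun y _ => ?_
      have h1 : (((U.perm e).arrowCongr (Equiv.refl Ω)) y) ∘ U.perm e = y := by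
        funext l
        simp [Equiv.arrowCongr]
      rw [← prodKernel_comp_equiv (U.perm e), h1, smul_comm]
      congr 3
      funext l
      simp [Equiv.eq_symm_apply]
    · simp
  have hm : ∀ M M' : Matrix ((V × L) × (L → Ω)) (V × (L → Ω)) ℝ,
      (∀ f : V × (L → Ω) → ℝ, act M f = act M' f) → M = M' := by
    intro M M' h
    ext p q
    have h := congrFun (h (Pi.single q 1)) p
    simpa [act, Pi.single_apply] using h
  refine hm _ _ fun f => ?_
  rw [act_mul, act_mul, key]

/-- The derivatives of a power of the averaging operator: here the commutation relation for the game
and the one for its reverse alternate. -/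
theorem UniqueGame.derivKernel_mul_pow (U : UniqueGame V L) (s : ℕ) :
    derivKernel V L Ω * (U.avgKernel Ω * ((U.avgKernel Ω).transpose * U.avgKernel Ω) ^ s)
      = U.liftKernel Ω * ((U.liftKernel Ω).transpose * U.liftKernel Ω) ^ s * derivKernel V L Ω := by
  have h1 := U.derivKernel_mul_avgKernel (Ω := Ω)
  have h2 := U.reverse.derivKernel_mul_avgKernel (Ω := Ω)
  rw [U.avgKernel_reverse, U.liftKernel_reverse] at h2
  induction s with
  | zero => simpa using h1
  | succ s ih =>
    simp only [pow_succ, ← Matrix.mul_assoc] at ih ⊢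
    rw [ih, Matrix.mul_assoc _ (derivKernel V L Ω), h2, ← Matrix.mul_assoc,
      Matrix.mul_assoc _ (derivKernel V L Ω), h1, ← Matrix.mul_assoc]

/-- The marginal of the lifted kernel is the label-extended graph. -/
theorem UniqueGame.liftKernel_isLift (U : UniqueGame V L) {T : Matrix (V × L) (V × L) ℝ}
    (hT : ∀ p q, Fintype.card V * (Fintype.card L * U.labelExtended p q) = T p q) :
    IsLift T (U.liftKernel Ω) := by
  rcases isEmpty_or_nonempty L with hL | hL
  · refine ⟨fun z => hL.elim z.1.2, fun p => hL.elim p.2, fun p => hL.elim p.2⟩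
  have hR : (Fintype.card L : ℝ) ≠ 0 := by simp
  have hT' : ∀ p q, T p q = ∑ e, if U.src e = p.1 ∧ U.dst e = q.1 ∧ U.perm e q.2 = p.2 then
      Fintype.card V * U.weight e else 0 := by
    intro p q
    rw [← hT, UniqueGame.labelExtended, mul_div_cancel₀ _ hR, Finset.mul_sum]
    refine Finset.sum_congr rfl fun e _ => ?_
    rw [mul_ite, mul_zero]
    congr
  refine ⟨fun p q => Finset.sum_nonneg fun e _ => ?_, fun p α q => ?_, fun p q β => ?_⟩
  · have := U.weight_nonneg e
    split_ifs <;> positivity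
  · rw [hT']
    simp only [UniqueGame.liftKernel]
    rw [Finset.sum_comm]
    refine Finset.sum_congr rfl fun e _ => ?_
    have hc : ∀ β : L → Ω, (U.src e = p.1 ∧
        ((U.dst e, (U.perm e).symm p.2), α ∘ U.perm e) = (q, β)) ↔
        (U.src e = p.1 ∧ U.dst e = q.1 ∧ U.perm e q.2 = p.2) ∧ α ∘ U.perm e = β := by
      intro β
      obtain ⟨v, j⟩ := q
      simp only [Prod.mk.injEq, Equiv.symm_apply_eq, eq_comm (a := p.2), and_assoc]
    simp only [hc, ite_and, Finset.sum_ite_irrel, Finset.sum_ite_eq, Finset.mem_univ, if_true,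
      Finset.sum_const_zero]
  · rw [hT']
    simp only [UniqueGame.liftKernel]
    rw [Finset.sum_comm]
    refine Finset.sum_congr rfl fun e _ => ?_
    have hc : ∀ α : L → Ω, (U.src e = p.1 ∧
        ((U.dst e, (U.perm e).symm p.2), α ∘ U.perm e) = (q, β)) ↔
        (U.src e = p.1 ∧ U.dst e = q.1 ∧ U.perm e q.2 = p.2) ∧ β ∘ (U.perm e).symm = α := by
      intro α
      obtain ⟨v, j⟩ := q
      have h3 : α ∘ U.perm e = β ↔ β ∘ (U.perm e).symm = α := by
        constructor
        · rintro rfl; funext i; simp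
        · rintro rfl; funext i; simp
      simp only [Prod.mk.injEq, Equiv.symm_apply_eq, eq_comm (a := p.2), and_assoc, h3]
    simp only [hc, ite_and, Finset.sum_ite_irrel, Finset.sum_ite_eq, Finset.mem_univ, if_true,
      Finset.sum_const_zero]

/-- The total influence of a smoothed function is bounded by its squared norm: the weight of a
component of degree `j` in the sum is `j / 4 ^ j ≤ 1`. -/
theorem sum_sq_act_derivKernel_le [Nonempty Ω] {W : Submodule ℝ A} {F : A →ₗ[ℝ] ℝ}
    (hF : NonnegOnSquares W F) {f : V × (L → Ω) → A} (hf : ∀ z, f z ∈ W) (u : V) :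
    ∑ i, ∑ x, F (act (derivKernel V L Ω) f ((u, i), x) ^ 2) ≤ ∑ x, F (f (u, x) ^ 2) := by
  set w : L → Finset L → ℝ := fun i S =>
    (∏ l ∈ S, (1 / 2 : ℝ)) * ∏ l ∈ Sᶜ, (if l = i then (0 : ℝ) else 1) with hw
  have h : ∑ i, ∑ x, F (act (derivKernel V L Ω) f ((u, i), x) ^ 2)
      = form F (multiplier fun S => ∑ i, w i S ^ 2) fun y => f (u, y) := by
    simp only [form_multiplier, Finset.sum_mul]
    rw [Finset.sum_comm (s := (Finset.univ : Finset (Finset L)))]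
    refine Finset.sum_congr rfl fun i _ => ?_
    rw [← form_multiplier F fun S => w i S ^ 2, ← sum_sq_act_multiplier]
    refine Finset.sum_congr rfl fun x _ => ?_
    rw [act_derivKernel, prodKernel_eq_multiplier]
  rw [h, sum_sq_eq_form_multiplier]
  refine form_multiplier_mono hF (fun S => ?_) fun x => hf _
  have hi : ∀ i : L, w i S ^ 2 = if i ∈ S then (1 / 4) ^ S.card else 0 := by
    intro i
    simp only [hw, Finset.prod_const]
    split_ifs with his
    · rw [Finset.prod_eq_one, mul_one, ← pow_mul, mul_comm, pow_mul]
      · norm_num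
      · intro l hl
        rw [if_neg]
        rintro rfl
        exact Finset.mem_compl.1 hl his
    · rw [Finset.prod_eq_zero (i := i) (by simpa using his) (by simp)]
      simp
  simp only [hi, Finset.sum_ite_mem, Finset.univ_inter, Finset.sum_const, nsmul_eq_mul]
  have h4 : (S.card : ℝ) ≤ 4 ^ S.card := by
    exact_mod_cast (Nat.lt_pow_self (by norm_num : 1 < 4)).le
  rw [one_div, inv_pow, ← div_eq_mul_inv]
  exact div_le_one_of_le₀ h4 (by positivity)

end GameKernels

/-! ### Influences of neighbourhood averages -/

section Influences

variable {A : Type} [CommRing A] [Algebra ℝ A] {W : Submodule ℝ A} {E : A →ₗ[ℝ] ℝ}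
variable {V L Ω : Type} [Fintype V] [DecidableEq V] [Fintype L] [DecidableEq L]
  [Fintype Ω] [DecidableEq Ω]

theorem sum_sq_act_derivKernel_le_sum [Nonempty Ω] {F : A →ₗ[ℝ] ℝ}
    (hF : NonnegOnSquares W F) {f : V × (L → Ω) → A} (hf : ∀ z, f z ∈ W) :
    ∑ z, F (act (derivKernel V L Ω) f z ^ 2) ≤ ∑ z, F (f z ^ 2) := by
  rw [Fintype.sum_prod_type, Fintype.sum_prod_type, Fintype.sum_prod_type]
  exact Finset.sum_le_sum fun u _ => sum_sq_act_derivKernel_le hF hf u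

/-- The fourth moments of the smoothed derivatives of the averages `g` of `f` are small. The part
of `f` on the small eigenvalues of the averaging operator contributes little to `g`. On the other
part `g` equals a high power of the averaging operator applied to a function which is not much
larger than `f`, and such a power lifts to the noise operator of the cube, which is
hypercontractive. -/
theorem NonnegOnQuartics.sum_pairSum_deriv_le [Nonempty Ω] [Nonempty V] [Nonempty L]
    (hE : NonnegOnQuartics W E) (h1 : (1 : A) ∈ W) (hE1 : E 1 = 1) (U : UniqueGame V L)
    (ψ : V × L ≃ (L → ZMod 2)) {r : ℝ} (hr : 0 ≤ r)
    (hU : ∀ p q, Fintype.card V * (Fintype.card L * U.labelExtended p q)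
      = prodKernel (fun _ => 1) (fun _ => r) (ψ p) (ψ q))
    {s : ℕ} (hs : 2 * r ^ (2 * s + 1) ≤ 1 - (r ^ (2 * s + 1)) ^ 2) {l : ℝ} (hl : 0 < l) {M : ℝ}
    (hM : 0 ≤ M) {f g : V × (L → Ω) → A} (hf : ∀ z, f z ∈ W) (hg : g = act (U.avgKernel Ω) f)
    (hfM : ∀ b ∈ W, ∑ z, E (b ^ 2 * f z ^ 2) ≤ Fintype.card V * M * E (b ^ 2))
    (hgM : ∀ b ∈ W, ∀ u, ∑ x, E (b ^ 2 * g (u, x) ^ 2) ≤ M * E (b ^ 2)) :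
    ∑ p, pairSum E (fun x => act (derivKernel V L Ω) g (p, x))
        (fun x => act (derivKernel V L Ω) g (p, x))
      ≤ 4 * Fintype.card V * M ^ 2 * ((l⁻¹) ^ (4 * s) / Fintype.card L + l) := by
  have hV : (0 : ℝ) < Fintype.card V := by exact_mod_cast Fintype.card_pos
  have hL : (0 : ℝ) < Fintype.card L := by exact_mod_cast Fintype.card_pos
  have hEs : NonnegOnSquares W E := fun a ha => by
    have h := hE.sqWeight h1 a ha
    rwa [sqWeight_apply, one_pow, one_mul] at h
  set G := U.avgKernel Ω with hG
  set T := U.liftKernel Ω with hT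
  set D := derivKernel V L Ω with hD
  obtain ⟨A₁, A₂, hsplit, hA⟩ := exists_spectral_split
    (S := G.transpose * G) (by simp [Matrix.transpose_mul]) hl s
  have hA1 : ∀ b ∈ W, ∑ z, E (b ^ 2 * act A₁ f z ^ 2)
      ≤ (l⁻¹) ^ (2 * s) * ∑ z, E (b ^ 2 * f z ^ 2) := fun b hb =>
    (hA W (SoSUniqueGames.sqWeight E b) (hE.sqWeight hb) f hf).1
  have hA2 := (hA W E hEs f hf).2
  have hgm : ∀ z, g z ∈ W := fun z => by rw [hg]; exact act_mem _ hf z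
  -- the two parts of the derivatives
  set a : (V × L) × (L → Ω) → A := act (T * (T.transpose * T) ^ s) (act D (act A₁ f)) with ha
  set b : (V × L) × (L → Ω) → A := act D (act G (act A₂ f)) with hb
  have ham : ∀ z, a z ∈ W := act_mem _ (act_mem _ (act_mem _ hf))
  have hbm : ∀ z, b z ∈ W := act_mem _ (act_mem _ (act_mem _ hf))
  have hsum : ∀ z, act D g z = a z + b z := by
    intro z
    have e1 : D * (G * (G.transpose * G) ^ s) = T * (T.transpose * T) ^ s * D :=
      U.derivKernel_mul_pow s
    have e : D * G = T * (T.transpose * T) ^ s * D * A₁ + D * G * A₂ := by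
      calc D * G = D * G * ((G.transpose * G) ^ s * A₁ + A₂) := by rw [hsplit, Matrix.mul_one]
        _ = D * (G * (G.transpose * G) ^ s) * A₁ + D * G * A₂ := by
            rw [Matrix.mul_add]
            simp only [Matrix.mul_assoc]
        _ = _ := by rw [e1]
    rw [hg, ha, hb, ← act_mul, e, act_add_left]
    simp only [act_mul]
  have hfour : ∀ p, pairSum E (fun x => act D g (p, x)) (fun x => act D g (p, x))
      ≤ 4 * pairSum E (fun x => a (p, x)) (fun x => a (p, x))
        + 4 * pairSum E (fun x => b (p, x)) (fun x => act D g (p, x)) := fun p =>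
    hE.pairSum_add_le (fun x => ham _) (fun x => hbm _) fun x => hsum _
  -- the structured part
  have hlift : IsLift ((prodKernel (fun _ => 1) fun _ => r ^ (2 * s + 1)).submatrix ψ ψ)
      (T * (T.transpose * T) ^ s) := by
    rw [← submatrix_prodKernel_mul_pow ψ r s rfl]
    exact (U.liftKernel_isLift hU).mul_pow s
  have hpa : Fintype.card V * Fintype.card L *
      ∑ p, pairSum E (fun x => a (p, x)) (fun x => a (p, x))
      ≤ ((l⁻¹) ^ (2 * s)) ^ 2 * (Fintype.card V * M) ^ 2 := by
    have q1 := hE.card_mul_sum_lift_le (pow_nonneg hr _) hs ψ hlift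
      (D := act D (act A₁ f)) (act_mem _ (act_mem _ hf))
    rw [Fintype.card_prod, Nat.cast_mul] at q1
    refine q1.trans ?_
    have q2 : pairSum E (act D (act A₁ f)) (act D (act A₁ f))
        ≤ 1 ^ 2 * pairSum E (act A₁ f) (act A₁ f) :=
      pairSum_act_le (act_mem _ hf) zero_le_one fun b hb => by
        rw [one_mul]
        exact sum_sq_act_derivKernel_le_sum (hE.sqWeight hb) (act_mem _ hf)
    have q3 : pairSum E (act A₁ f) (act A₁ f) ≤ ((l⁻¹) ^ (2 * s)) ^ 2 * pairSum E f f :=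
      pairSum_act_le hf (by positivity) hA1
    have q4 : pairSum E f f ≤ (Fintype.card V * M) ^ 2 := by
      have q : pairSum E f f ≤ ∑ z, Fintype.card V * M * E (f z ^ 2) :=
        Finset.sum_le_sum fun z _ => hfM _ (hf z)
      rw [← Finset.mul_sum] at q
      have q' := hfM 1 h1
      simp only [one_pow, one_mul, hE1, mul_one] at q'
      rw [pow_two]
      exact q.trans (mul_le_mul_of_nonneg_left q' (by positivity))
    rw [one_pow, one_mul] at q2
    exact q2.trans (q3.trans (mul_le_mul_of_nonneg_left q4 (by positivity)))
  -- the part on the small eigenvalues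
  have hpb : ∑ p, pairSum E (fun x => b (p, x)) (fun x => act D g (p, x))
      ≤ M * (l * (Fintype.card V * M)) := by
    have q1 : ∀ p, pairSum E (fun x => b (p, x)) (fun x => act D g (p, x))
        ≤ ∑ x, M * E (b (p, x) ^ 2) := by
      intro p
      refine Finset.sum_le_sum fun x _ => le_trans ?_ (hgM _ (hbm (p, x)) p.1)
      have hF := hE.sqWeight (hbm (p, x))
      refine le_trans ?_ (sum_sq_act_derivKernel_le hF hgm p.1)
      exact Finset.single_le_sum
        (f := fun i => ∑ y, SoSUniqueGames.sqWeight E (b (p, x)) (act D g ((p.1, i), y) ^ 2))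
        (fun i _ => Finset.sum_nonneg fun y _ => hF _ (act_mem _ hgm _)) (Finset.mem_univ p.2)
    have q2 : ∑ p, ∑ x, M * E (b (p, x) ^ 2) = M * ∑ z, E (b z ^ 2) := by
      rw [Fintype.sum_prod_type (f := fun z => E (b z ^ 2)), Finset.mul_sum]
      simp only [Finset.mul_sum]
    refine (Finset.sum_le_sum fun p _ => q1 p).trans (q2.trans_le ?_)
    refine mul_le_mul_of_nonneg_left ?_ hM
    refine (sum_sq_act_derivKernel_le_sum hEs (act_mem G (act_mem A₂ hf))).trans ?_
    have q3 : ∑ z, E (act G (act A₂ f) z ^ 2)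
        = form E (A₂.transpose * (G.transpose * G) * A₂) f := by
      rw [← act_mul, sum_sq_act, Matrix.transpose_mul]
      simp only [Matrix.mul_assoc]
    rw [q3]
    refine hA2.trans (mul_le_mul_of_nonneg_left ?_ hl.le)
    have q' := hfM 1 h1
    simpa only [one_pow, one_mul, hE1, mul_one] using q'
  have htot := Finset.sum_le_sum fun p (_ : p ∈ Finset.univ) => hfour p
  rw [Finset.sum_add_distrib, ← Finset.mul_sum, ← Finset.mul_sum] at htot
  refine htot.trans ?_
  have hpa' : ∑ p, pairSum E (fun x => a (p, x)) (fun x => a (p, x))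
      ≤ Fintype.card V * M ^ 2 * ((l⁻¹) ^ (4 * s) / Fintype.card L) := by
    have e : Fintype.card V * M ^ 2 * ((l⁻¹) ^ (4 * s) / Fintype.card L)
        = ((l⁻¹) ^ (2 * s)) ^ 2 * (Fintype.card V * M) ^ 2
          / (Fintype.card V * Fintype.card L) := by
      rw [← pow_mul, show 2 * s * 2 = 4 * s by ring]
      field_simp
    rw [e, le_div_iff₀ (by positivity), mul_comm]
    exact hpa
  linarith

end Influences

/-! ### Low-degree parts and the value of the noise form -/

section LowDegree

variable {A : Type} [CommRing A] [Algebra ℝ A] {W : Submodule ℝ A} {E : A →ₗ[ℝ] ℝ}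
variable {ι Ω : Type} [Fintype ι] [DecidableEq ι] [Fintype Ω] [DecidableEq Ω]

/-- The operator that scales the part of degree `j` by `ρ ^ j` if `j ≤ d` and removes it otherwise.
For `ρ = 1` it is the truncation to degree at most `d`. -/
def lowDegree (ρ : ℝ) (d : ℕ) : Matrix (ι → Ω) (ι → Ω) ℝ :=
  multiplier fun S => if S.card ≤ d then ρ ^ S.card else 0

theorem sum_sq_act_lowDegree_le [Nonempty Ω] {F : A →ₗ[ℝ] ℝ} (hF : NonnegOnSquares W F) {ρ : ℝ}
    (hρ : 1 ≤ ρ) (d : ℕ) {f : (ι → Ω) → A} (hf : ∀ x, f x ∈ W) :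
    ∑ x, F (act (lowDegree ρ d) f x ^ 2) ≤ ρ ^ (2 * d) * ∑ x, F (f x ^ 2) := by
  have h0 : (0 : ℝ) ≤ ρ := zero_le_one.trans hρ
  unfold lowDegree
  rw [sum_sq_act_multiplier, sum_sq_eq_form_multiplier, form_multiplier _ fun _ => (1 : ℝ),
    Finset.mul_sum]
  simp only [← mul_assoc]
  rw [← form_multiplier F fun _ => ρ ^ (2 * d) * 1]
  refine form_multiplier_mono hF (fun S => ?_) hf
  split_ifs with h
  · rw [← pow_mul, mul_one, mul_comm S.card]
    exact pow_le_pow_right₀ hρ (by omega)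
  · rw [mul_one, zero_pow two_ne_zero]
    positivity

theorem prodKernel_mul_lowDegree [Nonempty Ω] (ρ : ℝ) (d : ℕ) :
    (prodKernel (fun _ => 1) (fun _ => ρ) * lowDegree 1 d : Matrix (ι → Ω) (ι → Ω) ℝ)
      = lowDegree ρ d := by
  unfold lowDegree
  rw [prodKernel_eq_multiplier, multiplier_mul]
  simp

theorem prodKernel_deriv_mul_lowDegree [Nonempty Ω] (i : ι) (ρ : ℝ) (d : ℕ) :
    (prodKernel (fun l => if l = i then 0 else 1) (fun _ => ρ) * lowDegree 1 d :
      Matrix (ι → Ω) (ι → Ω) ℝ)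
      = lowDegree (2 * ρ) d
        * prodKernel (fun l => if l = i then 0 else 1) (fun _ => 1 / 2) := by
  unfold lowDegree
  rw [prodKernel_eq_multiplier, prodKernel_eq_multiplier, multiplier_mul, multiplier_mul]
  congr 1
  funext S
  simp only [Finset.prod_const]
  split_ifs
  · rw [one_pow, mul_one, ← mul_assoc, ← mul_pow]
    congr 2
    ring
  · simp

/-- The fourth moment of the low-degree part in terms of influences. -/
theorem NonnegOnQuartics.sum_lowDegree_pow_four_le [Nonempty Ω] (hE : NonnegOnQuartics W E)
    {τ : ℝ} (h1 : 1 ≤ 2 * τ) (h4 : 4 ≤ τ ^ 2) (hk : 3 * (Fintype.card Ω : ℝ) ≤ τ ^ 4) (d : ℕ)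
    {f : (ι → Ω) → A} (hf : ∀ x, f x ∈ W) :
    (Fintype.card Ω : ℝ) ^ Fintype.card ι * ∑ x, E (act (lowDegree 1 d) f x ^ 4)
      ≤ 16 ^ d * pairSum E f f + 3 * Fintype.card Ω * (2 * τ) ^ (4 * d) * ∑ i,
        pairSum E (act (prodKernel (fun l => if l = i then 0 else 1) fun _ => 1 / 2) f)
          (act (prodKernel (fun l => if l = i then 0 else 1) fun _ => 1 / 2) f) := by
  refine (hE.sum_pow_four_le h4 hk _ (act_mem _ hf)).trans ?_
  have hle : ∀ {ρ : ℝ} (_ : 1 ≤ ρ) {g : (ι → Ω) → A} (_ : ∀ x, g x ∈ W),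
      pairSum E (act (lowDegree ρ d) g) (act (lowDegree ρ d) g)
        ≤ ρ ^ (4 * d) * pairSum E g g := by
    intro ρ hρ g hg
    have h := pairSum_act_le (E := E) hg (pow_nonneg (zero_le_one.trans hρ) (2 * d))
      fun b hb => sum_sq_act_lowDegree_le (hE.sqWeight hb) hρ d hg
    rwa [← pow_mul, show 2 * d * 2 = 4 * d by ring] at h
  simp only [← act_mul, prodKernel_mul_lowDegree, prodKernel_deriv_mul_lowDegree]
  refine add_le_add ?_ ?_
  · have h := hle (one_le_two) hf
    rw [pow_mul] at h
    norm_num at h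
    exact h
  · rw [mul_assoc _ ((2 * τ) ^ (4 * d))]
    refine mul_le_mul_of_nonneg_left ?_ (by positivity)
    rw [Finset.mul_sum]
    refine Finset.sum_le_sum fun i _ => ?_
    rw [act_mul]
    exact hle h1 (act_mem _ hf)

/-- The noise operator is bounded by a scalar and the projection to low degrees. -/
theorem form_noise_le [Nonempty Ω] {F : A →ₗ[ℝ] ℝ} (hF : NonnegOnSquares W F) {r z : ℝ}
    (h0 : 0 ≤ r) (h1 : r ≤ 1) {d : ℕ} (hz : r ^ (d + 1) ≤ z) {f : (ι → Ω) → A}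
    (hf : ∀ x, f x ∈ W) :
    form F (prodKernel (fun _ => 1) fun _ => r) f
      ≤ z * ∑ x, F (f x ^ 2) + (1 - z) * form F (lowDegree 1 d) f := by
  have e : z * ∑ x, F (f x ^ 2) + (1 - z) * form F (lowDegree 1 d) f
      = form F (multiplier fun S => z + (1 - z) * if S.card ≤ d then 1 else 0) f := by
    unfold lowDegree
    rw [sum_sq_eq_form_multiplier]
    simp only [form_multiplier, Finset.mul_sum, add_mul, Finset.sum_add_distrib, one_mul, one_pow,
      mul_assoc]
  rw [e, prodKernel_eq_multiplier]
  refine form_multiplier_mono hF (fun S => ?_) hf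
  simp only [Finset.prod_const, one_pow, mul_one]
  split_ifs with h
  · rw [mul_one, add_sub_cancel]
    exact pow_le_one₀ h0 h1
  · rw [mul_zero, add_zero]
    exact (pow_le_pow_of_le_one h0 h1 (by omega)).trans hz

end LowDegree

section Value

variable {A : Type} [CommRing A] [Algebra ℝ A] {W : Submodule ℝ A} {E : A →ₗ[ℝ] ℝ}
variable {V L Ω : Type} [Fintype V] [DecidableEq V] [Fintype L] [DecidableEq L]
  [Fintype Ω] [DecidableEq Ω]

/-- The form in which Young's inequality is used: for the functional `E` the element `p` behaves
like a convex combination of quantities with values `0` and `1`. -/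
def YoungBound (W : Submodule ℝ A) (E : A →ₗ[ℝ] ℝ) (p : A) : Prop :=
  ∀ h ∈ W, ∀ s t : ℝ, 0 < s → 0 < t →
    E (h * p) ≤ s / (4 * t) * E (h ^ 4) + (t / 2 + 1 / (4 * s * t)) * E p

/-- The value of the quadratic form of the noise operator on the averages `g` of `f`. Here `q` is
the fourth root of the size of the alphabet. -/
theorem NonnegOnQuartics.sum_form_noise_le [Nonempty Ω] [Nonempty V] [Nonempty L]
    (hE : NonnegOnQuartics W E) (h1 : (1 : A) ∈ W) (hE1 : E 1 = 1) (U : UniqueGame V L)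
    (ψ : V × L ≃ (L → ZMod 2)) {r : ℝ} (hr : 0 ≤ r)
    (hU : ∀ p q, Fintype.card V * (Fintype.card L * U.labelExtended p q)
      = prodKernel (fun _ => 1) (fun _ => r) (ψ p) (ψ q))
    {s : ℕ} (hs : 2 * r ^ (2 * s + 1) ≤ 1 - (r ^ (2 * s + 1)) ^ 2) {l : ℝ} (hl : 0 < l)
    {q M : ℝ} (hq : 0 < q) (hq4 : q ^ 4 = Fintype.card Ω)
    (hM : Fintype.card Ω * M = (Fintype.card Ω : ℝ) ^ Fintype.card L)
    {f g : V × (L → Ω) → A} (hf : ∀ z, f z ∈ W) (hg : g = act (U.avgKernel Ω) f)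
    (hfM : ∀ b ∈ W, ∑ z, E (b ^ 2 * f z ^ 2) ≤ Fintype.card V * M * E (b ^ 2))
    (hgM : ∀ b ∈ W, ∀ u, ∑ x, E (b ^ 2 * g (u, x) ^ 2) ≤ M * E (b ^ 2))
    (hg1 : ∑ z, E (g z) = Fintype.card V * M) (hY : ∀ z, YoungBound W E (g z))
    {ρ z : ℝ} (hρ0 : 0 ≤ ρ) (hρ1 : ρ ≤ 1) {d : ℕ} (hz : ρ ^ (d + 1) ≤ z) (hz1 : z ≤ 1) :
    Fintype.card Ω / (Fintype.card V * (Fintype.card Ω : ℝ) ^ Fintype.card L) *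
      ∑ u, form E (prodKernel (fun _ => 1) fun _ => ρ) (fun x => g (u, x))
      ≤ z + (1 - z) * (2 ^ d / q + 3 * q ^ 3 * (32 * (Fintype.card Ω : ℝ) ^ 2) ^ d *
        ((l⁻¹) ^ (4 * s) / Fintype.card L + l)) := by
  have hV : (0 : ℝ) < Fintype.card V := by exact_mod_cast Fintype.card_pos
  have hk1 : (1 : ℝ) ≤ Fintype.card Ω := by exact_mod_cast Fintype.card_pos
  have hEs : NonnegOnSquares W E := fun a ha => by
    have h := hE.sqWeight h1 a ha
    rwa [sqWeight_apply, one_pow, one_mul] at h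
  have hgm : ∀ z, g z ∈ W := fun z => by rw [hg]; exact act_mem _ hf z
  set k : ℝ := ((Fintype.card Ω : ℕ) : ℝ) with hk
  set n : ℝ := ((Fintype.card V : ℕ) : ℝ) with hn
  have hk0 : 0 < k := by linarith
  have hM0 : 0 < M := by
    have : 0 < k * M := by rw [hM]; positivity
    exact (pos_iff_pos_of_mul_pos this).1 hk0
  set δ : ℝ := (l⁻¹) ^ (4 * s) / Fintype.card L + l with hδ
  set h : V → (L → Ω) → A := fun u => act (lowDegree 1 d) fun x => g (u, x) with hh
  have hhm : ∀ u x, h u x ∈ W := fun u => act_mem _ fun x => hgm _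
  have hq1 : 1 ≤ q ^ 2 := by
    have : (1 : ℝ) ≤ (q ^ 2) ^ 2 := by rw [← pow_mul, hq4]; exact hk1
    nlinarith [sq_nonneg q]
  -- the fourth moment of the low-degree part
  have hfour : k * M * ∑ u, ∑ x, E (h u x ^ 4)
      ≤ n * M ^ 2 * (16 ^ d + 12 * k * (256 * k ^ 2) ^ d * δ) := by
    have q1 := Finset.sum_le_sum fun u (_ : u ∈ Finset.univ) =>
      hE.sum_lowDegree_pow_four_le (τ := 2 * q ^ 2) (by linarith) (by nlinarith)
        (by
          rw [← hk, show (2 * q ^ 2) ^ 4 = 16 * (q ^ 4) ^ 2 by ring, hq4]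
          nlinarith) d (fun x => hgm (u, x))
    rw [← Finset.mul_sum, Finset.sum_add_distrib, ← Finset.mul_sum, ← Finset.mul_sum, ← hk,
      ← hM] at q1
    refine q1.trans ?_
    have q2 : ∑ u, pairSum E (fun x => g (u, x)) (fun x => g (u, x)) ≤ n * M ^ 2 := by
      have q3 : ∀ u, pairSum E (fun x => g (u, x)) (fun x => g (u, x)) ≤ M ^ 2 := by
        intro u
        have q4 : pairSum E (fun x => g (u, x)) (fun x => g (u, x))
            ≤ ∑ x, M * E (g (u, x) ^ 2) := Finset.sum_le_sum fun x _ => hgM _ (hgm _) u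
        rw [← Finset.mul_sum] at q4
        have q5 := hgM 1 h1 u
        simp only [one_pow, one_mul, hE1, mul_one] at q5
        rw [pow_two]
        exact q4.trans (mul_le_mul_of_nonneg_left q5 hM0.le)
      refine (Finset.sum_le_sum fun u _ => q3 u).trans ?_
      rw [Finset.sum_const, Finset.card_univ, nsmul_eq_mul]
    have q6 := hE.sum_pairSum_deriv_le h1 hE1 U ψ hr hU hs hl hM0.le hf hg hfM hgM
    rw [Fintype.sum_prod_type] at q6
    simp only [act_derivKernel] at q6
    rw [← hδ, ← hn] at q6
    have e : (2 * (2 * q ^ 2)) ^ (4 * d) = (256 * k ^ 2) ^ d := by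
      rw [pow_mul]
      congr 1
      rw [← hq4]
      ring
    rw [e]
    have q7 := mul_le_mul_of_nonneg_left q6
      (by positivity : 0 ≤ 3 * k * (256 * k ^ 2) ^ d)
    have q8 := mul_le_mul_of_nonneg_left q2 (by positivity : (0 : ℝ) ≤ 16 ^ d)
    refine (add_le_add q8 q7).trans (le_of_eq ?_)
    ring
  -- correlation of `g` with its low-degree part; the choice of parameters makes the contribution
  -- of the main term of the fourth moment and that of the mean of `g` proportional to `2 ^ d / q`
  have hlow : ∑ u, form E (lowDegree 1 d) (fun x => g (u, x))
      ≤ q ^ 3 / (4 * 8 ^ d) * ∑ u, ∑ x, E (h u x ^ 4) + 3 * 2 ^ d / (4 * q) * (n * M) := by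
    have q1 : ∀ u x, E (h u x * g (u, x)) ≤ q ^ 3 / (4 * 8 ^ d) * E (h u x ^ 4)
        + 3 * 2 ^ d / (4 * q) * E (g (u, x)) := by
      intro u x
      have q2 := hY (u, x) _ (hhm u x) (q ^ 2 / 4 ^ d) (2 ^ d / q) (by positivity) (by positivity)
      have e8 : (8 : ℝ) ^ d = 4 ^ d * 2 ^ d := by rw [← mul_pow]; norm_num
      have e4 : (4 : ℝ) ^ d = 2 ^ d * 2 ^ d := by rw [← mul_pow]; norm_num
      have e1 : q ^ 2 / 4 ^ d / (4 * (2 ^ d / q)) = q ^ 3 / (4 * 8 ^ d) := by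
        rw [e8]
        field_simp
      have e2 : 2 ^ d / q / 2 + 1 / (4 * (q ^ 2 / 4 ^ d) * (2 ^ d / q))
          = 3 * 2 ^ d / (4 * q) := by
        rw [e4]
        field_simp
        ring
      rwa [e1, e2] at q2
    have q3 : ∀ u, form E (lowDegree 1 d) (fun x => g (u, x)) = ∑ x, E (h u x * g (u, x)) := by
      intro u
      simp only [hh, act, form, Finset.sum_mul, map_sum, smul_mul_assoc, map_smul, smul_eq_mul]
      refine Finset.sum_congr rfl fun x _ => Finset.sum_congr rfl fun y _ => ?_
      rw [mul_comm (g (u, x))]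
    rw [← hg1, Fintype.sum_prod_type, Finset.mul_sum, Finset.mul_sum, ← Finset.sum_add_distrib]
    refine Finset.sum_le_sum fun u _ => ?_
    rw [q3, Finset.mul_sum, Finset.mul_sum, ← Finset.sum_add_distrib]
    exact Finset.sum_le_sum fun x _ => q1 u x
  have hnoise : ∑ u, form E (prodKernel (fun _ => 1) fun _ => ρ) (fun x => g (u, x))
      ≤ z * (n * M) + (1 - z) * ∑ u, form E (lowDegree 1 d) (fun x => g (u, x)) := by
    have hz0 : 0 ≤ z := (pow_nonneg hρ0 _).trans hz
    have q1 := Finset.sum_le_sum fun u (_ : u ∈ Finset.univ) =>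
      form_noise_le hEs hρ0 hρ1 hz fun x => hgm (u, x)
    rw [Finset.sum_add_distrib, ← Finset.mul_sum, ← Finset.mul_sum] at q1
    refine q1.trans (add_le_add (mul_le_mul_of_nonneg_left ?_ hz0) le_rfl)
    have q2 : ∀ u, ∑ x, E (g (u, x) ^ 2) ≤ M := fun u => by
      have q3 := hgM 1 h1 u
      simpa only [one_pow, one_mul, hE1, mul_one] using q3
    refine (Finset.sum_le_sum fun u _ => q2 u).trans ?_
    rw [Finset.sum_const, Finset.card_univ, nsmul_eq_mul]
  have hc : k / (n * k ^ Fintype.card L) = 1 / (n * M) := by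
    rw [← hM]
    field_simp
  rw [hc]
  have hnM : 0 < n * M := by positivity
  have hm : 1 / (n * M) * ∑ u, form E (lowDegree 1 d) (fun x => g (u, x))
      ≤ 2 ^ d / q + 3 * q ^ 3 * (32 * k ^ 2) ^ d * δ := by
    have q1 : ∑ u, ∑ x, E (h u x ^ 4)
        ≤ n * M * (16 ^ d + 12 * k * (256 * k ^ 2) ^ d * δ) / k := by
      rw [le_div_iff₀ hk0]
      refine le_of_mul_le_mul_left ?_ hM0
      linarith
    have q2 := hlow.trans (add_le_add (mul_le_mul_of_nonneg_left q1
      (by positivity : 0 ≤ q ^ 3 / (4 * 8 ^ d))) le_rfl)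
    rw [one_div, inv_mul_le_iff₀ hnM]
    refine q2.trans (le_of_eq ?_)
    have e1 : (256 * k ^ 2) ^ d = 8 ^ d * (32 * k ^ 2) ^ d := by rw [← mul_pow]; ring
    have e2 : (16 : ℝ) ^ d = 8 ^ d * 2 ^ d := by rw [← mul_pow]; norm_num
    rw [e1, e2, ← hq4]
    field_simp
    ring
  calc 1 / (n * M) * ∑ u, form E (prodKernel (fun _ => 1) fun _ => ρ) (fun x => g (u, x))
      ≤ 1 / (n * M) *
        (z * (n * M) + (1 - z) * ∑ u, form E (lowDegree 1 d) (fun x => g (u, x))) :=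
        mul_le_mul_of_nonneg_left hnoise (by positivity)
    _ = z + (1 - z) * (1 / (n * M) * ∑ u, form E (lowDegree 1 d) (fun x => g (u, x))) := by
        field_simp
    _ ≤ _ := by
        have := mul_le_mul_of_nonneg_left hm (by linarith : 0 ≤ 1 - z)
        linarith

end Value

open MvPolynomial

/-! ### Pseudo-expectations of assignments and folded long codes -/

section Assignments

variable {B S : Type} [Fintype S] {E : MvPolynomial (B × S) ℝ →ₗ[ℝ] ℝ}

/-- The polynomials of degree at most one. -/
abbrev affineForms (σ : Type) : Submodule ℝ (MvPolynomial σ ℝ) := restrictTotalDegree σ ℝ 1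

theorem totalDegree_le_of_mem_affineForms_mul {σ : Type} {P : MvPolynomial σ ℝ}
    (hP : P ∈ affineForms σ * affineForms σ) : P.totalDegree ≤ 2 := by
  refine Submodule.mul_induction_on hP (fun a ha b hb => ?_) fun a b ha hb =>
    (totalDegree_add a b).trans (max_le ha hb)
  rw [mem_restrictTotalDegree] at ha hb
  exact (totalDegree_mul a b).trans (by omega)

theorem sq_mem_affineForms_mul {σ : Type} {P : MvPolynomial σ ℝ} (hP : P ∈ affineForms σ) :
    P ^ 2 ∈ affineForms σ * affineForms σ := by
  rw [pow_two]
  exact Submodule.mul_mem_mul hP hP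

theorem X_mem_affineForms {σ : Type} (i : σ) : (X i : MvPolynomial σ ℝ) ∈ affineForms σ := by
  rw [mem_restrictTotalDegree, totalDegree_X]

theorem one_mem_affineForms (σ : Type) : (1 : MvPolynomial σ ℝ) ∈ affineForms σ := by
  rw [mem_restrictTotalDegree, totalDegree_one]
  exact zero_le_one

theorem IsPseudoExpectation.nonnegOnQuartics {σ : Type} {E : MvPolynomial σ ℝ →ₗ[ℝ] ℝ}
    (hE : IsPseudoExpectation 8 E) : NonnegOnQuartics (affineForms σ) E := fun P hP =>
  hE.sq_nonneg P (by have := totalDegree_le_of_mem_affineForms_mul hP; omega)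

/-- The Cauchy–Schwarz inequality: a polynomial whose square has pseudo-expectation zero is
orthogonal to all others. -/
theorem IsPseudoExpectation.map_mul_eq_zero {σ : Type} {E : MvPolynomial σ ℝ →ₗ[ℝ] ℝ}
    (hE : IsPseudoExpectation 8 E) {P Q : MvPolynomial σ ℝ} (hP : P.totalDegree ≤ 2)
    (hQ : Q.totalDegree ≤ 2) (h0 : E (P ^ 2) = 0) : E (P * Q) = 0 := by
  have h : ∀ t : ℝ, 0 ≤ 2 * t * E (P * Q) + E (Q ^ 2) := by
    intro t
    have hd : (t • P + Q).totalDegree ≤ 2 :=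
      (totalDegree_add _ _).trans (max_le ((totalDegree_smul_le _ _).trans hP) hQ)
    have h := hE.sq_nonneg (t • P + Q) (by omega)
    have e : (t • P + Q) ^ 2 = t ^ 2 • P ^ 2 + (2 * t) • (P * Q) + Q ^ 2 := by
      simp only [Algebra.smul_def, map_mul, map_pow, map_ofNat]
      ring
    rw [e, map_add, map_add, map_smul, map_smul, h0, smul_zero, zero_add, smul_eq_mul] at h
    exact h
  by_contra hne
  have h1 := h (-(E (Q ^ 2) + 1) / (2 * E (P * Q)))
  have e : 2 * (-(E (Q ^ 2) + 1) / (2 * E (P * Q))) * E (P * Q) = -(E (Q ^ 2) + 1) := by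
    field_simp
  rw [e] at h1
  linarith

theorem IsPseudoExpectation.map_mul_X_sq (hE : IsPseudoExpectation 8 E)
    (hc : ∀ P ∈ UniqueGame.assignmentConstraints B S, E (P ^ 2) = 0) (v : B × S)
    {Q : MvPolynomial (B × S) ℝ} (hQ : Q.totalDegree ≤ 2) :
    E (Q * X v ^ 2) = E (Q * X v) := by
  have hd : (X v ^ 2 - X v : MvPolynomial (B × S) ℝ).totalDegree ≤ 2 := by
    refine (totalDegree_sub _ _).trans (max_le ?_ ?_)
    · rw [totalDegree_X_pow]
    · rw [totalDegree_X]; exact one_le_two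
  have h := hE.map_mul_eq_zero hd hQ (hc _ (Or.inl ⟨v.1, v.2, rfl⟩))
  rw [sub_mul, map_sub, sub_eq_zero] at h
  rw [mul_comm Q, mul_comm Q]
  exact h

theorem IsPseudoExpectation.sum_map_mul_X (hE : IsPseudoExpectation 8 E)
    (hc : ∀ P ∈ UniqueGame.assignmentConstraints B S, E (P ^ 2) = 0) (v : B)
    {Q : MvPolynomial (B × S) ℝ} (hQ : Q.totalDegree ≤ 2) :
    ∑ a, E (Q * X (v, a)) = E Q := by
  have hd : ((∑ a : S, X (v, a)) - 1 : MvPolynomial (B × S) ℝ).totalDegree ≤ 2 := by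
    have h : ((∑ a : S, X (v, a)) - 1 : MvPolynomial (B × S) ℝ) ∈ affineForms (B × S) :=
      Submodule.sub_mem _ (Submodule.sum_mem _ fun a _ => X_mem_affineForms _)
        (one_mem_affineForms _)
    exact ((mem_restrictTotalDegree _ _ _).1 h).trans one_le_two
  have h := hE.map_mul_eq_zero hd hQ (hc _ (Or.inr ⟨v, rfl⟩))
  rw [sub_mul, map_sub, sub_eq_zero, one_mul, Finset.sum_mul, map_sum] at h
  simp only [mul_comm Q]
  exact h

theorem IsPseudoExpectation.youngBound_X (hE : IsPseudoExpectation 8 E)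
    (hc : ∀ P ∈ UniqueGame.assignmentConstraints B S, E (P ^ 2) = 0) (v : B × S) :
    YoungBound (affineForms (B × S)) E (X v) := by
  intro h hh s t hs ht
  have hh2 := sq_mem_affineForms_mul hh
  have hX := X_mem_affineForms v
  have h1m := one_mem_affineForms (B × S)
  have hX2 : E (X v ^ 2) = E (X v) := by
    simpa using hE.map_mul_X_sq hc v (Q := 1) (by simp)
  have hhX := hE.map_mul_X_sq hc v (totalDegree_le_of_mem_affineForms_mul hh2)
  -- `h X = (h X) X`, up to a term that vanishes
  have hh1 : E (h * X v) = E (h * X v * X v) := by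
    have h2 := hE.map_mul_X_sq hc v (Q := h)
      (((mem_restrictTotalDegree _ _ _).1 hh).trans one_le_two)
    rw [← h2]
    ring_nf
  have q1 : 2 * (t * E (h * X v)) ≤ E (h ^ 2 * X v) + t ^ 2 * E (X v) := by
    have q := hE.nonnegOnQuartics _ (Submodule.sub_mem _ (Submodule.mul_mem_mul hh hX)
      (Submodule.smul_mem _ t (Submodule.mul_mem_mul h1m hX)))
    have e : (h * X v - t • (1 * X v)) ^ 2
        = h ^ 2 * X v ^ 2 + t ^ 2 • X v ^ 2 - (2 * t) • (h * X v * X v) := by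
      simp only [Algebra.smul_def, map_mul, map_pow, map_ofNat]
      ring
    rw [e, map_sub, map_add, map_smul, map_smul, hX2, hhX, ← hh1, smul_eq_mul, smul_eq_mul] at q
    linarith
  have q2 : 2 * (s * E (h ^ 2 * X v)) ≤ s ^ 2 * E (h ^ 4) + E (X v) := by
    have q := hE.nonnegOnQuartics _ (Submodule.sub_mem _ (Submodule.smul_mem _ s hh2)
      (Submodule.mul_mem_mul h1m hX))
    have e : (s • h ^ 2 - 1 * X v) ^ 2
        = s ^ 2 • h ^ 4 + X v ^ 2 - (2 * s) • (h ^ 2 * X v) := by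
      simp only [Algebra.smul_def, map_mul, map_pow, map_ofNat]
      ring
    rw [e, map_sub, map_add, map_smul, map_smul, hX2, smul_eq_mul, smul_eq_mul] at q
    linarith
  have q3 : 4 * s * t * E (h * X v) ≤ s ^ 2 * E (h ^ 4) + E (X v) + 2 * s * t ^ 2 * E (X v) := by
    have := mul_le_mul_of_nonneg_left q1 (by positivity : 0 ≤ 2 * s)
    linarith
  have e : s / (4 * t) * E (h ^ 4) + (t / 2 + 1 / (4 * s * t)) * E (X v)
      = (s ^ 2 * E (h ^ 4) + E (X v) + 2 * s * t ^ 2 * E (X v)) / (4 * s * t) := by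
    field_simp
    ring
  rw [e, le_div_iff₀ (by positivity)]
  linarith

theorem YoungBound.sum {A : Type} [CommRing A] [Algebra ℝ A] {W : Submodule ℝ A}
    {E : A →ₗ[ℝ] ℝ} {ι : Type*} [Fintype ι] {w : ι → ℝ}
    (h0 : ∀ i, 0 ≤ w i) (h1 : ∑ i, w i = 1) {p : ι → A} (hp : ∀ i, YoungBound W E (p i)) :
    YoungBound W E (∑ i, w i • p i) := by
  intro h hh s t hs ht
  have e : s / (4 * t) * E (h ^ 4) + (t / 2 + 1 / (4 * s * t)) * E (∑ i, w i • p i)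
      = ∑ i, w i * (s / (4 * t) * E (h ^ 4) + (t / 2 + 1 / (4 * s * t)) * E (p i)) := by
    simp only [mul_add, Finset.sum_add_distrib, ← Finset.sum_mul, h1, one_mul, map_sum, map_smul,
      smul_eq_mul, Finset.mul_sum]
    congr 1
    refine Finset.sum_congr rfl fun i _ => ?_
    ring
  rw [e, Finset.mul_sum, map_sum]
  refine Finset.sum_le_sum fun i _ => ?_
  rw [mul_smul_comm, map_smul, smul_eq_mul]
  exact mul_le_mul_of_nonneg_left (hp i h hh s t hs ht) (h0 i)

end Assignments

section LongCode

variable {V L : Type} [Fintype L] [DecidableEq L] {k : ℕ} [NeZero k]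

/-- The average over `c` of the indicators that the long code of `v` takes the value `c` at
`x - c`: the folded long code. -/
def folded (V L : Type) (k : ℕ) [NeZero k] (z : V × (L → ZMod k)) :
    MvPolynomial ((V × (L → ZMod k)) × ZMod k) ℝ :=
  ∑ c : ZMod k, (1 / k : ℝ) • X ((z.1, fun i => z.2 i - c), c)

theorem folded_mem (z : V × (L → ZMod k)) : folded V L k z ∈ affineForms _ :=
  Submodule.sum_mem _ fun _ _ => Submodule.smul_mem _ _ (X_mem_affineForms _)

theorem sum_one_div_card : ∑ _c : ZMod k, (1 / k : ℝ) = 1 := by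
  have hk : (k : ℝ) ≠ 0 := by exact_mod_cast NeZero.ne k
  rw [Finset.sum_const, Finset.card_univ, ZMod.card, nsmul_eq_mul, mul_one_div_cancel hk]

/-- Translations preserve sums over the points of `ZMod k ^ L`. -/
theorem sum_sub_const {M : Type*} [AddCommMonoid M] (c : ZMod k) (p : (L → ZMod k) → M) :
    ∑ x : L → ZMod k, p (fun i => x i - c) = ∑ x, p x :=
  (Equiv.subRight fun _ => c).sum_comp p

variable {E : MvPolynomial ((V × (L → ZMod k)) × ZMod k) ℝ →ₗ[ℝ] ℝ}

theorem IsPseudoExpectation.sum_folded (hE : IsPseudoExpectation 8 E)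
    (hc : ∀ P ∈ UniqueGame.assignmentConstraints (V × (L → ZMod k)) (ZMod k), E (P ^ 2) = 0)
    {Q : MvPolynomial ((V × (L → ZMod k)) × ZMod k) ℝ} (hQ : Q.totalDegree ≤ 2) (v : V) :
    ∑ x : L → ZMod k, ∑ c : ZMod k, (1 / k : ℝ) * E (Q * X ((v, fun i => x i - c), c))
      = (k : ℝ) ^ Fintype.card L / k * E Q := by
  rw [Finset.sum_comm]
  simp only [← Finset.mul_sum]
  have h : ∀ c : ZMod k, ∑ x : L → ZMod k, E (Q * X ((v, fun i => x i - c), c))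
      = ∑ x, E (Q * X ((v, x), c)) := fun c =>
    sum_sub_const c fun x => E (Q * X ((v, x), c))
  simp only [h]
  rw [Finset.sum_comm]
  simp only [hE.sum_map_mul_X hc _ hQ, Finset.sum_const, Finset.card_univ, nsmul_eq_mul,
    Fintype.card_fun, ZMod.card]
  push_cast
  ring

theorem IsPseudoExpectation.sum_sq_folded_le (hE : IsPseudoExpectation 8 E)
    (hc : ∀ P ∈ UniqueGame.assignmentConstraints (V × (L → ZMod k)) (ZMod k), E (P ^ 2) = 0)
    {b : MvPolynomial ((V × (L → ZMod k)) × ZMod k) ℝ} (hb : b ∈ affineForms _) (v : V) :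
    ∑ x, E (b ^ 2 * folded V L k (v, x) ^ 2) ≤ (k : ℝ) ^ Fintype.card L / k * E (b ^ 2) := by
  have hb2 := totalDegree_le_of_mem_affineForms_mul (sq_mem_affineForms_mul hb)
  rw [← hE.sum_folded hc hb2 v]
  refine Finset.sum_le_sum fun x _ => ?_
  refine (sq_act_le (hE.nonnegOnQuartics.sqWeight hb) (w := fun _ : ZMod k => (1 / k : ℝ))
    (fun _ => by positivity) sum_one_div_card fun c => X_mem_affineForms _).trans (le_of_eq ?_)
  refine Finset.sum_congr rfl fun c _ => ?_
  rw [sqWeight_apply, hE.map_mul_X_sq hc _ hb2]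

theorem IsPseudoExpectation.sum_map_folded (hE : IsPseudoExpectation 8 E)
    (hc : ∀ P ∈ UniqueGame.assignmentConstraints (V × (L → ZMod k)) (ZMod k), E (P ^ 2) = 0)
    (v : V) : ∑ x, E (folded V L k (v, x)) = (k : ℝ) ^ Fintype.card L / k := by
  have h := hE.sum_folded hc (Q := 1) (by simp) v
  rw [hE.map_one, mul_one] at h
  rw [← h]
  simp [folded, map_sum, map_smul]

theorem IsPseudoExpectation.youngBound_folded (hE : IsPseudoExpectation 8 E)
    (hc : ∀ P ∈ UniqueGame.assignmentConstraints (V × (L → ZMod k)) (ZMod k), E (P ^ 2) = 0)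
    (z : V × (L → ZMod k)) : YoungBound (affineForms _) E (folded V L k z) :=
  YoungBound.sum (fun _ => by positivity) sum_one_div_card
    fun c => hE.youngBound_X hc _

theorem noise_sub_const (ε : ℝ) (b : ZMod k) (x y : L → ZMod k) :
    noise ε (fun i => x i - b) (fun i => y i - b) = noise ε x y := by
  simp [noise]

/-- The constraints between two long codes, averaged over the shift: after a translation of both
points they become constraints between the folded long codes. -/
theorem sum_noise_mul_eq_folded (ε : ℝ) (v v' : V) (σ σ' : Equiv.Perm L) :
    ∑ x : L → ZMod k, ∑ y, ∑ c, noise ε x y * ∑ a : ZMod k,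
      E (X ((v, fun i => x (σ i)), a - c) * X ((v', fun i => y (σ' i) - c), a))
    = (k : ℝ) ^ 2 * ∑ x, ∑ y, noise ε x y *
      E (folded V L k (v, x ∘ σ) * folded V L k (v', y ∘ σ')) := by
  have hk : (k : ℝ) ≠ 0 := by exact_mod_cast NeZero.ne k
  -- the right-hand side, expanded
  have hr : ∀ x y : L → ZMod k, (k : ℝ) ^ 2 * (noise ε x y *
      E (folded V L k (v, x ∘ σ) * folded V L k (v', y ∘ σ')))
      = ∑ b, ∑ a, noise ε x y *
        E (X ((v, fun i => x (σ i) - b), b) * X ((v', fun i => y (σ' i) - a), a)) := by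
    intro x y
    simp only [folded, Finset.sum_mul_sum, map_sum, smul_mul_smul_comm, map_smul, smul_eq_mul,
      ← Finset.mul_sum, Function.comp]
    field_simp
  -- both sides for a fixed pair of symbols
  have hab : ∀ a b : ZMod k, ∑ x : L → ZMod k, ∑ y, noise ε x y *
      E (X ((v, fun i => x (σ i)), b) * X ((v', fun i => y (σ' i) - (a - b)), a))
      = ∑ x : L → ZMod k, ∑ y, noise ε x y *
      E (X ((v, fun i => x (σ i) - b), b) * X ((v', fun i => y (σ' i) - a), a)) := by
    intro a b
    rw [← sum_sub_const b fun x : L → ZMod k => ∑ y, noise ε x y *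
      E (X ((v, fun i => x (σ i)), b) * X ((v', fun i => y (σ' i) - (a - b)), a))]
    refine Finset.sum_congr rfl fun x _ => ?_
    rw [← sum_sub_const b fun y : L → ZMod k => noise ε (fun i => x i - b) y *
      E (X ((v, fun i => x (σ i) - b), b) * X ((v', fun i => y (σ' i) - (a - b)), a))]
    refine Finset.sum_congr rfl fun y _ => ?_
    rw [noise_sub_const]
    simp only [sub_sub, add_sub_cancel]
  simp only [Finset.mul_sum, hr]
  have hl : ∀ x y : L → ZMod k, ∑ c, ∑ a : ZMod k, noise ε x y *
      E (X ((v, fun i => x (σ i)), a - c) * X ((v', fun i => y (σ' i) - c), a))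
      = ∑ b, ∑ a, noise ε x y *
      E (X ((v, fun i => x (σ i)), b) * X ((v', fun i => y (σ' i) - (a - b)), a)) := by
    intro x y
    rw [Finset.sum_comm, Finset.sum_comm (γ := ZMod k) (s := Finset.univ) (t := Finset.univ)
      (f := fun b a => noise ε x y *
        E (X ((v, fun i => x (σ i)), b) * X ((v', fun i => y (σ' i) - (a - b)), a)))]
    refine Finset.sum_congr rfl fun a _ => ?_
    rw [← (Equiv.subLeft a).sum_comp]
    simp
  simp only [hl]
  have hswap : ∀ p : (L → ZMod k) → (L → ZMod k) → ZMod k → ZMod k → ℝ,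
      ∑ x, ∑ y, ∑ b, ∑ a, p x y b a = ∑ b, ∑ a, ∑ x, ∑ y, p x y b a := by
    intro p
    simp only [← Finset.sum_product', Finset.univ_product_univ]
    exact Finset.sum_equiv ((Equiv.refl _).trans
      { toFun := fun z => (z.2.2.1, z.2.2.2, z.1, z.2.1)
        invFun := fun z => (z.2.2.1, z.2.2.2, z.1, z.2.1)
        left_inv := fun _ => rfl
        right_inv := fun _ => rfl }) (by simp) (by simp)
  rw [hswap, hswap]
  exact Finset.sum_congr rfl fun b _ => Finset.sum_congr rfl fun a _ => hab a b

end LongCode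

/-! ### The objective of the long-code reduction -/

section Objective

variable {V L : Type} [Fintype V] [DecidableEq V] [Fintype L] [DecidableEq L] {k : ℕ} [NeZero k]

/-- The averages of the folded long codes over the neighbours of a vertex. -/
def neighborAvg (U : UniqueGame V L) (k : ℕ) [NeZero k] :
    V × (L → ZMod k) → MvPolynomial ((V × (L → ZMod k)) × ZMod k) ℝ :=
  act (U.avgKernel (ZMod k)) (folded V L k)

/-- The weights with which the constraints at `u` enter `neighborAvg`. -/
def nbrWeight (U : UniqueGame V L) (u : V) (e : U.Constraint) : ℝ :=
  if U.src e = u then Fintype.card V * U.weight e else 0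

theorem nbrWeight_nonneg (U : UniqueGame V L) (u : V) (e : U.Constraint) :
    0 ≤ nbrWeight U u e := by
  have := U.weight_nonneg e
  unfold nbrWeight
  split_ifs <;> positivity

theorem sum_nbrWeight (U : UniqueGame V L) (u : V) :
    ∑ e, nbrWeight U u e = Fintype.card V * U.srcProb u := by
  rw [UniqueGame.srcProb, Finset.mul_sum]
  refine Finset.sum_congr rfl fun e _ => ?_
  unfold nbrWeight
  by_cases h : U.src e = u <;> simp [h]

theorem neighborAvg_eq (U : UniqueGame V L) (u : V) (x : L → ZMod k) :
    neighborAvg U k (u, x)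
      = ∑ e, nbrWeight U u e • folded V L k (U.dst e, x ∘ U.perm e) := by
  rw [neighborAvg, UniqueGame.act_avgKernel]
  refine Finset.sum_congr rfl fun e _ => ?_
  simp only [nbrWeight, ite_smul, zero_smul]

theorem sum_comp_perm {M : Type*} [AddCommMonoid M] (σ : Equiv.Perm L)
    (p : (L → ZMod k) → M) : ∑ x : L → ZMod k, p (x ∘ σ) = ∑ x, p x :=
  (Equiv.arrowCongr σ.symm (Equiv.refl (ZMod k))).sum_comp p

variable {E : MvPolynomial ((V × (L → ZMod k)) × ZMod k) ℝ →ₗ[ℝ] ℝ}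

theorem IsPseudoExpectation.sum_sq_neighborAvg_le (hE : IsPseudoExpectation 8 E)
    (hc : ∀ P ∈ UniqueGame.assignmentConstraints (V × (L → ZMod k)) (ZMod k), E (P ^ 2) = 0)
    (U : UniqueGame V L) (hU : ∀ u, Fintype.card V * U.srcProb u = 1)
    {b : MvPolynomial ((V × (L → ZMod k)) × ZMod k) ℝ} (hb : b ∈ affineForms _) (u : V) :
    ∑ x, E (b ^ 2 * neighborAvg U k (u, x) ^ 2) ≤ (k : ℝ) ^ Fintype.card L / k * E (b ^ 2) := by
  have h1 : ∑ e, nbrWeight U u e = 1 := by rw [sum_nbrWeight, hU]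
  have h : ∀ x : L → ZMod k, E (b ^ 2 * neighborAvg U k (u, x) ^ 2)
      ≤ ∑ e, nbrWeight U u e * E (b ^ 2 * folded V L k (U.dst e, x ∘ U.perm e) ^ 2) := by
    intro x
    rw [neighborAvg_eq]
    exact sq_act_le (hE.nonnegOnQuartics.sqWeight hb) (nbrWeight_nonneg U u) h1
      fun e => folded_mem _
  refine (Finset.sum_le_sum fun x _ => h x).trans ?_
  rw [Finset.sum_comm]
  simp only [← Finset.mul_sum]
  have h2 : ∀ e, ∑ x : L → ZMod k, E (b ^ 2 * folded V L k (U.dst e, x ∘ U.perm e) ^ 2)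
      ≤ (k : ℝ) ^ Fintype.card L / k * E (b ^ 2) := by
    intro e
    rw [sum_comp_perm (U.perm e) fun x => E (b ^ 2 * folded V L k (U.dst e, x) ^ 2)]
    exact hE.sum_sq_folded_le hc hb _
  refine (Finset.sum_le_sum fun e _ =>
    mul_le_mul_of_nonneg_left (h2 e) (nbrWeight_nonneg U u e)).trans (le_of_eq ?_)
  rw [← Finset.sum_mul, h1, one_mul]

theorem IsPseudoExpectation.sum_map_neighborAvg (hE : IsPseudoExpectation 8 E)
    (hc : ∀ P ∈ UniqueGame.assignmentConstraints (V × (L → ZMod k)) (ZMod k), E (P ^ 2) = 0)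
    (U : UniqueGame V L) (hU : ∀ u, Fintype.card V * U.srcProb u = 1) :
    ∑ z, E (neighborAvg U k z) = Fintype.card V * ((k : ℝ) ^ Fintype.card L / k) := by
  have h : ∀ u, ∑ x, E (neighborAvg U k (u, x)) = (k : ℝ) ^ Fintype.card L / k := by
    intro u
    simp only [neighborAvg_eq, map_sum, map_smul, smul_eq_mul]
    rw [Finset.sum_comm]
    simp only [← Finset.mul_sum]
    have h2 : ∀ e, ∑ x : L → ZMod k, E (folded V L k (U.dst e, x ∘ U.perm e))
        = (k : ℝ) ^ Fintype.card L / k := by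
      intro e
      rw [sum_comp_perm (U.perm e) fun x => E (folded V L k (U.dst e, x))]
      exact hE.sum_map_folded hc _
    simp only [h2]
    rw [← Finset.sum_mul, sum_nbrWeight, hU, one_mul]
  rw [Fintype.sum_prod_type]
  simp only [h, Finset.sum_const, Finset.card_univ, nsmul_eq_mul]

theorem IsPseudoExpectation.youngBound_neighborAvg (hE : IsPseudoExpectation 8 E)
    (hc : ∀ P ∈ UniqueGame.assignmentConstraints (V × (L → ZMod k)) (ZMod k), E (P ^ 2) = 0)
    (U : UniqueGame V L) (hU : ∀ u, Fintype.card V * U.srcProb u = 1) (z : V × (L → ZMod k)) :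
    YoungBound (affineForms _) E (neighborAvg U k z) := by
  obtain ⟨u, x⟩ := z
  rw [neighborAvg_eq]
  exact YoungBound.sum (nbrWeight_nonneg U u) (by rw [sum_nbrWeight, hU])
    fun e => hE.youngBound_folded hc _

/-- The objective is the quadratic form of the noise operator on the averages of the folded long
codes. -/
theorem map_objective_longCodeReduction (ε : ℝ) (hε : ε ∈ Set.Ioo (0 : ℝ) 1)
    (U : UniqueGame V L) (hU : ∀ u, Fintype.card V * U.srcProb u = 1) :
    E (longCodeReduction k ε hε U).objective
      = k / (Fintype.card V * (k : ℝ) ^ Fintype.card L) *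
        ∑ u, form E (prodKernel (fun _ => 1) fun _ => 1 - ε) (fun x => neighborAvg U k (u, x)) := by
  have hk : (k : ℝ) ≠ 0 := by exact_mod_cast NeZero.ne k
  set n : ℝ := ((Fintype.card V : ℕ) : ℝ) with hn
  set N : U.Constraint → U.Constraint → ℝ := fun e e' => ∑ x : L → ZMod k, ∑ y, noise ε x y *
      E (folded V L k (U.dst e, x ∘ U.perm e) * folded V L k (U.dst e', y ∘ U.perm e')) with hN
  have hn0 : n ≠ 0 := by
    obtain ⟨e, -⟩ : ∃ e : U.Constraint, e ∈ Finset.univ := by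
      by_contra h
      push Not at h
      have := U.weight_sum
      rw [Finset.sum_eq_zero fun e he => absurd he (h e)] at this
      exact zero_ne_one this
    exact left_ne_zero_of_mul_eq_one (hU (U.src e))
  have hp : ∀ u, U.srcProb u = n⁻¹ := fun u => eq_inv_of_mul_eq_one_right (hU u)
  -- the contribution of a pair of constraints
  have hl : E (longCodeReduction k ε hε U).objective
      = ∑ e, ∑ e', if U.src e = U.src e' then
        k * n / (k : ℝ) ^ Fintype.card L * (U.weight e * U.weight e') * N e e' else 0 := by
    rw [UniqueGame.objective, map_sum]
    simp only [← smul_eq_C_mul, map_smul, map_sum, smul_eq_mul]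
    change ∑ t : U.Constraint × U.Constraint × (L → ZMod k) × (L → ZMod k) × ZMod k, _ = _
    simp only [Fintype.sum_prod_type (α₁ := U.Constraint)]
    refine Finset.sum_congr rfl fun e _ => Finset.sum_congr rfl fun e' _ => ?_
    by_cases h : U.src e = U.src e'
    · rw [if_pos h]
      simp only [longCodeReduction, if_pos h, hp]
      have hN' : N e e' = (∑ x : L → ZMod k, ∑ y, ∑ c, noise ε x y * ∑ a : ZMod k,
          E (X ((U.dst e, fun i => x (U.perm e i)), a - c) *
            X ((U.dst e', fun i => y (U.perm e' i) - c), a))) / (k : ℝ) ^ 2 := by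
        rw [sum_noise_mul_eq_folded, mul_div_cancel_left₀ _ (pow_ne_zero 2 hk)]
      rw [hN']
      simp only [Fintype.sum_prod_type, Finset.mul_sum, Finset.sum_div, Equiv.subRight_apply]
      refine Finset.sum_congr rfl fun x _ => Finset.sum_congr rfl fun y _ =>
        Finset.sum_congr rfl fun c _ => Finset.sum_congr rfl fun a _ => ?_
      field_simp
    · rw [if_neg h]
      refine Finset.sum_eq_zero fun t _ => ?_
      simp only [longCodeReduction, if_neg h, zero_mul]
  have hr : ∀ u, form E (prodKernel (fun _ => 1) fun _ => 1 - ε)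
      (fun x => neighborAvg U k (u, x))
      = ∑ e, ∑ e', nbrWeight U u e * nbrWeight U u e' * N e e' := by
    intro u
    have h : ∀ x y : L → ZMod k, noise ε x y * E (neighborAvg U k (u, x) * neighborAvg U k (u, y))
        = ∑ e, ∑ e', nbrWeight U u e * nbrWeight U u e' * (noise ε x y *
          E (folded V L k (U.dst e, x ∘ U.perm e) * folded V L k (U.dst e', y ∘ U.perm e'))) := by
      intro x y
      rw [neighborAvg_eq, neighborAvg_eq, Finset.sum_mul_sum]
      simp only [map_sum, smul_mul_smul_comm, map_smul, smul_eq_mul, Finset.mul_sum]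
      refine Finset.sum_congr rfl fun e _ => Finset.sum_congr rfl fun e' _ => ?_
      ring
    simp only [form, ← noise_eq_prodKernel, h, hN, Finset.mul_sum]
    have hswap : ∀ p : (L → ZMod k) → (L → ZMod k) → U.Constraint → U.Constraint → ℝ,
        ∑ x, ∑ y, ∑ e, ∑ e', p x y e e' = ∑ e, ∑ e', ∑ x, ∑ y, p x y e e' := by
      intro p
      simp only [← Finset.sum_product', Finset.univ_product_univ]
      exact Finset.sum_equiv ((Equiv.refl _).trans
        { toFun := fun z => (z.2.2.1, z.2.2.2, z.1, z.2.1)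
          invFun := fun z => (z.2.2.1, z.2.2.2, z.1, z.2.1)
          left_inv := fun _ => rfl
          right_inv := fun _ => rfl }) (by simp) (by simp)
    exact hswap _
  have hw : ∀ e e', ∑ u, nbrWeight U u e * nbrWeight U u e'
      = if U.src e = U.src e' then n ^ 2 * (U.weight e * U.weight e') else 0 := by
    intro e e'
    rw [Finset.sum_eq_single (U.src e)]
    · unfold nbrWeight
      rw [if_pos rfl]
      by_cases h : U.src e = U.src e'
      · rw [if_pos h, if_pos h.symm]
        ring
      · rw [if_neg h, if_neg (Ne.symm h), mul_zero]
    · intro u _ hu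
      rw [nbrWeight, if_neg (Ne.symm hu), zero_mul]
    · exact fun h => absurd (Finset.mem_univ _) h
  have hx : ∑ u, ∑ e, ∑ e', nbrWeight U u e * nbrWeight U u e' * N e e'
      = ∑ e, ∑ u, ∑ e', nbrWeight U u e * nbrWeight U u e' * N e e' := Finset.sum_comm
  rw [hl]
  simp only [hr]
  rw [hx]
  have hs : ∀ e, ∑ u, ∑ e', nbrWeight U u e * nbrWeight U u e' * N e e'
      = ∑ e', (∑ u, nbrWeight U u e * nbrWeight U u e') * N e e' := by
    intro e
    rw [Finset.sum_comm]
    simp only [Finset.sum_mul]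
  simp only [hs, hw, Finset.mul_sum]
  refine Finset.sum_congr rfl fun e _ => Finset.sum_congr rfl fun e' _ => ?_
  split_ifs
  · field_simp
  · simp

end Objective

/-! ### The bound on the relaxation -/

section Bound

theorem UniqueGame.sosOpt_le_of_forall {B S : Type} [Fintype S] {r : ℕ} {U : UniqueGame B S} {c : ℝ}
    (h : ∀ E : MvPolynomial (B × S) ℝ →ₗ[ℝ] ℝ, IsPseudoExpectation r E →
      (∀ P ∈ UniqueGame.assignmentConstraints B S, E (P ^ 2) = 0) → E U.objective ≤ c) :
    U.sosOpt r ≤ (c : EReal) := by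
  refine sSup_le ?_
  rintro v ⟨E, hE, hc, rfl⟩
  exact EReal.coe_le_coe_iff.2 (h E hE hc)

/-- In a game whose label-extended graph is the noise graph the first vertex of a random constraint
is uniform. -/
theorem card_mul_srcProb {V L : Type} [Fintype V] [Fintype L] [Nonempty L] {U : UniqueGame V L}
    {r : ℝ} (ψ : V × L ≃ (L → ZMod 2))
    (hU : ∀ p q, Fintype.card V * (Fintype.card L * U.labelExtended p q)
      = noise r (ψ p) (ψ q)) (u : V) : Fintype.card V * U.srcProb u = 1 := by
  classical
  obtain ⟨i⟩ := ‹Nonempty L›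
  have hl := U.liftKernel_isLift (Ω := Unit) (T := fun p q => noise r (ψ p) (ψ q)) hU
  have h1 : act (U.liftKernel Unit) (fun _ => (1 : ℝ)) ((u, i), fun _ => ()) = 1 := by
    simp only [act, smul_eq_mul, mul_one, Fintype.sum_prod_type (α₁ := V × L), hl.row]
    rw [ψ.sum_comp fun y => noise r (ψ (u, i)) y, noise_sum]
  rw [UniqueGame.act_liftKernel] at h1
  rw [← h1, UniqueGame.srcProb, Finset.mul_sum]
  refine Finset.sum_congr rfl fun e _ => ?_
  by_cases h : U.src e = u <;> simp [h]

/-- The bound on the value with free parameters: the number `s` of steps on the label-extended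
graph, the threshold `l` between small and large eigenvalues, and the degree `d` at which functions
are truncated. -/
theorem sosOpt_longCodeReduction_le {V L : Type} [Fintype L] [DecidableEq L] {k : ℕ} [NeZero k]
    {ε : ℝ} (hε : ε ∈ Set.Ioo (0 : ℝ) 1) {η : ℝ} (hη : η ∈ Set.Ioo (0 : ℝ) 1)
    {U : UniqueGame V L} (hU : HasNoisyCubeGraph η U) {s : ℕ}
    (hs : 2 * (1 - η) ^ (2 * s + 1) ≤ 1 - ((1 - η) ^ (2 * s + 1)) ^ 2) {l : ℝ} (hl : 0 < l)
    {q : ℝ} (hq : 0 < q) (hq4 : q ^ 4 = k) {z : ℝ} {d : ℕ} (hz : (1 - ε) ^ (d + 1) ≤ z)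
    (hz1 : z ≤ 1) :
    (longCodeReduction k ε hε U).sosOpt 8 ≤
      ((z + (1 - z) * (2 ^ d / q + 3 * q ^ 3 * (32 * (k : ℝ) ^ 2) ^ d *
        ((l⁻¹) ^ (4 * s) / Fintype.card L + l)) : ℝ) : EReal) := by
  classical
  obtain ⟨φ, hφ⟩ := hU
  have hL : Nonempty L := ⟨(φ.symm fun _ => 0).2⟩
  have hV : Nonempty V := ⟨(φ.symm fun _ => 0).1⟩
  have hfin : Finite V := by
    obtain ⟨i⟩ := hL
    exact Finite.of_injective (fun v => φ (v, i)) fun v w h => by simpa using h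
  let _ := Fintype.ofFinite V
  have hcard : (Fintype.card V : ℝ) * Fintype.card L = 2 ^ Fintype.card L := by
    have h := Fintype.card_congr φ
    rw [Fintype.card_prod, Fintype.card_fun, ZMod.card] at h
    exact_mod_cast h
  have hT : ∀ p q, Fintype.card V * (Fintype.card L * U.labelExtended p q)
      = noise η (φ p) (φ q) := by
    intro p q
    rw [hφ, ← mul_assoc, hcard, mul_div_cancel₀ _ (by positivity)]
  have hsrc := card_mul_srcProb φ hT
  have hk : (k : ℝ) ≠ 0 := by exact_mod_cast NeZero.ne k
  refine UniqueGame.sosOpt_le_of_forall fun E hE hc => ?_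
  rw [map_objective_longCodeReduction ε hε U hsrc]
  have hcz : ((Fintype.card (ZMod k) : ℕ) : ℝ) = k := by rw [ZMod.card]
  have h := hE.nonnegOnQuartics.sum_form_noise_le (Ω := ZMod k) (one_mem_affineForms _) hE.map_one U
    φ (r := 1 - η) (by linarith [hη.2]) (fun p q => by rw [hT, noise_eq_prodKernel]) hs hl hq
    (by rw [hq4, hcz]) (M := (k : ℝ) ^ Fintype.card L / k)
    (by rw [hcz, mul_div_cancel₀ _ hk]) (f := folded V L k) (g := neighborAvg U k) folded_mem rfl
    (fun b hb => by
      rw [Fintype.sum_prod_type]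
      refine (Finset.sum_le_sum fun v _ => hE.sum_sq_folded_le hc hb v).trans (le_of_eq ?_)
      rw [Finset.sum_const, Finset.card_univ, nsmul_eq_mul, mul_assoc])
    (fun b hb u => hE.sum_sq_neighborAvg_le hc U hsrc hb u)
    (hE.sum_map_neighborAvg hc U hsrc) (hE.youngBound_neighborAvg hc U hsrc)
    (ρ := 1 - ε) (by linarith [hε.2]) (by linarith [hε.1]) hz hz1
  rw [hcz] at h
  exact h

/-- The interpolation between the trivial bound and the bound for low degrees. It is applied to
`y = k ^ (-1 / 8)` and `w = y ^ (ε / 16)`. -/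
theorem add_one_sub_mul_le {w y : ℝ} (hw1 : w ≤ 1) (hw0 : 0 ≤ w) (hy : y ≤ 14 / 15)
    (hy0 : 0 ≤ y) (hyw : y ≤ w ^ 16) : w ^ 16 + (1 - w ^ 16) * y ≤ w := by
  -- with `S = w + ⋯ + w ^ 15` the difference is `(1 - w) (S - y - y S)`, and `S ≥ 15 y`
  have hS : ∀ i ∈ Finset.range 15, y ≤ w ^ (i + 1) := fun i hi =>
    hyw.trans (pow_le_pow_of_le_one hw0 hw1 (by have := Finset.mem_range.1 hi; omega))
  have hS' := Finset.card_nsmul_le_sum _ _ _ hS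
  rw [Finset.card_range, nsmul_eq_mul] at hS'
  set S := ∑ i ∈ Finset.range 15, w ^ (i + 1) with hSdef
  have e : w - w ^ 16 = (1 - w) * S := by
    rw [hSdef]
    simp only [Finset.sum_range_succ, Finset.sum_range_zero]
    ring
  have h : 0 ≤ (1 - w) * (S * (1 - y) - y) := by
    refine mul_nonneg (by linarith) ?_
    push_cast at hS'
    have := mul_le_mul_of_nonneg_right hS' (by linarith : 0 ≤ 1 - y)
    nlinarith
  have e2 : (1 - w ^ 16) = (1 - w) * (1 + S) := by linarith
  have : w - (w ^ 16 + (1 - w ^ 16) * y) = (1 - w) * (S * (1 - y) - y) := by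
    rw [e2]
    linear_combination e
  linarith

/-- The number of steps after which the correlation `1 - η` has dropped below `2 / 5`. -/
theorem exists_steps {η : ℝ} (hη : η ∈ Set.Ioo (0 : ℝ) 1) :
    ∃ s : ℕ, η * s ≤ 2 ∧ 2 * (1 - η) ^ (2 * s + 1) ≤ 1 - ((1 - η) ^ (2 * s + 1)) ^ 2 := by
  obtain ⟨h0, h1⟩ := hη
  refine ⟨⌈1 / (2 * η)⌉₊, ?_, ?_⟩
  · have h := (Nat.ceil_lt_add_one (by positivity : 0 ≤ 1 / (2 * η))).le
    have h2 := mul_le_mul_of_nonneg_left h h0.le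
    have e : η * (1 / (2 * η) + 1) = 1 / 2 + η := by field_simp
    linarith
  · set s := ⌈1 / (2 * η)⌉₊ with hs
    have h := Nat.le_ceil (1 / (2 * η))
    rw [← hs, div_le_iff₀ (by positivity)] at h
    set p := (1 - η) ^ (2 * s + 1) with hp
    have p0 : 0 ≤ p := pow_nonneg (by linarith) _
    have p1 : p ≤ Real.exp (-1) := by
      have q : p ≤ Real.exp (-η) ^ (2 * s + 1) :=
        pow_le_pow_left₀ (by linarith) (by linarith [Real.add_one_le_exp (-η)]) _
      refine q.trans ?_
      rw [← Real.exp_nat_mul]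
      refine Real.exp_le_exp.2 ?_
      push_cast
      nlinarith
    have p2 : p ≤ 2 / 5 := by
      refine p1.trans ?_
      rw [Real.exp_neg, inv_le_comm₀ (Real.exp_pos _) (by norm_num)]
      linarith [Real.exp_one_gt_d9]
    nlinarith

/-- The bound on the value, from `sosOpt_longCodeReduction_le` with the eigenvalue threshold
`l = R ^ (-η / 16)`, the degree `d = ⌊log k / 8⌋` and `z = k ^ (-ε / 8)`. -/
theorem sosOpt_longCodeReduction_le_rpow {V L : Type} [Fintype L] [DecidableEq L] {k : ℕ}
    [NeZero k] {ε : ℝ} (hε : ε ∈ Set.Ioo (0 : ℝ) 1) {η : ℝ} (hη : η ∈ Set.Ioo (0 : ℝ) 1)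
    {U : UniqueGame V L} (hk : 2 ≤ k) (hU : HasNoisyCubeGraph η U) :
    (longCodeReduction k ε hε U).sosOpt 8 ≤
      (((k : ℝ) ^ (-(1 / 128 * ε)) + (k : ℝ) ^ (7 * Real.log k) *
        (Fintype.card L : ℝ) ^ (-(1 / 16 * η)) : ℝ) : EReal) := by
  have hL : Nonempty L := ⟨(hU.choose.symm fun _ => 0).2⟩
  have hR : (0 : ℝ) < Fintype.card L := by exact_mod_cast Fintype.card_pos
  have hR1 : (1 : ℝ) ≤ Fintype.card L := by exact_mod_cast Fintype.card_pos
  have hk2 : (2 : ℝ) ≤ k := by exact_mod_cast hk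
  have hk0 : (0 : ℝ) < k := by linarith
  obtain ⟨ε0, ε1⟩ := hε
  obtain ⟨s, hs1, hs2⟩ := exists_steps hη
  obtain ⟨η0, η1⟩ := hη
  set Λ := Real.log k with hΛ
  set ρ := Real.log (Fintype.card L) with hρ
  have hρ0 : 0 ≤ ρ := Real.log_nonneg hR1
  have hΛ2 : 0.69 ≤ Λ := by
    have h := Real.log_le_log (by norm_num) hk2
    linarith [Real.log_two_gt_d9]
  have hkΛ : Real.exp Λ = k := Real.exp_log hk0
  have hRρ : Real.exp ρ = Fintype.card L := Real.exp_log hR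
  have hpow : ∀ a : ℝ, (k : ℝ) ^ a = Real.exp (Λ * a) := fun a => by
    rw [Real.rpow_def_of_pos hk0]
  have hpowR : ∀ a : ℝ, (Fintype.card L : ℝ) ^ a = Real.exp (ρ * a) := fun a => by
    rw [Real.rpow_def_of_pos hR]
  set d := ⌊Λ / 8⌋₊ with hd
  have hd1 : (d : ℝ) ≤ Λ / 8 := Nat.floor_le (by linarith)
  have hd2 : Λ / 8 ≤ d + 1 := (Nat.lt_floor_add_one _).le
  set w := Real.exp (-(Λ * ε / 128)) with hw
  set y := Real.exp (-(Λ / 8)) with hy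
  have hw16 : w ^ 16 = Real.exp (-(Λ * ε / 8)) := by
    rw [hw, ← Real.exp_nat_mul]
    congr 1
    push_cast
    ring
  have hz : (1 - ε) ^ (d + 1) ≤ w ^ 16 := by
    have q : (1 - ε) ^ (d + 1) ≤ Real.exp (-ε) ^ (d + 1) :=
      pow_le_pow_left₀ (by linarith) (by linarith [Real.add_one_le_exp (-ε)]) _
    refine q.trans ?_
    rw [hw16, ← Real.exp_nat_mul]
    refine Real.exp_le_exp.2 ?_
    push_cast
    nlinarith
  have hw1 : w ≤ 1 := Real.exp_le_one_iff.2 (by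
    have : 0 ≤ Λ * ε / 128 := by positivity
    linarith)
  have hw0 : 0 ≤ w := (Real.exp_pos _).le
  have hz1 : w ^ 16 ≤ 1 := pow_le_one₀ hw0 hw1
  set l := Real.exp (-(ρ * η / 16)) with hl
  have hq4 : Real.exp (Λ / 4) ^ 4 = k := by
    rw [← Real.exp_nat_mul, ← hkΛ]
    congr 1
    push_cast
    ring
  have hmain := sosOpt_longCodeReduction_le (k := k) ⟨ε0, ε1⟩ ⟨η0, η1⟩ hU hs2
    (Real.exp_pos _ : 0 < l) (Real.exp_pos (Λ / 4)) hq4 hz hz1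
  refine hmain.trans (EReal.coe_le_coe_iff.2 ?_)
  have hyw : y ≤ w ^ 16 := by
    rw [hw16]
    refine Real.exp_le_exp.2 ?_
    nlinarith
  have hy1 : y ≤ 14 / 15 := by
    have h8 : y ^ 8 ≤ (14 / 15) ^ 8 := by
      have e : y ^ 8 = (k : ℝ)⁻¹ := by
        rw [hy, ← Real.exp_nat_mul, ← hkΛ, ← Real.exp_neg]
        congr 1
        push_cast
        ring
      rw [e]
      refine (inv_anti₀ two_pos hk2).trans ?_
      norm_num
    exact (pow_le_pow_iff_left₀ (Real.exp_pos _).le (by norm_num) (by norm_num)).1 h8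
  have hint := add_one_sub_mul_le hw1 hw0 hy1 (Real.exp_pos _).le hyw
  have h2d : 2 ^ d / Real.exp (Λ / 4) ≤ y := by
    rw [div_le_iff₀ (Real.exp_pos _), hy, ← Real.exp_add]
    have q : (2 : ℝ) ^ d ≤ Real.exp 1 ^ d :=
      pow_le_pow_left₀ two_pos.le (by linarith [Real.exp_one_gt_d9]) _
    refine q.trans ?_
    rw [← Real.exp_nat_mul]
    refine Real.exp_le_exp.2 ?_
    linarith
  have hδ : (l⁻¹) ^ (4 * s) / Fintype.card L + l ≤ 2 * l := by
    have q : (l⁻¹) ^ (4 * s) / Fintype.card L ≤ l := by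
      rw [hl, ← Real.exp_neg, ← Real.exp_nat_mul, ← hRρ, ← Real.exp_sub]
      refine Real.exp_le_exp.2 ?_
      push_cast
      have h1 := mul_le_mul_of_nonneg_left hs1 hρ0
      have h2 := mul_le_mul_of_nonneg_left η1.le hρ0
      linarith
    linarith
  have herr : 3 * Real.exp (Λ / 4) ^ 3 * (32 * (k : ℝ) ^ 2) ^ d *
      ((l⁻¹) ^ (4 * s) / Fintype.card L + l)
      ≤ (k : ℝ) ^ (7 * Λ) * (Fintype.card L : ℝ) ^ (-(1 / 16 * η)) := by
    have e1 : (Fintype.card L : ℝ) ^ (-(1 / 16 * η)) = l := by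
      rw [hpowR, hl]
      congr 1
      ring
    rw [e1, hpow]
    have q1 : (32 * (k : ℝ) ^ 2) ^ d ≤ Real.exp (7 * Λ * (Λ / 8)) := by
      have q2 : 32 * (k : ℝ) ^ 2 ≤ Real.exp (7 * Λ) := by
        have e : Real.exp (7 * Λ) = (k : ℝ) ^ 5 * (k : ℝ) ^ 2 := by
          rw [← hkΛ, ← pow_add, ← Real.exp_nat_mul]
          norm_num
        rw [e]
        have := pow_le_pow_left₀ two_pos.le hk2 5
        norm_num at this
        exact mul_le_mul_of_nonneg_right this (by positivity)
      refine (pow_le_pow_left₀ (by positivity) q2 d).trans ?_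
      rw [← Real.exp_nat_mul]
      refine Real.exp_le_exp.2 ?_
      nlinarith
    -- the constant `6` is absorbed by `k ^ 3`, as `k ≥ 2`
    have q3 : 6 * Real.exp (Λ / 4) ^ 3 ≤ Real.exp (3 * Λ + 3 * Λ / 4) := by
      rw [Real.exp_add, ← Real.exp_nat_mul]
      have e : Real.exp (3 * Λ) = (k : ℝ) ^ 3 := by
        rw [← hkΛ, ← Real.exp_nat_mul]
        norm_num
      have e' : ((3 : ℕ) : ℝ) * (Λ / 4) = 3 * Λ / 4 := by push_cast; ring
      rw [e, e']
      have := pow_le_pow_left₀ two_pos.le hk2 3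
      exact mul_le_mul_of_nonneg_right (by linarith) (Real.exp_pos _).le
    calc 3 * Real.exp (Λ / 4) ^ 3 * (32 * (k : ℝ) ^ 2) ^ d *
          ((l⁻¹) ^ (4 * s) / Fintype.card L + l)
        ≤ 3 * Real.exp (Λ / 4) ^ 3 * (32 * (k : ℝ) ^ 2) ^ d * (2 * l) :=
          mul_le_mul_of_nonneg_left hδ (by positivity)
      _ = 6 * Real.exp (Λ / 4) ^ 3 * (32 * (k : ℝ) ^ 2) ^ d * l := by ring
      _ ≤ Real.exp (3 * Λ + 3 * Λ / 4) * Real.exp (7 * Λ * (Λ / 8)) * l := by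
          gcongr
      _ ≤ Real.exp (Λ * (7 * Λ)) * l := by
          rw [← Real.exp_add]
          refine mul_le_mul_of_nonneg_right (Real.exp_le_exp.2 ?_) (Real.exp_pos _).le
          nlinarith
  have e2 : (k : ℝ) ^ (-(1 / 128 * ε)) = w := by
    rw [hpow, hw]
    congr 1
    ring
  rw [e2]
  have herr0 : 0 ≤ 3 * Real.exp (Λ / 4) ^ 3 * (32 * (k : ℝ) ^ 2) ^ d *
      ((l⁻¹) ^ (4 * s) / Fintype.card L + l) := by positivity
  have hz0 : 0 ≤ w ^ 16 := pow_nonneg hw0 _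
  have h3 := mul_le_mul_of_nonneg_left h2d (by linarith : 0 ≤ 1 - w ^ 16)
  have h4 := mul_nonneg hz0 herr0
  linarith

/-- The error term is a small fraction of the main term for large alphabets of the given game. -/
theorem error_le {k : ℕ} (hk : 2 ≤ k) {ε η : ℝ} (hε : ε ∈ Set.Ioo (0 : ℝ) 1) (hη : 0 < η)
    {R : ℕ} (hR : 0 < R) {κ : ℝ} (hκ : 0 < κ)
    (h : 16 * (8 + 3 * |Real.log κ|) * Real.log k ^ 2 / η ≤ Real.log R) :
    (k : ℝ) ^ (7 * Real.log k) * (R : ℝ) ^ (-(1 / 16 * η)) ≤ κ * (k : ℝ) ^ (-(1 / 128 * ε)) := by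
  have hk2 : (2 : ℝ) ≤ k := by exact_mod_cast hk
  have hk0 : (0 : ℝ) < k := by linarith
  have hΛ2 : 0.69 ≤ Real.log k := by
    have h := Real.log_le_log (by norm_num) hk2
    linarith [Real.log_two_gt_d9]
  rw [Real.rpow_def_of_pos hk0, Real.rpow_def_of_pos hk0,
    Real.rpow_def_of_pos (by exact_mod_cast hR), ← Real.exp_add]
  conv_rhs => rw [← Real.exp_log hκ, ← Real.exp_add]
  refine Real.exp_le_exp.2 ?_
  set Λ := Real.log k
  rw [div_le_iff₀ hη] at h
  have h1 := neg_abs_le (Real.log κ)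
  have h2 : |Real.log κ| ≤ 3 * |Real.log κ| * Λ ^ 2 := by
    have : (1 : ℝ) ≤ 3 * Λ ^ 2 := by nlinarith
    nlinarith [abs_nonneg (Real.log κ)]
  have h3 : Λ * ε ≤ 2 * Λ ^ 2 := by nlinarith [hε.2]
  nlinarith

end Bound

/-! ### The quotient noisy cube -/

section QuotientCube

variable {m : ℕ}

theorem hadamard_injective (m : ℕ) : Function.Injective (hadamard m) := by
  intro s t h
  funext i
  have := congrFun h (Pi.single i 1)
  simpa [hadamard, Pi.single_apply] using this

theorem hadamard_label (x : (Fin m → ZMod 2) → ZMod 2) :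
    hadamard m (label x) = x - cosetRep (Submodule.Quotient.mk x : CubeQuotient m) :=
  (exists_label x).choose_spec

theorem mk_cosetRep_add (u : CubeQuotient m) (s : Fin m → ZMod 2) :
    (Submodule.Quotient.mk (cosetRep u + hadamard m s) : CubeQuotient m) = u := by
  have h : (Submodule.Quotient.mk (cosetRep u) : CubeQuotient m) = u := Quotient.out_eq _
  conv_rhs => rw [← h]
  exact (Submodule.Quotient.eq _).2 ⟨s, (add_sub_cancel_left _ _).symm⟩

theorem label_cosetRep_add (u : CubeQuotient m) (s : Fin m → ZMod 2) :
    label (cosetRep u + hadamard m s) = s := by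
  refine hadamard_injective m ?_
  rw [hadamard_label, mk_cosetRep_add, add_sub_cancel_left]

/-- A point of the cube is given by its coset and its label. -/
def cosetLabelEquiv (m : ℕ) :
    CubeQuotient m × (Fin m → ZMod 2) ≃ ((Fin m → ZMod 2) → ZMod 2) where
  toFun p := cosetRep p.1 + hadamard m p.2
  invFun x := (Submodule.Quotient.mk x, label x)
  left_inv p := Prod.ext (mk_cosetRep_add _ _) (label_cosetRep_add _ _)
  right_inv x := by
    change cosetRep (Submodule.Quotient.mk x : CubeQuotient m) + hadamard m (label x) = x
    rw [hadamard_label, add_sub_cancel]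

theorem noise_add_right {L : Type} [Fintype L] (η : ℝ) (x y h : L → ZMod 2) :
    noise η (x + h) (y + h) = noise η x y := by
  simp [noise]

/-- The label-extended graph of the quotient noisy cube is the noise graph: the constraints
contributing to one of its edges are the translates of the edge by the codewords. -/
theorem hasNoisyCubeGraph_khotVishnoi (m : ℕ) (η : ℝ) (hη : η ∈ Set.Ioo (0 : ℝ) 1) :
    HasNoisyCubeGraph η (khotVishnoi m η hη) := by
  classical
  refine ⟨cosetLabelEquiv m, fun p q => ?_⟩
  set φ := cosetLabelEquiv m with hφ
  have hm : ∀ z, (Submodule.Quotient.mk (φ z) : CubeQuotient m) = z.1 := fun z =>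
    mk_cosetRep_add _ _
  have hl : ∀ z, label (φ z) = z.2 := fun z => label_cosetRep_add _ _
  have htr : ∀ b, noise η (φ (p.1, p.2 - q.2 + b)) (φ (q.1, b)) = noise η (φ p) (φ q) := by
    intro b
    rw [← noise_add_right η (φ p) (φ q) (hadamard m (b - q.2))]
    congr 1 <;> simp only [hφ, cosetLabelEquiv, Equiv.coe_fn_mk, add_assoc, ← map_add]
    · congr 2
      abel
    · congr 2
      abel
  have hcard : Fintype.card (Fin m → ZMod 2) = 2 ^ m := by simp [ZMod.card]
  have key : (∑ e, if (khotVishnoi m η hη).src e = p.1 ∧ (khotVishnoi m η hη).dst e = q.1 ∧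
      (khotVishnoi m η hη).perm e q.2 = p.2 then (khotVishnoi m η hη).weight e else 0)
      = (Fintype.card (Fin m → ZMod 2) : ℝ) * (1 / 2 ^ 2 ^ m * noise η (φ p) (φ q)) := by
    change (∑ e : ((Fin m → ZMod 2) → ZMod 2) × ((Fin m → ZMod 2) → ZMod 2),
      if Submodule.Quotient.mk e.1 = p.1 ∧ Submodule.Quotient.mk e.2 = q.1 ∧
        q.2 + (label e.1 - label e.2) = p.2 then 1 / 2 ^ 2 ^ m * noise η e.1 e.2 else 0) = _
    rw [← (φ.prodCongr φ).sum_comp, Fintype.sum_prod_type_right]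
    simp only [Equiv.prodCongr_apply, Prod.map_apply, hm, hl]
    rw [Fintype.sum_prod_type, Finset.sum_eq_single q.1]
    · have h : ∀ b : Fin m → ZMod 2, ∑ z : CubeQuotient m × (Fin m → ZMod 2),
          (if z.1 = p.1 ∧ q.1 = q.1 ∧ q.2 + (z.2 - b) = p.2 then
            1 / 2 ^ 2 ^ m * noise η (φ z) (φ (q.1, b)) else 0)
          = 1 / 2 ^ 2 ^ m * noise η (φ p) (φ q) := by
        intro b
        rw [Finset.sum_eq_single (p.1, p.2 - q.2 + b)]
        · rw [if_pos ⟨rfl, rfl, by rw [add_sub_cancel_right, add_sub_cancel]⟩, htr]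
        · rintro ⟨u, a⟩ _ hne
          refine if_neg ?_
          rintro ⟨rfl, -, h⟩
          refine hne (Prod.ext rfl ?_)
          rw [← h, add_sub_cancel_left, sub_add_cancel]
        · exact fun h => absurd (Finset.mem_univ _) h
      refine (Finset.sum_congr rfl fun b _ => h b).trans ?_
      rw [Finset.sum_const, Finset.card_univ, nsmul_eq_mul]
    · intro v _ hv
      exact Finset.sum_eq_zero fun b _ => Finset.sum_eq_zero fun z _ =>
        if_neg fun h => hv h.2.1
    · exact fun h => absurd (Finset.mem_univ _) h
  have hR : (Fintype.card (Fin m → ZMod 2) : ℝ) ≠ 0 := by simp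
  rw [UniqueGame.labelExtended]
  rw [show (∑ e, _ : ℝ) = _ from (Finset.sum_congr rfl fun e _ => by congr).trans key]
  rw [mul_div_cancel_left₀ _ hR, hcard]
  ring

end QuotientCube

end SoSUniqueGames

theorem mainTheorem6 :
    ∃ c₁ C c₂ : ℝ, 0 < c₁ ∧ 0 < C ∧ 0 < c₂ ∧
      -- the bound on the optimal value of the level-8 relaxation
      (∀ (V L : Type) [Fintype L] [DecidableEq L] (k : ℕ) [NeZero k]
        (ε : ℝ) (hε : ε ∈ Set.Ioo (0 : ℝ) 1) (η : ℝ) (U : SoSUniqueGames.UniqueGame V L),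
        2 ≤ k → η ∈ Set.Ioo (0 : ℝ) 1 → SoSUniqueGames.HasNoisyCubeGraph η U →
        (SoSUniqueGames.longCodeReduction k ε hε U).sosOpt 8 ≤
          (((k : ℝ) ^ (-(c₁ * ε)) +
            (k : ℝ) ^ (C * Real.log k) * (Fintype.card L : ℝ) ^ (-(c₂ * η)) : ℝ) : EReal)) ∧
      -- it is close to `1 / k ^ (c₁ ε)` if `log R ≫ (log k)² / η`
      (∀ κ : ℝ, 0 < κ → ∃ K : ℝ, 0 < K ∧
        ∀ (V L : Type) [Fintype L] [DecidableEq L] (k : ℕ) [NeZero k]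
          (ε : ℝ) (hε : ε ∈ Set.Ioo (0 : ℝ) 1) (η : ℝ) (U : SoSUniqueGames.UniqueGame V L),
          2 ≤ k → η ∈ Set.Ioo (0 : ℝ) 1 → SoSUniqueGames.HasNoisyCubeGraph η U →
          K * Real.log k ^ 2 / η ≤ Real.log (Fintype.card L) →
          (SoSUniqueGames.longCodeReduction k ε hε U).sosOpt 8 ≤
            (((1 + κ) * (k : ℝ) ^ (-(c₁ * ε)) : ℝ) : EReal)) ∧
      -- eight rounds certify the value `1 / 100`
      (∃ K : ℝ, 0 < K ∧ ∀ (ε : ℝ) (hε : ε ∈ Set.Ioo (0 : ℝ) 1), ∃ k₀ : ℕ,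
        ∀ (V L : Type) [Fintype L] [DecidableEq L] (k : ℕ) [NeZero k]
          (η : ℝ) (U : SoSUniqueGames.UniqueGame V L),
          2 ≤ k → k₀ ≤ k → η ∈ Set.Ioo (0 : ℝ) 1 → SoSUniqueGames.HasNoisyCubeGraph η U →
          K * Real.log k ^ 2 / η ≤ Real.log (Fintype.card L) →
          (SoSUniqueGames.longCodeReduction k ε hε U).sosOpt 8 ≤ ((1 / 100 : ℝ) : EReal)) ∧
      -- the quotient noisy cube is such an instance `U`, for every alphabet size `R = 2 ^ m`
      (∀ (m : ℕ) (η : ℝ) (hη : η ∈ Set.Ioo (0 : ℝ) 1),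
        SoSUniqueGames.HasNoisyCubeGraph η (SoSUniqueGames.khotVishnoi m η hη)) := by
  have close : ∀ κ : ℝ, 0 < κ → ∃ K : ℝ, 0 < K ∧
      ∀ (V L : Type) [Fintype L] [DecidableEq L] (k : ℕ) [NeZero k]
        (ε : ℝ) (hε : ε ∈ Set.Ioo (0 : ℝ) 1) (η : ℝ) (U : SoSUniqueGames.UniqueGame V L),
        2 ≤ k → η ∈ Set.Ioo (0 : ℝ) 1 → SoSUniqueGames.HasNoisyCubeGraph η U →
        K * Real.log k ^ 2 / η ≤ Real.log (Fintype.card L) →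
        (SoSUniqueGames.longCodeReduction k ε hε U).sosOpt 8 ≤
          (((1 + κ) * (k : ℝ) ^ (-(1 / 128 * ε)) : ℝ) : EReal) := by
    intro κ hκ
    refine ⟨16 * (8 + 3 * |Real.log κ|), by positivity, ?_⟩
    intro V L _ _ k _ ε hε η U hk hη hU hR
    refine (SoSUniqueGames.sosOpt_longCodeReduction_le_rpow hε hη hk hU).trans
      (EReal.coe_le_coe_iff.2 ?_)
    have hL : Nonempty L := ⟨(hU.choose.symm fun _ => 0).2⟩
    have h := SoSUniqueGames.error_le hk hε hη.1 Fintype.card_pos hκ hR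
    linarith
  refine ⟨1 / 128, 7, 1 / 16, by norm_num, by norm_num, by norm_num, ?_, close, ?_,
    SoSUniqueGames.hasNoisyCubeGraph_khotVishnoi⟩
  · intro V L _ _ k _ ε hε η U hk hη hU
    exact SoSUniqueGames.sosOpt_longCodeReduction_le_rpow hε hη hk hU
  · obtain ⟨K, hK, h⟩ := close 1 one_pos
    refine ⟨K, hK, fun ε hε => ⟨⌈(200 : ℝ) ^ (128 / ε)⌉₊, ?_⟩⟩
    intro V L _ _ k _ η U hk hk0 hη hU hR
    refine (h V L k ε hε η U hk hη hU hR).trans (EReal.coe_le_coe_iff.2 ?_)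
    have h1 : (200 : ℝ) ^ (128 / ε) ≤ k := (Nat.le_ceil _).trans (by exact_mod_cast hk0)
    have h2 : (200 : ℝ) ≤ (k : ℝ) ^ (1 / 128 * ε) := by
      have h3 := Real.rpow_le_rpow (by positivity) h1
        (by have := hε.1; positivity : 0 ≤ 1 / 128 * ε)
      rw [← Real.rpow_mul (by norm_num)] at h3
      have e : 128 / ε * (1 / 128 * ε) = 1 := by
        have := hε.1.ne'
        field_simp
      rwa [e, Real.rpow_one] at h3
    rw [Real.rpow_neg (Nat.cast_nonneg k)]
    have h4 := inv_anti₀ (by norm_num) h2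
    linarith

end
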